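/- Let $n\ge 1$ be an integer and let $(\mathcal C,\mathbb E,\mathfrak s)$ be an $n$-exangulated category in the sense of Herschend–Liu–Nakaoka. That is, $\mathcal C$ is an additive category, $\mathbb E\colon\mathcal C^{\mathrm{op}}\times\mathcal C\to\mathsf{Ab}$ is a biadditive functor, and $\mathfrak s$ is an exact realisation of $\mathbb E$ satisfying (EA1), (EA2) and (EA2)$^{\mathrm{op}}$. The realisation assigns to each $\delta\in\mathbb E(C,A)$ a class $\mathfrak s(\delta)=[X_\bullet]$ of complexes $X_0=A\to X_1\to\cdots\to X_n\to X_{n+1}=C$, up to homotopy equivalence that is the identity on $A$ and on $C$. For $a\colon A\to B$ and $c\colon D\to C$ write $a_{\mathbb E}\delta=\mathbb E(C,a)(\delta)$ and $c^{\mathbb E}\delta=\mathbb E(c,A)(\delta)$. An $n$-exangulated functor $(\mathscr F,\Lambda)\colon(\mathcal C,\mathbb E,\mathfrak s)\to(\mathcal C',\mathbb E',\mathfrak s')$ is an additive functor $\mathscr F\colon\mathcal C\to\mathcal C'$ with a natural transformation $\Lambda\colon\mathbb E(-,-)\Rightarrow\mathbb E'(\mathscr F-,\mathscr F-)$ such that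 $\mathfrak s(\delta)=[X_\bullet]$ implies $\mathfrak s'(\Lambda(\delta))=[\mathscr F(X_\bullet)]$. Composition is $(\mathscr L,\Phi)\circ(\mathscr F,\Lambda)=(\mathscr L\mathscr F,\Phi_{\mathscr F\times\mathscr F}\circ\Lambda)$. A natural transformation $\beta\colon\mathscr F\Rightarrow\mathscr G$ is $n$-exangulated, as a transformation $(\mathscr F,\Lambda)\Rightarrow(\mathscr G,\Theta)$, if $(\beta_A)_{\mathbb E'}\Lambda(\delta)=(\beta_C)^{\mathbb E'}\Theta(\delta)$ for all $\delta\in\mathbb E(C,A)$. It is an $n$-exangulated natural isomorphism if it also has an $n$-exangulated inverse. An $n$-exangulated category is idempotent complete if every idempotent of its underlying category splits. Let $\widetilde{\mathcal C}$ be the idempotent completion (Karoubi envelope) of $\mathcal C$, with objects the pairs $(X,e)$ where $e=e^2\in\operatorname{End}_{\mathcal C}(X)$, and let $\mathscr I_{\mathcal C}\colon\mathcal C\to\widetilde{\mathcal C}$, $X\mapsto(X,1_X)$, be the inclusion. Define $$\mathbb F\big((Z,e'),(X,e)\big)=\{(e,\delta,e')\mid\delta\in\mathbb E(Z,X),\ e_{\mathbb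 E}\delta=\delta=(e')^{\mathbb E}\delta\},$$ with $\mathbb F$ acting on morphisms as $\mathbb E$ does. Define $\mathfrak t(e,\delta,e')=[(X_\bullet,e_\bullet)]$, where $\mathfrak s(\delta)=[X_\bullet]$, $e_\bullet\colon X_\bullet\to X_\bullet$ is any idempotent morphism of complexes with $e_0=e$ and $e_{n+1}=e'$, and $(X_\bullet,e_\bullet)$ is the complex in $\widetilde{\mathcal C}$ with terms $(X_i,e_i)$ and differentials $e_{i+1}d_i^Xe_i$. Let $\Gamma\colon\mathbb E(-,-)\Rightarrow\mathbb F(\mathscr I_{\mathcal C}-,\mathscr I_{\mathcal C}-)$ be given by $\Gamma(\delta)=(1,\delta,1)$. Then $(\widetilde{\mathcal C},\mathbb F,\mathfrak t)$ is an idempotent complete $n$-exangulated category, and $(\mathscr I_{\mathcal C},\Gamma)\colon(\mathcal C,\mathbb E,\mathfrak s)\to(\widetilde{\mathcal C},\mathbb F,\mathfrak t)$ is an $n$-exangulated functor. Moreover, for every $n$-exangulated functor $(\mathscr F,\Lambda)\colon(\mathcal C,\mathbb E,\mathfrak s)\to(\mathcal C',\mathbb E',\mathfrak s')$ to an idempotent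 complete $n$-exangulated category, the following hold. (i) There are an $n$-exangulated functor $(\mathscr E,\Psi)\colon(\widetilde{\mathcal C},\mathbb F,\mathfrak t)\to(\mathcal C',\mathbb E',\mathfrak s')$ and an $n$-exangulated natural isomorphism $\tau\colon(\mathscr F,\Lambda)\Rightarrow(\mathscr E,\Psi)\circ(\mathscr I_{\mathcal C},\Gamma)$. (ii) Let $(\mathscr G,\Theta),(\mathscr H,\Phi)\colon(\widetilde{\mathcal C},\mathbb F,\mathfrak t)\to(\mathcal C',\mathbb E',\mathfrak s')$ be $n$-exangulated functors, and let $\beta\colon(\mathscr F,\Lambda)\Rightarrow(\mathscr G,\Theta)\circ(\mathscr I_{\mathcal C},\Gamma)$ and $\gamma\colon(\mathscr F,\Lambda)\Rightarrow(\mathscr H,\Phi)\circ(\mathscr I_{\mathcal C},\Gamma)$ be $n$-exangulated natural isomorphisms. Then there is a unique natural isomorphism $\mu\colon\mathscr G\Rightarrow\mathscr H$ with $\gamma=\mu_{\mathscr I_{\mathcal C}}\circ\beta$, and $\mu$ is an $n$-exangulated natural isomorphism $(\mathscr G,\Theta)\Rightarrow(\mathscr H,\Phi)$. -/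

import Mathlib

open CategoryTheory CategoryTheory.Limits CategoryTheory.Idempotents Opposite

universe w v u v' u' v'' u''

namespace NExang

/-! ### Biadditive functors and extensions -/

section Extensions

/-- Functors `𝒞ᵒᵖ × 𝒞 ⥤ Ab`, in curried form: `(E.obj (op C)).obj A` is `E(C, A)`. -/
abbrev Bifunctor (𝒞 : Type u) [Category.{v} 𝒞] : Type (max u v (w + 1)) :=
  𝒞ᵒᵖ ⥤ 𝒞 ⥤ AddCommGrpCat.{w}

variable {𝒞 : Type u} [Category.{v} 𝒞]

/-- The abelian group `E(C, A)`; its elements are the `E`-extensions of `C` by `A`. -/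
abbrev Ext (E : Bifunctor.{w} 𝒞) (C A : 𝒞) : Type w := (E.obj (op C)).obj A

/-- `a_E = E(C, a) : E(C, A) → E(C, B)`, for `a : A ⟶ B`. -/
def push (E : Bifunctor.{w} 𝒞) {C A B : 𝒞} (a : A ⟶ B) : Ext E C A →+ Ext E C B :=
  ((E.obj (op C)).map a).hom

/-- `c^E = E(c, A) : E(C, A) → E(D, A)`, for `c : D ⟶ C`. -/
def pull (E : Bifunctor.{w} 𝒞) {C D A : 𝒞} (c : D ⟶ C) : Ext E C A →+ Ext E D A :=
  ((E.map c.op).app A).hom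

@[simp]
lemma push_id (E : Bifunctor.{w} 𝒞) {C A : 𝒞} (δ : Ext E C A) : push E (𝟙 A) δ = δ := by
  simp [push]

@[simp]
lemma pull_id (E : Bifunctor.{w} 𝒞) {C A : 𝒞} (δ : Ext E C A) : pull E (𝟙 C) δ = δ := by
  simp [pull]

lemma push_comp (E : Bifunctor.{w} 𝒞) {C A B D : 𝒞} (a : A ⟶ B) (b : B ⟶ D) (δ : Ext E C A) :
    push E (a ≫ b) δ = push E b (push E a δ) := by
  simp [push]

lemma pull_comp (E : Bifunctor.{w} 𝒞) {C D B A : 𝒞} (c : D ⟶ C) (d : B ⟶ D) (δ : Ext E C A) :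
    pull E (d ≫ c) δ = pull E d (pull E c δ) := by
  simp [pull]

lemma push_pull (E : Bifunctor.{w} 𝒞) {C D A B : 𝒞} (a : A ⟶ B) (c : D ⟶ C) (δ : Ext E C A) :
    push E a (pull E c δ) = pull E c (push E a δ) :=
  (ConcreteCategory.congr_hom ((E.map c.op).naturality a) δ).symm

/-- `E` is additive in each of its two variables. -/
structure IsBiadditive [Preadditive 𝒞] (E : Bifunctor.{w} 𝒞) : Prop where
  push_add : ∀ {C A B : 𝒞} (a a' : A ⟶ B) (δ : Ext E C A),
    push E (a + a') δ = push E a δ + push E a' δ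
  pull_add : ∀ {C D A : 𝒞} (c c' : D ⟶ C) (δ : Ext E C A),
    pull E (c + c') δ = pull E c δ + pull E c' δ

end Extensions

/-! ### `(n+2)`-term complexes with prescribed ends -/

section Complexes

variable {𝒞 : Type u} [Category.{v} 𝒞] [Preadditive 𝒞]

/-- Complexes `X₀ ⟶ X₁ ⟶ ⋯ ⟶ Xₙ ⟶ Xₙ₊₁` concentrated in degrees `0, …, n+1` with first term `A`
and last term `C`.  The first and last terms are identified with `A` and `C` by specified
isomorphisms rather than by equality of objects.  Every such complex is isomorphic, compatibly with
the identifications of the ends, to one whose identifications are identities, so that isomorphism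
classes (up to homotopy, relative to the ends) are the same as for equality of objects. -/
structure NComplex (n : ℕ) (A C : 𝒞) where
  /-- the complex -/
  K : CochainComplex 𝒞 ℕ
  isZero : ∀ i, n + 1 < i → IsZero (K.X i)
  /-- identification of the first term -/
  left : K.X 0 ≅ A
  /-- identification of the last term -/
  right : K.X (n + 1) ≅ C

namespace NComplex

variable {n : ℕ} {A B C D : 𝒞}

/-- The differential `d₀`, as a morphism out of `A`. -/
def dFirst (X : NComplex n A C) : A ⟶ X.K.X 1 := X.left.inv ≫ X.K.d 0 1

/-- The differential `dₙ`, as a morphism into `C`. -/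
def dLast (X : NComplex n A C) : X.K.X n ⟶ C := X.K.d n (n + 1) ≫ X.right.hom

/-- The morphism of complexes `f` is a lift of the pair `(a, c)`, that is `f₀ = a` and
`fₙ₊₁ = c`. -/
def Lifts {X : NComplex n A C} {Y : NComplex n B D} (f : X.K ⟶ Y.K) (a : A ⟶ B) (c : C ⟶ D) :
    Prop :=
  f.f 0 ≫ Y.left.hom = X.left.hom ≫ a ∧ f.f (n + 1) ≫ Y.right.hom = X.right.hom ≫ c

/-- Homotopy equivalence relative to the ends: an isomorphism in the category whose objects are the
complexes from `A` to `C`, and whose morphisms are homotopy classes of the morphisms of complexes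
that are the identity on `A` and on `C`.  The homotopies are the usual ones. -/
def HtpyEquiv (X Y : NComplex n A C) : Prop :=
  ∃ (f : X.K ⟶ Y.K) (g : Y.K ⟶ X.K),
    Lifts (X := X) (Y := Y) f (𝟙 A) (𝟙 C) ∧ Lifts (X := Y) (Y := X) g (𝟙 A) (𝟙 C) ∧
    Nonempty (Homotopy (f ≫ g) (𝟙 X.K)) ∧ Nonempty (Homotopy (g ≫ f) (𝟙 Y.K))

/-- The class `[X]` of `X`. -/
def cls (X : NComplex n A C) : Set (NComplex n A C) := {Y | HtpyEquiv X Y}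

/-- The image of a complex under an additive functor. -/
def map {𝒞' : Type u'} [Category.{v'} 𝒞'] [Preadditive 𝒞'] (F : 𝒞 ⥤ 𝒞') [F.Additive]
    (X : NComplex n A C) : NComplex n (F.obj A) (F.obj C) where
  K := (F.mapHomologicalComplex _).obj X.K
  isZero i hi := F.map_isZero (X.isZero i hi)
  left := F.mapIso X.left
  right := F.mapIso X.right

/-- `⟨X, δ⟩` is an `n`-exangle for `(𝒞, E)`: it is an `E`-attached complex, and the two sequences
`𝒞(-, X₀) ⟶ 𝒞(-, X₁) ⟶ ⋯ ⟶ 𝒞(-, Xₙ₊₁) ⟶ E(-, X₀)` and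
`𝒞(Xₙ₊₁, -) ⟶ 𝒞(Xₙ, -) ⟶ ⋯ ⟶ 𝒞(X₀, -) ⟶ E(Xₙ₊₁, -)` are exact at all their inner terms. -/
structure IsNExangle (E : Bifunctor.{w} 𝒞) (X : NComplex n A C) (δ : Ext E C A) : Prop where
  push_eq_zero : push E X.dFirst δ = 0
  pull_eq_zero : pull E X.dLast δ = 0
  exact_covariant : ∀ i, i < n → ∀ {W : 𝒞} (g : W ⟶ X.K.X (i + 1)),
    g ≫ X.K.d (i + 1) (i + 2) = 0 → ∃ h : W ⟶ X.K.X i, h ≫ X.K.d i (i + 1) = g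
  exact_covariant_last : ∀ {W : 𝒞} (g : W ⟶ C), pull E g δ = 0 → ∃ h : W ⟶ X.K.X n, h ≫ X.dLast = g
  exact_contravariant : ∀ i, i < n → ∀ {W : 𝒞} (g : X.K.X (i + 1) ⟶ W),
    X.K.d i (i + 1) ≫ g = 0 → ∃ h : X.K.X (i + 2) ⟶ W, X.K.d (i + 1) (i + 2) ≫ h = g
  exact_contravariant_last : ∀ {W : 𝒞} (g : A ⟶ W), push E g δ = 0 →
    ∃ h : X.K.X 1 ⟶ W, X.dFirst ≫ h = g

/-- `X` is a copy of the complex `triv₀(A) = (A = A ⟶ 0 ⟶ ⋯ ⟶ 0)`. -/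
structure IsTrivFirst (X : NComplex n A C) : Prop where
  isIso : IsIso (X.K.d 0 1)
  isZero : ∀ i, 1 < i → IsZero (X.K.X i)

/-- `X` is a copy of the complex `trivₙ(C) = (0 ⟶ ⋯ ⟶ 0 ⟶ C = C)`. -/
structure IsTrivLast (X : NComplex n A C) : Prop where
  isIso : IsIso (X.K.d n (n + 1))
  isZero : ∀ i, i < n → IsZero (X.K.X i)

variable [HasBinaryBiproducts 𝒞]

/-- `M` is a mapping cone of a morphism `f : X ⟶ Y` (with `f₀ = id`), that is, the complex
`X₁ ⟶ X₂ ⊞ Y₁ ⟶ X₃ ⊞ Y₂ ⟶ ⋯ ⟶ Xₙ₊₁ ⊞ Yₙ ⟶ Yₙ₊₁`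
with differentials `(-d^X, f)`, `((-d^X, f), (0, d^Y))` and `(f, d^Y)`.  It is unique up to the
choice of the direct sums.  The maps are given by their components: `biprod.lift` has the components
of a map into a direct sum, `biprod.desc` those of a map out of one. -/
def IsMappingCone {X : NComplex n A C} {Y : NComplex n A D} (f : X.K ⟶ Y.K)
    (M : NComplex n (X.K.X 1) D) : Prop :=
  ∃ φ : ∀ i, 1 ≤ i → i ≤ n → (M.K.X i ≅ X.K.X (i + 1) ⊞ Y.K.X i),
    (∀ h : 1 ≤ n, M.dFirst ≫ (φ 1 le_rfl h).hom = biprod.lift (-X.K.d 1 2) (f.f 1)) ∧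
    (∀ i (h₁ : 1 ≤ i) (h₂ : i + 1 ≤ n),
      (φ i h₁ (by omega)).inv ≫ M.K.d i (i + 1) ≫ (φ (i + 1) (by omega) h₂).hom =
        biprod.desc (biprod.lift (-X.K.d (i + 1) (i + 2)) (f.f (i + 1)))
          (biprod.lift 0 (Y.K.d i (i + 1)))) ∧
    (∀ h : 1 ≤ n, (φ n h le_rfl).inv ≫ M.dLast =
      biprod.desc (f.f (n + 1) ≫ Y.right.hom) Y.dLast)

/-- `M` is a mapping cocone of a morphism `f : X ⟶ Y` (with `fₙ₊₁ = id`), that is, the complex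
`X₀ ⟶ X₁ ⊞ Y₀ ⟶ X₂ ⊞ Y₁ ⟶ ⋯ ⟶ Xₙ ⊞ Yₙ₋₁ ⟶ Yₙ`
with differentials `(d^X, f)`, `((d^X, f), (0, -d^Y))` and `(f, -d^Y)`.  It is the dual of the
mapping cone: in the opposite category it is the mapping cone of `fᵒᵖ : Yᵒᵖ ⟶ Xᵒᵖ`, up to
the order of the summands. -/
def IsMappingCocone {X : NComplex n A C} {Y : NComplex n B C} (f : X.K ⟶ Y.K)
    (M : NComplex n A (Y.K.X n)) : Prop :=
  ∃ φ : ∀ i j, i + 1 = j → j ≤ n → (M.K.X j ≅ X.K.X j ⊞ Y.K.X i),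
    (∀ h : 1 ≤ n, M.dFirst ≫ (φ 0 1 rfl h).hom = biprod.lift X.dFirst (X.left.inv ≫ f.f 0)) ∧
    (∀ i j k (h₁ : i + 1 = j) (h₂ : j + 1 = k) (h₃ : k ≤ n),
      (φ i j h₁ (by omega)).inv ≫ M.K.d j k ≫ (φ j k h₂ h₃).hom =
        biprod.desc (biprod.lift (X.K.d j k) (f.f j)) (biprod.lift 0 (-Y.K.d i j))) ∧
    (∀ i (h : i + 1 = n), (φ i n h le_rfl).inv ≫ M.dLast =
      biprod.desc (f.f n) (-Y.K.d i n))

end NComplex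

end Complexes

/-! ### `n`-exangulated categories -/

section Categories

attribute [local instance] hasBinaryBiproducts_of_finite_biproducts

/-- The data underlying an `n`-exangulated structure on `𝒞`: a functor `E : 𝒞ᵒᵖ × 𝒞 ⥤ Ab`, and an
assignment `s` sending an extension `δ ∈ E(C, A)` to a collection of complexes from `A` to `C`.  The
laws, including that `s δ` is a single isomorphism class `[X]`, are those of `IsNExangulated`. -/
structure ExtData (n : ℕ) (𝒞 : Type u) [Category.{v} 𝒞] [Preadditive 𝒞] where
  /-- the functor of extensions -/
  E : Bifunctor.{w} 𝒞
  /-- the realisation; `X ∈ s δ` means that `s(δ) = [X]` -/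
  s : ∀ {A C : 𝒞}, Ext E C A → Set (NComplex n A C)

namespace ExtData

variable {n : ℕ} {𝒞 : Type u} [Category.{v} 𝒞] [Preadditive 𝒞]

/-- `S.s` is an exact realisation of `S.E`. -/
structure IsExactRealisation (S : ExtData.{w} n 𝒞) : Prop where
  /-- `s(δ)` is an isomorphism class -/
  isClass : ∀ {A C : 𝒞} (δ : Ext S.E C A), ∃ X : NComplex n A C, S.s δ = X.cls
  /-- morphisms of extensions lift to morphisms of complexes -/
  exists_lift : ∀ {A B C D : 𝒞} (δ : Ext S.E C A) (ρ : Ext S.E D B) (a : A ⟶ B) (c : C ⟶ D),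
    push S.E a δ = pull S.E c ρ → ∀ X ∈ S.s δ, ∀ Y ∈ S.s ρ,
      ∃ f : X.K ⟶ Y.K, NComplex.Lifts (X := X) (Y := Y) f a c
  isNExangle : ∀ {A C : 𝒞} (δ : Ext S.E C A), ∀ X ∈ S.s δ, X.IsNExangle S.E δ
  triv_first : ∀ {A Z : 𝒞}, IsZero Z → ∀ X : NComplex n A Z, X.IsTrivFirst → X ∈ S.s 0
  triv_last : ∀ {Z C : 𝒞}, IsZero Z → ∀ X : NComplex n Z C, X.IsTrivLast → X ∈ S.s 0

/-- `g : A ⟶ B` is an `s`-inflation: it is the differential `d₀` of a complex `X` with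
`s(δ) = [X]` for some extension `δ`. -/
def IsInflation (S : ExtData.{w} n 𝒞) {A B : 𝒞} (g : A ⟶ B) : Prop :=
  ∃ (C : 𝒞) (δ : Ext S.E C A) (X : NComplex n A C) (_ : X ∈ S.s δ) (φ : X.K.X 1 ≅ B),
    X.dFirst ≫ φ.hom = g

/-- `g : B ⟶ C` is an `s`-deflation: it is the differential `dₙ` of a complex `X` with
`s(δ) = [X]` for some extension `δ`. -/
def IsDeflation (S : ExtData.{w} n 𝒞) {B C : 𝒞} (g : B ⟶ C) : Prop :=
  ∃ (A : 𝒞) (δ : Ext S.E C A) (X : NComplex n A C) (_ : X ∈ S.s δ) (φ : B ≅ X.K.X n),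
    φ.hom ≫ X.dLast = g

/-- `(𝒞, E, s)` is an `n`-exangulated category (for `n ≥ 1`). -/
structure IsNExangulated [HasFiniteBiproducts 𝒞] (S : ExtData.{w} n 𝒞) : Prop where
  isBiadditive : IsBiadditive S.E
  isExactRealisation : S.IsExactRealisation
  /-- inflations are closed under composition -/
  inflation_comp : ∀ {A B D : 𝒞} (g : A ⟶ B) (h : B ⟶ D),
    S.IsInflation g → S.IsInflation h → S.IsInflation (g ≫ h)
  /-- deflations are closed under composition -/
  deflation_comp : ∀ {A B D : 𝒞} (g : A ⟶ B) (h : B ⟶ D),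
    S.IsDeflation g → S.IsDeflation h → S.IsDeflation (g ≫ h)
  /-- if `s(c^E δ) = [Y]` and `s(δ) = [X]`, then `(id, c)` has a lift `f : Y ⟶ X` such that
  `s((d₀^Y)_E δ)` is the class of the mapping cone of `f` -/
  exists_cone : ∀ {A C D : 𝒞} (δ : Ext S.E D A) (c : C ⟶ D),
    ∀ Y ∈ S.s (pull S.E c δ), ∀ X ∈ S.s δ,
      ∃ f : Y.K ⟶ X.K, NComplex.Lifts (X := Y) (Y := X) f (𝟙 A) c ∧
        ∃ M ∈ S.s (push S.E Y.dFirst δ), NComplex.IsMappingCone (X := Y) (Y := X) f M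
  /-- if `s(δ) = [X]` and `s(a_E δ) = [Y]`, then `(a, id)` has a lift `f : X ⟶ Y` such that
  `s((dₙ^Y)^E δ)` is the class of the mapping cocone of `f` -/
  exists_cocone : ∀ {A B C : 𝒞} (δ : Ext S.E C A) (a : A ⟶ B),
    ∀ Y ∈ S.s (push S.E a δ), ∀ X ∈ S.s δ,
      ∃ f : X.K ⟶ Y.K, NComplex.Lifts (X := X) (Y := Y) f a (𝟙 C) ∧
        ∃ M ∈ S.s (pull S.E Y.dLast δ), NComplex.IsMappingCocone (X := X) (Y := Y) f M

end ExtData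

end Categories

/-! ### `n`-exangulated functors and natural transformations -/

section Functors

variable {n : ℕ} {𝒞 : Type u} [Category.{v} 𝒞] {𝒞' : Type u'} [Category.{v'} 𝒞']
  {𝒞'' : Type u''} [Category.{v''} 𝒞'']

/-- The bifunctor `E(F -, F -)`. -/
abbrev restrict (F : 𝒞 ⥤ 𝒞') (E : Bifunctor.{w} 𝒞') : Bifunctor.{w} 𝒞 :=
  F.op ⋙ E ⋙ (Functor.whiskeringLeft 𝒞 𝒞' AddCommGrpCat.{w}).obj F

/-- The component `E(C, A) → E'(F C, F A)` of a natural transformation `E(-, -) ⟶ E'(F -, F -)`. -/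
def extMap {E : Bifunctor.{w} 𝒞} {E' : Bifunctor.{w} 𝒞'} {F : 𝒞 ⥤ 𝒞'} (Γ : E ⟶ restrict F E')
    {C A : 𝒞} : Ext E C A →+ Ext E' (F.obj C) (F.obj A) :=
  ((Γ.app (op C)).app A).hom

/-- The second component `Φ_{F × F} ∘ Γ` of the composite `(L, Φ) ∘ (F, Γ)`. -/
def compExt {E : Bifunctor.{w} 𝒞} {E' : Bifunctor.{w} 𝒞'} {E'' : Bifunctor.{w} 𝒞''}
    {F : 𝒞 ⥤ 𝒞'} {L : 𝒞' ⥤ 𝒞''} (Γ : E ⟶ restrict F E') (Φ : E' ⟶ restrict L E'') :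
    E ⟶ restrict (F ⋙ L) E'' where
  app C := Γ.app C ≫ Functor.whiskerLeft F (Φ.app (F.op.obj C))
  naturality C D c := by
    have h₁ := Γ.naturality c
    have h₂ := congrArg (Functor.whiskerLeft F) (Φ.naturality (F.op.map c))
    simp only [Functor.whiskerLeft_comp] at h₂
    rw [← Category.assoc, h₁, Category.assoc, Category.assoc]
    exact congrArg (Γ.app C ≫ ·) h₂

lemma extMap_compExt {E : Bifunctor.{w} 𝒞} {E' : Bifunctor.{w} 𝒞'} {E'' : Bifunctor.{w} 𝒞''}
    {F : 𝒞 ⥤ 𝒞'} {L : 𝒞' ⥤ 𝒞''} (Γ : E ⟶ restrict F E') (Φ : E' ⟶ restrict L E'') {C A : 𝒞}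
    (δ : Ext E C A) : extMap (compExt Γ Φ) δ = extMap Φ (extMap Γ δ) :=
  rfl

/-- A natural transformation `β : F ⟶ G` is `n`-exangulated, as a transformation
`(F, Γ) ⟶ (G, Λ)`. -/
def IsNExangulatedNatTrans {E : Bifunctor.{w} 𝒞} {E' : Bifunctor.{w} 𝒞'} {F G : 𝒞 ⥤ 𝒞'}
    (Γ : E ⟶ restrict F E') (Λ : E ⟶ restrict G E') (β : F ⟶ G) : Prop :=
  ∀ {A C : 𝒞} (δ : Ext E C A),
    push E' (β.app A) (extMap Γ δ) = pull E' (β.app C) (extMap Λ δ)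

/-- `β : F ≅ G` is an `n`-exangulated natural isomorphism `(F, Γ) ≅ (G, Λ)`: it is `n`-exangulated
and its inverse is `n`-exangulated. -/
def IsNExangulatedNatIso {E : Bifunctor.{w} 𝒞} {E' : Bifunctor.{w} 𝒞'} {F G : 𝒞 ⥤ 𝒞'}
    (Γ : E ⟶ restrict F E') (Λ : E ⟶ restrict G E') (β : F ≅ G) : Prop :=
  IsNExangulatedNatTrans Γ Λ β.hom ∧ IsNExangulatedNatTrans Λ Γ β.inv

/-- `(F, Γ) : (𝒞, E, s) ⟶ (𝒞', E', s')` is an `n`-exangulated functor: `s(δ) = [X]` implies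
`s'(Γ(δ)) = [F X]`. -/
def IsNExangulatedFunctor [Preadditive 𝒞] [Preadditive 𝒞'] (S : ExtData.{w} n 𝒞)
    (S' : ExtData.{w} n 𝒞') (F : 𝒞 ⥤ 𝒞') [F.Additive] (Γ : S.E ⟶ restrict F S'.E) : Prop :=
  ∀ {A C : 𝒞} (δ : Ext S.E C A), ∀ X ∈ S.s δ, X.map F ∈ S'.s (extMap Γ δ)

end Functors

/-! ### The idempotent completion

The category is Mathlib's `Karoubi 𝒞`, whose objects are the pairs `(X, e)` with `e` an
idempotent of `X`, and the inclusion of `𝒞` is `toKaroubi 𝒞`. -/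

section Completion

variable {n : ℕ} {𝒞 : Type u} [Category.{v} 𝒞]

/-- The group of the extensions `δ ∈ E(Z, X)` with `e_E δ = δ = e'^E δ`, for objects `(X, e)` and
`(Z, e')` of the idempotent completion. -/
def karoubiExt (E : Bifunctor.{w} 𝒞) (Z X : Karoubi 𝒞) : AddSubgroup (Ext E Z.X X.X) where
  carrier := {δ | push E X.p δ = δ ∧ pull E Z.p δ = δ}
  zero_mem' := by simp
  add_mem' := by
    rintro a b ⟨h₁, h₂⟩ ⟨h₃, h₄⟩
    simp [h₁, h₂, h₃, h₄]
  neg_mem' := by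
    rintro a ⟨h₁, h₂⟩
    simp [h₁, h₂]

lemma karoubiExt_push_mem (E : Bifunctor.{w} 𝒞) {Z X Y : Karoubi 𝒞} (a : X ⟶ Y)
    {δ : Ext E Z.X X.X} (h : δ ∈ karoubiExt E Z X) : push E a.f δ ∈ karoubiExt E Z Y := by
  refine ⟨?_, ?_⟩
  · rw [← push_comp, Karoubi.comp_p]
  · rw [← push_pull, h.2]

lemma karoubiExt_pull_mem (E : Bifunctor.{w} 𝒞) {Z W X : Karoubi 𝒞} (c : W ⟶ Z)
    {δ : Ext E Z.X X.X} (h : δ ∈ karoubiExt E Z X) : pull E c.f δ ∈ karoubiExt E W X := by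
  refine ⟨?_, ?_⟩
  · rw [push_pull, h.1]
  · rw [← pull_comp, Karoubi.p_comp]

/-- The bifunctor `𝔽` on the idempotent completion: its groups are the `karoubiExt E Z X`, and
on morphisms it is the restriction of `E`. -/
def karoubiBifunctor (E : Bifunctor.{w} 𝒞) : Bifunctor.{w} (Karoubi 𝒞) where
  obj Z :=
    { obj := fun X => AddCommGrpCat.of (karoubiExt E Z.unop X)
      map := fun {X Y} a => AddCommGrpCat.ofHom
        (((push E a.f).comp (karoubiExt E Z.unop X).subtype).codRestrict (karoubiExt E Z.unop Y)
          fun δ => karoubiExt_push_mem E a δ.2)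
      map_id := fun X => by
        ext δ
        exact δ.2.1
      map_comp := fun a b => by
        ext δ
        exact (push_comp E a.f b.f δ.1) }
  map {Z W} c :=
    { app := fun X => AddCommGrpCat.ofHom
        (((pull E c.unop.f).comp (karoubiExt E Z.unop X).subtype).codRestrict
          (karoubiExt E W.unop X) fun δ => karoubiExt_pull_mem E c.unop δ.2)
      naturality := fun X Y a => by
        ext δ
        exact (push_pull E a.f c.unop.f δ.1).symm }
  map_id Z := by
    ext X δ
    exact δ.2.2
  map_comp c d := by
    ext X δ
    exact (pull_comp E c.unop.f d.unop.f δ.1)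

/-- The underlying `E`-extension of an `𝔽`-extension. -/
def underlying (E : Bifunctor.{w} 𝒞) {Z X : Karoubi 𝒞} (δ : Ext (karoubiBifunctor E) Z X) :
    Ext E Z.X X.X :=
  Subtype.val (p := (· ∈ karoubiExt E Z X)) δ

/-- The transformation `Γ : E(-, -) ⟶ 𝔽(I -, I -)`, where `I` is the inclusion of `𝒞` into its
idempotent completion; it sends `δ` to the `𝔽`-extension `(id, δ, id)` with underlying
`E`-extension `δ`. -/
def karoubiGamma (E : Bifunctor.{w} 𝒞) : E ⟶ restrict (toKaroubi 𝒞) (karoubiBifunctor E) where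
  app C :=
    { app := fun A => AddCommGrpCat.ofHom
        ((AddMonoidHom.id (Ext E C.unop A)).codRestrict
          (karoubiExt E ((toKaroubi 𝒞).obj C.unop) ((toKaroubi 𝒞).obj A))
          fun δ => ⟨push_id E (C := C.unop) (A := A) δ, pull_id E (C := C.unop) (A := A) δ⟩)
      naturality := fun _ _ _ => rfl }
  naturality _ _ _ := rfl

lemma underlying_karoubiGamma (E : Bifunctor.{w} 𝒞) {C A : 𝒞} (δ : Ext E C A) :
    underlying E (extMap (karoubiGamma E) δ) = δ :=
  rfl

/-- An isomorphism `φ : U ≅ P.X` that is compatible with an idempotent `e` of `U` and with the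
idempotent of `P` induces an isomorphism `(U, e) ≅ P`, with underlying morphism `φ e`. -/
def karoubiIso {U : 𝒞} {P : Karoubi 𝒞} (φ : U ≅ P.X) (e : U ⟶ U) (he : e ≫ e = e)
    (h : e ≫ φ.hom = φ.hom ≫ P.p) : (⟨U, e, he⟩ : Karoubi 𝒞) ≅ P where
  hom := ⟨e ≫ φ.hom, by
    change e ≫ (e ≫ φ.hom) ≫ P.p = e ≫ φ.hom
    rw [Category.assoc, ← h, ← Category.assoc, he, ← Category.assoc, he]⟩
  inv := ⟨φ.inv ≫ e, by
    change P.p ≫ (φ.inv ≫ e) ≫ e = φ.inv ≫ e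
    rw [Category.assoc, he, ← Category.assoc, ← cancel_mono φ.hom, Category.assoc, h]
    simp [h]⟩
  hom_inv_id := by
    ext
    change (e ≫ φ.hom) ≫ φ.inv ≫ e = e
    simp [he]
  inv_hom_id := by
    ext
    change (φ.inv ≫ e) ≫ e ≫ φ.hom = P.p
    rw [Category.assoc, ← Category.assoc e, he, h]
    simp

variable [Preadditive 𝒞]

/-- The complex `(X, e)` in the idempotent completion, for a complex `X` and an idempotent
endomorphism `e` of `X` lifting the pair of idempotents `(P.p, Q.p)`: it has the
terms `(Xᵢ, eᵢ)` and the differentials `eᵢ₊₁ dᵢ eᵢ = dᵢ eᵢ`. -/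
def karoubiComplex {P Q : Karoubi 𝒞} (X : NComplex n P.X Q.X) (e : X.K ⟶ X.K) (he : e ≫ e = e)
    (hl : NComplex.Lifts (X := X) (Y := X) e P.p Q.p) : NComplex n P Q where
  K := KaroubiHomologicalComplexEquivalence.Functor.obj ⟨X.K, e, he⟩
  isZero i hi := by
    rw [IsZero.iff_id_eq_zero]
    ext
    exact (X.isZero i hi).eq_of_src _ _
  left := karoubiIso X.left (e.f 0) (HomologicalComplex.congr_hom he 0) hl.1
  right := karoubiIso X.right (e.f (n + 1)) (HomologicalComplex.congr_hom he (n + 1)) hl.2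

/-- The data `(𝔽, t)` on the idempotent completion of `(𝒞, E, s)`.  The class `t(δ̃)` is the class
of `(X, e)`, for any complex `X` with `s(δ) = [X]` and any idempotent endomorphism `e` of `X`
lifting the idempotents of the two ends. -/
def ExtData.karoubi (S : ExtData.{w} n 𝒞) : ExtData.{w} n (Karoubi 𝒞) where
  E := karoubiBifunctor S.E
  s {P Q} δ :=
    {Z | ∃ X ∈ S.s (underlying S.E δ), ∃ (e : X.K ⟶ X.K) (he : e ≫ e = e)
      (hl : NComplex.Lifts (X := X) (Y := X) e P.p Q.p), Z ∈ (karoubiComplex X e he hl).cls}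

end Completion

end NExang

/-!
The idempotent completion is controlled by one construction. If `δ` is an extension in `𝒞` fixed by
idempotents `e` and `e'` of its ends, then some realisation of `δ` carries an idempotent
endomorphism lifting `(e, e')` (`exists_idempotent_lift`). Any lift `f` of `(e, e')`
can be made idempotent one degree at a time, from left to right: each step adds to the realisation a
contractible complex concentrated in two adjacent degrees, and replaces `f` by the idempotent matrix
`(f, f - f²; 1, 1 - f)`. In the last inner degree `f² - f` has square zero, so that `3f² - 2f³` is
idempotent. Hence every realisation `Z` in the idempotent completion is a homotopy retract of the
image of a realisation `X` in `𝒞` (`ExtData.exists_retract_of_mem_karoubi`), and almost everything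
else is a statement about homotopy retracts.

* `n`-exangles are closed under homotopy retracts (`NComplex.IsNExangle.of_retract`), and two
  `n`-exangles of the same extension that map to each other under the identities of the ends are
  homotopy equivalent (`NComplex.IsNExangle.htpyEquiv`): an endomorphism lifting `(0, 0)` has square
  zero up to homotopy, so that adding it to the identity gives an equivalence. Together they show
  that a homotopy retract of a realisation is a realisation (`ExtData.IsRealisation.mem_of_retract`).
  The exactness of the realisation follows, and so does the fact that every extension of an
  `n`-exangulated functor to the idempotent completion is again `n`-exangulated.

* (EA1): up to adding complementary summands, an inflation `g : P ⟶ Q` of the idempotent completion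
  is an inflation `P.X ⟶ E` of `𝒞` in which the complement of `P` in `P.X` is split off
  (`IsSourceSummand`). This describes all inflations (`exists_isSourceSummand`,
  `isInflation_of_isSourceSummand`), and composites can be treated in `𝒞`, where mapping cocones give
  enough inflations (`isInflation_lift_zero`, `exists_isInflation_map_id`).

* (EA2): given realisations `X` and `Y` in the idempotent completion, a good lift is chosen between
  realisations in `𝒞` of which they are retracts, and is restricted to `X` and `Y`. The mapping cone
  of the restriction is comparable with a realisation, through morphisms of cones induced by squares
  that commute up to a homotopy vanishing at one end; the only part of exactness that is not
  inherited is a weak pushout property at the last term, which is read off the cone in `𝒞`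
  (`ConeData.isNExangle`, `ExtData.IsRealisation.exists_cone_of_retract`). The axiom (EA2)ᵒᵖ is
  treated in the same way with cocones.

* The universal property: restriction along `toKaroubi` is an equivalence onto the functors to an
  idempotent complete category, by the theory of the Karoubi envelope in Mathlib. An extension in
  `𝔽((Z, e'), (X, e))` is recovered from the underlying extension by push and pull along the
  projection onto `(X, e)` and the inclusion of `(Z, e')`; this determines the transformation of the
  extension groups (`extensionTrans`), and shows that a natural transformation is `n`-exangulated as
  soon as its restriction is (`isNExangulatedNatTrans_of_restriction`).
-/

namespace NExang

/-! ### Biadditivity -/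

namespace IsBiadditive

variable {𝒞 : Type u} [Category.{v} 𝒞] [Preadditive 𝒞] {E : Bifunctor.{w} 𝒞}

lemma push_zero (hE : IsBiadditive E) {C A B : 𝒞} (δ : Ext E C A) :
    push E (0 : A ⟶ B) δ = 0 := by
  simpa using hE.push_add (0 : A ⟶ B) 0 δ

lemma pull_zero (hE : IsBiadditive E) {C D A : 𝒞} (δ : Ext E C A) :
    pull E (0 : D ⟶ C) δ = 0 := by
  simpa using hE.pull_add (0 : D ⟶ C) 0 δ

lemma push_sub (hE : IsBiadditive E) {C A B : 𝒞} (a a' : A ⟶ B) (δ : Ext E C A) :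
    push E (a - a') δ = push E a δ - push E a' δ := by
  rw [eq_sub_iff_add_eq, ← hE.push_add, sub_add_cancel]

lemma pull_sub (hE : IsBiadditive E) {C D A : 𝒞} (c c' : D ⟶ C) (δ : Ext E C A) :
    pull E (c - c') δ = pull E c δ - pull E c' δ := by
  rw [eq_sub_iff_add_eq, ← hE.pull_add, sub_add_cancel]

end IsBiadditive

/-! ### Homotopies in components -/

section Components

variable {𝒞 : Type u} [Category.{v} 𝒞] [Preadditive 𝒞] {K L : CochainComplex 𝒞 ℕ}

lemma exists_components_of_homotopy {f g : K ⟶ L} (H : Homotopy f g) :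
    ∃ h : ∀ i, K.X (i + 1) ⟶ L.X i, f.f 0 - g.f 0 = K.d 0 1 ≫ h 0 ∧
      ∀ i, f.f (i + 1) - g.f (i + 1) = h i ≫ L.d i (i + 1) + K.d (i + 1) (i + 2) ≫ h (i + 1) := by
  refine ⟨fun i => H.hom (i + 1) i, ?_, fun i => ?_⟩
  · rw [H.comm 0, Homotopy.dNext_cochainComplex, Homotopy.prevD_zero_cochainComplex]
    abel
  · rw [H.comm (i + 1), Homotopy.dNext_cochainComplex, Homotopy.prevD_succ_cochainComplex]
    abel

open Classical in
lemma nonempty_homotopy_of_components {f g : K ⟶ L} (h : ∀ i, K.X (i + 1) ⟶ L.X i)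
    (h0 : f.f 0 - g.f 0 = K.d 0 1 ≫ h 0)
    (h1 : ∀ i, f.f (i + 1) - g.f (i + 1) =
      h i ≫ L.d i (i + 1) + K.d (i + 1) (i + 2) ≫ h (i + 1)) :
    Nonempty (Homotopy f g) := by
  let H : ∀ i j, K.X i ⟶ L.X j := fun i j =>
    if e : j + 1 = i then eqToHom (by rw [e]) ≫ h j else 0
  have hH : ∀ i, H (i + 1) i = h i := fun i => by simp [H]
  refine ⟨⟨H, fun i j hij => dif_neg hij, fun i => ?_⟩⟩
  rcases i with _ | i
  · rw [Homotopy.dNext_cochainComplex, Homotopy.prevD_zero_cochainComplex, hH, add_zero, ← h0,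
      sub_add_cancel]
  · rw [Homotopy.dNext_cochainComplex, Homotopy.prevD_succ_cochainComplex, hH, hH,
      add_comm (_ ≫ _), ← h1, sub_add_cancel]

end Components

namespace NComplex

variable {𝒞 : Type u} [Category.{v} 𝒞] [Preadditive 𝒞] {n : ℕ}

/-! ### Lifts of morphisms of the ends -/

section Lifts

variable {A B C D A' C' : 𝒞} {X : NComplex n A C} {Y : NComplex n B D} {Z : NComplex n A' C'}

lemma Lifts.id : Lifts (X := X) (Y := X) (𝟙 X.K) (𝟙 A) (𝟙 C) := by
  simp [Lifts]

lemma Lifts.comp {f : X.K ⟶ Y.K} {g : Y.K ⟶ Z.K} {a : A ⟶ B} {c : C ⟶ D} {a' : B ⟶ A'}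
    {c' : D ⟶ C'} (hf : Lifts (X := X) (Y := Y) f a c) (hg : Lifts (X := Y) (Y := Z) g a' c') :
    Lifts (X := X) (Y := Z) (f ≫ g) (a ≫ a') (c ≫ c') := by
  constructor
  · rw [HomologicalComplex.comp_f, Category.assoc, hg.1, ← Category.assoc, hf.1, Category.assoc]
  · rw [HomologicalComplex.comp_f, Category.assoc, hg.2, ← Category.assoc, hf.2, Category.assoc]

lemma Lifts.sub {f g : X.K ⟶ Y.K} {a a' : A ⟶ B} {c c' : C ⟶ D}
    (hf : Lifts (X := X) (Y := Y) f a c) (hg : Lifts (X := X) (Y := Y) g a' c') :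
    Lifts (X := X) (Y := Y) (f - g) (a - a') (c - c') := by
  constructor
  · simp [Preadditive.sub_comp, Preadditive.comp_sub, hf.1, hg.1]
  · simp [Preadditive.sub_comp, Preadditive.comp_sub, hf.2, hg.2]

lemma Lifts.add {f g : X.K ⟶ Y.K} {a a' : A ⟶ B} {c c' : C ⟶ D}
    (hf : Lifts (X := X) (Y := Y) f a c) (hg : Lifts (X := X) (Y := Y) g a' c') :
    Lifts (X := X) (Y := Y) (f + g) (a + a') (c + c') := by
  constructor
  · simp [hf.1, hg.1]
  · simp [hf.2, hg.2]

lemma Lifts.of_eq {f : X.K ⟶ Y.K} {a a' : A ⟶ B} {c c' : C ⟶ D}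
    (hf : Lifts (X := X) (Y := Y) f a c) (ha : a = a') (hc : c = c') :
    Lifts (X := X) (Y := Y) f a' c' := by
  subst ha hc
  exact hf

lemma Lifts.f_zero {f : X.K ⟶ Y.K} {c : C ⟶ D}
    (hf : Lifts (X := X) (Y := Y) f 0 c) : f.f 0 = 0 := by
  rw [← cancel_mono Y.left.hom, hf.1, comp_zero, zero_comp]

lemma Lifts.f_last {f : X.K ⟶ Y.K} {a : A ⟶ B}
    (hf : Lifts (X := X) (Y := Y) f a 0) : f.f (n + 1) = 0 := by
  rw [← cancel_mono Y.right.hom, hf.2, comp_zero, zero_comp]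

lemma Lifts.dFirst {f : X.K ⟶ Y.K} {a : A ⟶ B} {c : C ⟶ D}
    (hf : Lifts (X := X) (Y := Y) f a c) : X.dFirst ≫ f.f 1 = a ≫ Y.dFirst := by
  rw [NComplex.dFirst, NComplex.dFirst, Category.assoc, ← f.comm, ← Category.assoc,
    ← Category.assoc]
  congr 1
  rw [Iso.inv_comp_eq, ← Category.assoc, ← hf.1]
  simp

lemma Lifts.dLast {f : X.K ⟶ Y.K} {a : A ⟶ B} {c : C ⟶ D}
    (hf : Lifts (X := X) (Y := Y) f a c) : f.f n ≫ Y.dLast = X.dLast ≫ c := by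
  rw [NComplex.dLast, NComplex.dLast, ← Category.assoc, f.comm, Category.assoc, hf.2,
    Category.assoc]

end Lifts

/-! ### Homotopy equivalence relative to the ends -/

section HtpyEquiv

variable {A C : 𝒞}

lemma HtpyEquiv.refl (X : NComplex n A C) : HtpyEquiv X X :=
  ⟨𝟙 _, 𝟙 _, Lifts.id, Lifts.id, ⟨Homotopy.ofEq (by simp)⟩, ⟨Homotopy.ofEq (by simp)⟩⟩

lemma HtpyEquiv.trans {X Y Z : NComplex n A C} (h : HtpyEquiv X Y) (h' : HtpyEquiv Y Z) :
    HtpyEquiv X Z := by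
  obtain ⟨f, g, hf, hg, ⟨h₁⟩, ⟨h₂⟩⟩ := h
  obtain ⟨f', g', hf', hg', ⟨h₁'⟩, ⟨h₂'⟩⟩ := h'
  refine ⟨f ≫ f', g' ≫ g, (hf.comp hf').of_eq (by simp) (by simp),
    (hg'.comp hg).of_eq (by simp) (by simp), ⟨?_⟩, ⟨?_⟩⟩
  · have e := ((h₁'.compLeft f).compRight g)
    exact (Homotopy.ofEq (by simp)).trans (e.trans ((Homotopy.ofEq (by simp)).trans h₁))
  · have e := ((h₂.compLeft g').compRight f')
    exact (Homotopy.ofEq (by simp)).trans (e.trans ((Homotopy.ofEq (by simp)).trans h₂'))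

end HtpyEquiv

/-! ### Transport of the exactness properties along homotopy retracts -/

/-- The property of being an `n`-exangle passes to homotopy retracts.  The homotopy `i p ∼ 1` is
only needed in the inner degrees, and one degree at a time. -/
lemma IsNExangle.of_retract {E : Bifunctor.{w} 𝒞} {A C A' C' : 𝒞} {X : NComplex n A C}
    {X' : NComplex n A' C'} {δ : Ext E C A} {δ' : Ext E C' A'} (hX : X.IsNExangle E δ)
    {i : X'.K ⟶ X.K} {p : X.K ⟶ X'.K} {a : A' ⟶ A} {c : C' ⟶ C} {a' : A ⟶ A'} {c' : C ⟶ C'}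
    (hi : Lifts (X := X') (Y := X) i a c) (hp : Lifts (X := X) (Y := X') p a' c')
    (ha : a ≫ a' = 𝟙 A') (hc : c ≫ c' = 𝟙 C')
    (h₁ : push E a δ' = pull E c δ) (h₂ : push E a' δ = pull E c' δ')
    (H : ∀ j, j < n → ∃ (s : X'.K.X (j + 1) ⟶ X'.K.X j) (t : X'.K.X (j + 2) ⟶ X'.K.X (j + 1)),
      i.f (j + 1) ≫ p.f (j + 1) = 𝟙 _ + s ≫ X'.K.d j (j + 1) + X'.K.d (j + 1) (j + 2) ≫ t) :
    X'.IsNExangle E δ' where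
  push_eq_zero := by
    have : X'.dFirst = a ≫ X.dFirst ≫ p.f 1 := by
      rw [hp.dFirst, ← Category.assoc, ha, Category.id_comp]
    rw [this, push_comp, push_comp, h₁, push_pull, hX.push_eq_zero, map_zero, map_zero]
  pull_eq_zero := by
    have : X'.dLast = (i.f n ≫ X.dLast) ≫ c' := by
      rw [hi.dLast, Category.assoc, hc, Category.comp_id]
    rw [this, pull_comp, ← h₂, ← push_pull, pull_comp, hX.pull_eq_zero, map_zero, map_zero]
  exact_covariant j hj W g hg := by
    obtain ⟨h, hh⟩ := hX.exact_covariant j hj (g ≫ i.f (j + 1)) (by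
      rw [Category.assoc, i.comm, ← Category.assoc, hg, zero_comp])
    obtain ⟨s, t, hst⟩ := H j hj
    refine ⟨h ≫ p.f j - g ≫ s, ?_⟩
    have h3 : g ≫ i.f (j + 1) ≫ p.f (j + 1) = g + g ≫ s ≫ X'.K.d j (j + 1) := by
      rw [hst]
      simp [Preadditive.comp_add, reassoc_of% hg]
    rw [Preadditive.sub_comp, Category.assoc, p.comm, ← Category.assoc, hh, Category.assoc, h3,
      Category.assoc, add_sub_cancel_right]
  exact_covariant_last {W} g hg := by
    obtain ⟨h, hh⟩ := hX.exact_covariant_last (g ≫ c) (by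
      rw [pull_comp, ← h₁, ← push_pull, hg, map_zero])
    refine ⟨h ≫ p.f n, ?_⟩
    rw [Category.assoc, hp.dLast, ← Category.assoc, hh, Category.assoc, hc, Category.comp_id]
  exact_contravariant j hj W g hg := by
    obtain ⟨h, hh⟩ := hX.exact_contravariant j hj (p.f (j + 1) ≫ g) (by
      rw [← Category.assoc, ← p.comm, Category.assoc, hg, comp_zero])
    obtain ⟨s, t, hst⟩ := H j hj
    refine ⟨i.f (j + 2) ≫ h - t ≫ g, ?_⟩
    have h3 : i.f (j + 1) ≫ p.f (j + 1) ≫ g = g + X'.K.d (j + 1) (j + 2) ≫ t ≫ g := by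
      rw [← Category.assoc, hst]
      simp [Preadditive.add_comp, hg]
    rw [Preadditive.comp_sub, ← Category.assoc, ← i.comm, Category.assoc, hh, h3,
      add_sub_cancel_right]
  exact_contravariant_last {W} g hg := by
    obtain ⟨h, hh⟩ := hX.exact_contravariant_last (a' ≫ g) (by
      rw [push_comp, h₂, push_pull, hg, map_zero])
    refine ⟨i.f 1 ≫ h, ?_⟩
    rw [← Category.assoc, hi.dFirst, Category.assoc, hh, ← Category.assoc, ha, Category.id_comp]

end NComplex

/-! ### Null-homotopies normalised at one end -/

section NullHtpy

variable {𝒞 : Type u} [Category.{v} 𝒞] [Preadditive 𝒞] {K L M : CochainComplex 𝒞 ℕ}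

/-- `h` is a null-homotopy of `k`, given by its components `hᵢ : Kᵢ₊₁ ⟶ Lᵢ`. -/
structure NullHtpy (k : K ⟶ L) (h : ∀ i, K.X (i + 1) ⟶ L.X i) : Prop where
  zero : k.f 0 = K.d 0 1 ≫ h 0
  succ : ∀ i, k.f (i + 1) = h i ≫ L.d i (i + 1) + K.d (i + 1) (i + 2) ≫ h (i + 1)

lemma NullHtpy.precomp {k : K ⟶ L} {h : ∀ i, K.X (i + 1) ⟶ L.X i} (H : NullHtpy k h)
    (g : M ⟶ K) : NullHtpy (g ≫ k) (fun i => g.f (i + 1) ≫ h i) where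
  zero := by rw [HomologicalComplex.comp_f, H.zero, ← Category.assoc, g.comm, Category.assoc]
  succ i := by
    rw [HomologicalComplex.comp_f, H.succ, Preadditive.comp_add, ← Category.assoc _ (K.d _ _),
      g.comm, Category.assoc, Category.assoc]

lemma NullHtpy.postcomp {k : K ⟶ L} {h : ∀ i, K.X (i + 1) ⟶ L.X i} (H : NullHtpy k h)
    (g : L ⟶ M) : NullHtpy (k ≫ g) (fun i => h i ≫ g.f i) where
  zero := by rw [HomologicalComplex.comp_f, H.zero, Category.assoc]
  succ i := by
    rw [HomologicalComplex.comp_f, H.succ, Preadditive.add_comp, Category.assoc, Category.assoc,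
      Category.assoc, g.comm]

lemma NullHtpy.add {k k' : K ⟶ L} {h h' : ∀ i, K.X (i + 1) ⟶ L.X i} (H : NullHtpy k h)
    (H' : NullHtpy k' h') : NullHtpy (k + k') (fun i => h i + h' i) where
  zero := by simp [H.zero, H'.zero]
  succ i := by
    simp only [HomologicalComplex.add_f_apply, H.succ, H'.succ, Preadditive.add_comp,
      Preadditive.comp_add]
    abel

lemma NullHtpy.neg {k : K ⟶ L} {h : ∀ i, K.X (i + 1) ⟶ L.X i} (H : NullHtpy k h) :
    NullHtpy (-k) (fun i => -h i) where
  zero := by simp [H.zero]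
  succ i := by
    simp only [HomologicalComplex.neg_f_apply, H.succ, Preadditive.neg_comp, Preadditive.comp_neg]
    abel

lemma exists_nullHtpy_of_homotopy {f g : K ⟶ L} (H : Homotopy f g) :
    ∃ h, NullHtpy (f - g) h := by
  obtain ⟨h, h0, h1⟩ := exists_components_of_homotopy H
  exact ⟨h, by simpa using h0, fun i => by simpa using h1 i⟩

lemma NullHtpy.nonempty_homotopy {f g : K ⟶ L} {h : ∀ i, K.X (i + 1) ⟶ L.X i}
    (H : NullHtpy (f - g) h) : Nonempty (Homotopy f g) :=
  nonempty_homotopy_of_components h (by simpa using H.zero) (fun i => by simpa using H.succ i)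

/-- `k` is null-homotopic, by a homotopy that vanishes as a map `K₁ ⟶ L₀`. -/
def NullLeft (k : K ⟶ L) : Prop := ∃ h, NullHtpy k h ∧ h 0 = 0

/-- `k` is null-homotopic, by a homotopy that vanishes as a map `Kₙ₊₁ ⟶ Lₙ`. -/
def NullRight (n : ℕ) (k : K ⟶ L) : Prop := ∃ h, NullHtpy k h ∧ h n = 0

lemma NullLeft.precomp {k : K ⟶ L} (H : NullLeft k) (g : M ⟶ K) : NullLeft (g ≫ k) := by
  obtain ⟨h, H, h0⟩ := H
  exact ⟨_, H.precomp g, by simp [h0]⟩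

lemma NullLeft.postcomp {k : K ⟶ L} (H : NullLeft k) (g : L ⟶ M) : NullLeft (k ≫ g) := by
  obtain ⟨h, H, h0⟩ := H
  exact ⟨_, H.postcomp g, by simp [h0]⟩

lemma NullLeft.add {k k' : K ⟶ L} (H : NullLeft k) (H' : NullLeft k') : NullLeft (k + k') := by
  obtain ⟨h, H, h0⟩ := H
  obtain ⟨h', H', h0'⟩ := H'
  exact ⟨_, H.add H', by simp [h0, h0']⟩

lemma NullLeft.neg {k : K ⟶ L} (H : NullLeft k) : NullLeft (-k) := by
  obtain ⟨h, H, h0⟩ := H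
  exact ⟨_, H.neg, by simp [h0]⟩

lemma NullRight.precomp {n : ℕ} {k : K ⟶ L} (H : NullRight n k) (g : M ⟶ K) :
    NullRight n (g ≫ k) := by
  obtain ⟨h, H, h0⟩ := H
  exact ⟨_, H.precomp g, by simp [h0]⟩

lemma NullRight.postcomp {n : ℕ} {k : K ⟶ L} (H : NullRight n k) (g : L ⟶ M) :
    NullRight n (k ≫ g) := by
  obtain ⟨h, H, h0⟩ := H
  exact ⟨_, H.postcomp g, by simp [h0]⟩

lemma NullRight.add {n : ℕ} {k k' : K ⟶ L} (H : NullRight n k) (H' : NullRight n k') :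
    NullRight n (k + k') := by
  obtain ⟨h, H, h0⟩ := H
  obtain ⟨h', H', h0'⟩ := H'
  exact ⟨_, H.add H', by simp [h0, h0']⟩

lemma NullRight.neg {n : ℕ} {k : K ⟶ L} (H : NullRight n k) : NullRight n (-k) := by
  obtain ⟨h, H, h0⟩ := H
  exact ⟨_, H.neg, by simp [h0]⟩

end NullHtpy

namespace NComplex

variable {𝒞 : Type u} [Category.{v} 𝒞] [Preadditive 𝒞] {n : ℕ} {E : Bifunctor.{w} 𝒞}
  {A B C D : 𝒞}

/-- A null-homotopy on a complex of length `n + 2` only has to be checked in the degrees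
`0, …, n + 1`. -/
lemma nullHtpy_of_le {X : NComplex n A C} {L : CochainComplex 𝒞 ℕ} {k : X.K ⟶ L}
    {h : ∀ i, X.K.X (i + 1) ⟶ L.X i} (h0 : k.f 0 = X.K.d 0 1 ≫ h 0)
    (h1 : ∀ i, i < n → k.f (i + 1) = h i ≫ L.d i (i + 1) + X.K.d (i + 1) (i + 2) ≫ h (i + 1))
    (h2 : k.f (n + 1) = h n ≫ L.d n (n + 1)) : NullHtpy k h where
  zero := h0
  succ i := by
    rcases lt_trichotomy i n with hi | rfl | hi
    · exact h1 i hi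
    · rw [h2, (X.isZero (i + 2) (by omega)).eq_of_tgt (X.K.d (i + 1) (i + 2)) 0, zero_comp,
        add_zero]
    · exact (X.isZero (i + 1) (by omega)).eq_of_src _ _

/-! #### Homotopies built from the left -/

/-- If `X` is an `n`-exangle and `k : X ⟶ L` vanishes in degree `0`, then `k` is null-homotopic up
to an error in the last degree. -/
lemma IsNExangle.exists_partial_left {X : NComplex n A C} {δ : Ext E C A} (hX : X.IsNExangle E δ)
    {L : CochainComplex 𝒞 ℕ} (k : X.K ⟶ L) (hk : k.f 0 = 0) :
    ∃ h : ∀ i, X.K.X (i + 1) ⟶ L.X i, h 0 = 0 ∧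
      ∀ i, i < n → k.f (i + 1) = h i ≫ L.d i (i + 1) + X.K.d (i + 1) (i + 2) ≫ h (i + 1) := by
  suffices H : ∀ m, m ≤ n → ∃ h : ∀ i, X.K.X (i + 1) ⟶ L.X i, h 0 = 0 ∧
      ∀ i, i < m → k.f (i + 1) = h i ≫ L.d i (i + 1) + X.K.d (i + 1) (i + 2) ≫ h (i + 1) from
    H n le_rfl
  intro m
  induction m with
  | zero => exact fun _ => ⟨fun _ => 0, rfl, fun i hi => absurd hi (Nat.not_lt_zero i)⟩
  | succ m ih =>
    intro hm
    obtain ⟨h, h0, h1⟩ := ih (by omega)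
    have key : X.K.d m (m + 1) ≫ (k.f (m + 1) - h m ≫ L.d m (m + 1)) = 0 := by
      rw [Preadditive.comp_sub, ← k.comm]
      rcases m with _ | m
      · simp [hk, h0]
      · rw [h1 m (by omega)]
        simp
    obtain ⟨x, hx⟩ := hX.exact_contravariant m (by omega) _ key
    refine ⟨Function.update h (m + 1) x, ?_, fun i hi => ?_⟩
    · rw [Function.update_of_ne (by omega), h0]
    · rcases Nat.lt_succ_iff_lt_or_eq.mp hi with hi' | rfl
      · rw [Function.update_of_ne (by omega), Function.update_of_ne (by omega), h1 i hi']
      · rw [Function.update_of_ne (by omega), Function.update_self, hx]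
        abel

/-- In a composite `k k'` the error in the last degree disappears. -/
lemma IsNExangle.nullHtpy_comp {X : NComplex n A C} {δ : Ext E C A} (hX : X.IsNExangle E δ)
    {L M : CochainComplex 𝒞 ℕ} (k : X.K ⟶ L) (k' : L ⟶ M) (hk : k.f 0 = 0)
    (hk' : k'.f (n + 1) = 0) : ∃ h, NullHtpy (k ≫ k') h := by
  obtain ⟨h, h0, h1⟩ := hX.exists_partial_left k hk
  refine ⟨fun i => h i ≫ k'.f i, nullHtpy_of_le ?_ ?_ ?_⟩
  · simp [hk, h0]
  · intro i hi
    rw [HomologicalComplex.comp_f, h1 i hi, Preadditive.add_comp, Category.assoc, Category.assoc,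
      Category.assoc, k'.comm]
  · simp [hk']

/-- Two `n`-exangles of the same extension that map to each other relative to the ends are
homotopy equivalent relative to the ends. -/
lemma IsNExangle.htpyEquiv {X Y : NComplex n A C} {δ : Ext E C A} (hX : X.IsNExangle E δ)
    (hY : Y.IsNExangle E δ) {f : X.K ⟶ Y.K} {g : Y.K ⟶ X.K}
    (hf : Lifts (X := X) (Y := Y) f (𝟙 A) (𝟙 C)) (hg : Lifts (X := Y) (Y := X) g (𝟙 A) (𝟙 C)) :
    HtpyEquiv X Y := by
  -- With `k = f g - 1` and `k' = g f - 1`, the square of each is null-homotopic, so that `1 - k`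
  -- and `1 - k'` are inverse to `f g` and `g f` up to homotopy.
  have hk : Lifts (X := X) (Y := X) (f ≫ g - 𝟙 X.K) 0 0 :=
    ((hf.comp hg).sub Lifts.id).of_eq (by simp) (by simp)
  have hk' : Lifts (X := Y) (Y := Y) (g ≫ f - 𝟙 Y.K) 0 0 :=
    ((hg.comp hf).sub Lifts.id).of_eq (by simp) (by simp)
  obtain ⟨h, H⟩ := hX.nullHtpy_comp _ _ hk.f_zero hk.f_last
  obtain ⟨h', H'⟩ := hY.nullHtpy_comp _ _ hk'.f_zero hk'.f_last
  refine ⟨f, g ≫ (𝟙 X.K - (f ≫ g - 𝟙 X.K)), hf, ?_, ?_, ?_⟩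
  · exact (hg.comp (Lifts.id.sub hk)).of_eq (by simp) (by simp)
  · refine NullHtpy.nonempty_homotopy (h := fun i => -h i) ?_
    convert H.neg using 1
    simp only [Preadditive.comp_sub, Preadditive.sub_comp, Category.assoc, Category.comp_id,
      Category.id_comp]
    abel
  · refine NullHtpy.nonempty_homotopy (h := fun i => -h' i) ?_
    convert H'.neg using 1
    simp only [Preadditive.comp_sub, Preadditive.sub_comp, Category.assoc, Category.comp_id,
      Category.id_comp]
    abel

/-- A null-homotopy on an `n`-exangle of a map vanishing in degree `0` may be normalised. -/
lemma IsNExangle.nullLeft_of_nullHtpy (hn : 1 ≤ n) {X : NComplex n A C} {δ : Ext E C A}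
    (hX : X.IsNExangle E δ) {L : CochainComplex 𝒞 ℕ} {k : X.K ⟶ L} (hk : k.f 0 = 0)
    {h : ∀ i, X.K.X (i + 1) ⟶ L.X i} (H : NullHtpy k h) : NullLeft k := by
  obtain ⟨x, hx⟩ := hX.exact_contravariant 0 hn (h 0) (by rw [← H.zero, hk])
  refine ⟨fun i => match i with
    | 0 => 0
    | 1 => h 1 + x ≫ L.d 0 1
    | i + 2 => h (i + 2), ⟨by simp [hk], fun i => ?_⟩, rfl⟩
  rcases i with _ | _ | i
  · have := H.succ 0
    rw [← hx] at this
    simp only [zero_comp, zero_add, Preadditive.comp_add] at this ⊢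
    rw [this, Category.assoc]
    exact add_comm _ _
  · have := H.succ 1
    simpa [Preadditive.add_comp] using this
  · exact H.succ (i + 2)

/-- A map `ν g` out of an `n`-exangle that vanishes at both ends is null-homotopic, if `ν` is an
idempotent up to homotopy whose last component factors through the last differential. -/
lemma IsNExangle.nullLeft_of_split_source (hn : 1 ≤ n) {X : NComplex n A C} {δ : Ext E C A}
    (hX : X.IsNExangle E δ) {K' L : CochainComplex 𝒞 ℕ} {p : X.K ⟶ K'} {i : K' ⟶ X.K}
    (hip : NullLeft (𝟙 K' - i ≫ p)) (σ : X.K.X (n + 1) ⟶ X.K.X n)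
    (hσ : (𝟙 X.K - p ≫ i).f (n + 1) = σ ≫ X.K.d n (n + 1)) (g : X.K ⟶ L)
    (h0 : ((𝟙 X.K - p ≫ i) ≫ g).f 0 = 0) (h1 : ((𝟙 X.K - p ≫ i) ≫ g).f (n + 1) = 0) :
    NullLeft ((𝟙 X.K - p ≫ i) ≫ g) := by
  generalize hν : 𝟙 X.K - p ≫ i = ν at *
  have e : ν ≫ g = ν ≫ ν ≫ g + p ≫ (𝟙 K' - i ≫ p) ≫ i ≫ g := by
    rw [← hν]
    simp only [Preadditive.comp_sub, Preadditive.sub_comp, Category.assoc,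
      Category.id_comp]
    abel
  rw [e]
  refine NullLeft.add ?_ ((hip.postcomp _).precomp _)
  obtain ⟨h, hh0, hh⟩ := hX.exists_partial_left (ν ≫ g) h0
  refine ⟨fun j => ν.f (j + 1) ≫ h j, nullHtpy_of_le ?_ ?_ ?_, by simp [hh0]⟩
  · rw [HomologicalComplex.comp_f, h0, hh0]
    simp
  · intro j hj
    rw [HomologicalComplex.comp_f, hh j hj, Preadditive.comp_add, ← Category.assoc _ (X.K.d _ _),
      ν.comm, Category.assoc, Category.assoc]
  · obtain ⟨m, rfl⟩ : ∃ m, n = m + 1 := ⟨n - 1, by omega⟩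
    have e3 : X.K.d (m + 1) (m + 2) ≫ h (m + 1) ≫ L.d (m + 1) (m + 2) = 0 := by
      have := (ν ≫ g).comm (m + 1) (m + 2)
      rw [h1, hh m (by omega)] at this
      simpa [Preadditive.add_comp] using this
    rw [HomologicalComplex.comp_f, h1, comp_zero, hσ, Category.assoc, Category.assoc]
    exact ((congrArg (σ ≫ ·) e3).trans comp_zero).symm

/-- A map `g ν` out of an `n`-exangle that vanishes at both ends is null-homotopic, if `ν` is an
idempotent up to homotopy whose last component factors through the last differential. -/
lemma IsNExangle.nullLeft_of_split_target (hn : 1 ≤ n) {X : NComplex n A C} {δ : Ext E C A}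
    (hX : X.IsNExangle E δ) {K' L : CochainComplex 𝒞 ℕ} {p : L ⟶ K'} {i : K' ⟶ L}
    (hip : NullLeft (𝟙 K' - i ≫ p)) (σ : L.X (n + 1) ⟶ L.X n)
    (hσ : (𝟙 L - p ≫ i).f (n + 1) = σ ≫ L.d n (n + 1)) (g : X.K ⟶ L)
    (h0 : (g ≫ (𝟙 L - p ≫ i)).f 0 = 0) (h1 : (g ≫ (𝟙 L - p ≫ i)).f (n + 1) = 0) :
    NullLeft (g ≫ (𝟙 L - p ≫ i)) := by
  generalize hν : 𝟙 L - p ≫ i = ν at *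
  have e : g ≫ ν = (g ≫ ν) ≫ ν + g ≫ p ≫ (𝟙 K' - i ≫ p) ≫ i := by
    rw [← hν]
    simp only [Preadditive.comp_sub, Preadditive.sub_comp, Category.assoc, Category.comp_id,
      Category.id_comp]
    abel
  rw [e]
  refine NullLeft.add ?_ (((hip.postcomp _).precomp _).precomp _)
  obtain ⟨h, hh0, hh⟩ := hX.exists_partial_left (g ≫ ν) h0
  obtain ⟨m, rfl⟩ : ∃ m, n = m + 1 := ⟨n - 1, by omega⟩
  have e3 : X.K.d (m + 1) (m + 2) ≫ h (m + 1) ≫ L.d (m + 1) (m + 2) = 0 := by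
    have := (g ≫ ν).comm (m + 1) (m + 2)
    rw [h1, hh m (by omega)] at this
    simpa [Preadditive.add_comp] using this
  let h' : ∀ j, X.K.X (j + 1) ⟶ L.X j :=
    Function.update (fun j => h j ≫ ν.f j) (m + 1)
      (h (m + 1) ≫ ν.f (m + 1) - (h (m + 1) ≫ L.d (m + 1) (m + 2)) ≫ σ)
  have h'm : h' (m + 1) = h (m + 1) ≫ ν.f (m + 1) - (h (m + 1) ≫ L.d (m + 1) (m + 2)) ≫ σ :=
    Function.update_self _ _ _
  have h'ne : ∀ j, j ≠ m + 1 → h' j = h j ≫ ν.f j := fun j hj => Function.update_of_ne hj _ _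
  refine ⟨h', nullHtpy_of_le ?_ ?_ ?_, by rw [h'ne 0 (by omega), hh0, zero_comp]⟩
  · rw [HomologicalComplex.comp_f, h0, h'ne 0 (by omega), hh0]
    simp
  · intro j hj
    have e4 : X.K.d (j + 1) (j + 2) ≫ h' (j + 1) =
        X.K.d (j + 1) (j + 2) ≫ h (j + 1) ≫ ν.f (j + 1) := by
      by_cases hjm : j = m
      · subst hjm
        rw [h'm, Preadditive.comp_sub, sub_eq_self, ← Category.assoc]
        rw [e3, zero_comp]
      · rw [h'ne (j + 1) (by omega)]
    rw [e4, h'ne j (by omega), HomologicalComplex.comp_f, hh j hj, Preadditive.add_comp,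
      Category.assoc, Category.assoc, Category.assoc, ν.comm]
  · rw [HomologicalComplex.comp_f, h1, zero_comp, h'm, Preadditive.sub_comp, Category.assoc,
      ν.comm, Category.assoc, hσ, Category.assoc, sub_self]

/-! #### Homotopies built from the right -/

/-- If `Y` is an `n`-exangle and `k : K ⟶ Y` vanishes in degree `n + 1`, then `k` is
null-homotopic up to an error in degree `0`. -/
lemma IsNExangle.exists_partial_right {Y : NComplex n A C} {δ : Ext E C A}
    (hY : Y.IsNExangle E δ) {K : CochainComplex 𝒞 ℕ} (k : K ⟶ Y.K) (hk : k.f (n + 1) = 0) :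
    ∃ h : ∀ i, K.X (i + 1) ⟶ Y.K.X i, h n = 0 ∧
      ∀ i, i < n → k.f (i + 1) = h i ≫ Y.K.d i (i + 1) + K.d (i + 1) (i + 2) ≫ h (i + 1) := by
  suffices H : ∀ m, m ≤ n → ∃ h : ∀ i, K.X (i + 1) ⟶ Y.K.X i, h n = 0 ∧
      ∀ i, i < n → n ≤ i + m →
        k.f (i + 1) = h i ≫ Y.K.d i (i + 1) + K.d (i + 1) (i + 2) ≫ h (i + 1) by
    obtain ⟨h, h0, h1⟩ := H n le_rfl
    exact ⟨h, h0, fun i hi => h1 i hi (by omega)⟩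
  intro m
  induction m with
  | zero => exact fun _ => ⟨fun _ => 0, rfl, fun i hi hi' => by omega⟩
  | succ m ih =>
    intro hm
    obtain ⟨h, h0, h1⟩ := ih (by omega)
    obtain ⟨j, hj⟩ : ∃ j, n = j + m + 1 := ⟨n - (m + 1), by omega⟩
    have key : (k.f (j + 1) - K.d (j + 1) (j + 2) ≫ h (j + 1)) ≫ Y.K.d (j + 1) (j + 2) = 0 := by
      rw [Preadditive.sub_comp, k.comm, Category.assoc]
      by_cases hjn : j + 1 = n
      · subst hjn
        rw [h0, hk]
        simp
      · have := h1 (j + 1) (by omega) (by omega)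
        rw [show k.f (j + 2) = _ from this]
        simp
    obtain ⟨x, hx⟩ := hY.exact_covariant j (by omega) _ key
    refine ⟨Function.update h j x, ?_, fun i hi hi' => ?_⟩
    · rw [Function.update_of_ne (by omega), h0]
    · by_cases hij : i = j
      · subst hij
        rw [Function.update_of_ne (show i + 1 ≠ i by omega), Function.update_self, hx]
        abel
      · rw [Function.update_of_ne hij, Function.update_of_ne (by omega), h1 i hi (by omega)]

/-- A null-homotopy into an `n`-exangle of a map vanishing in degree `n + 1` may be normalised. -/
lemma IsNExangle.nullRight_of_nullHtpy (hn : 1 ≤ n) {X : NComplex n B D} {Y : NComplex n A C}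
    {δ : Ext E C A} (hY : Y.IsNExangle E δ) {k : X.K ⟶ Y.K} (hk : k.f (n + 1) = 0)
    {h : ∀ i, X.K.X (i + 1) ⟶ Y.K.X i} (H : NullHtpy k h) : NullRight n k := by
  obtain ⟨m, rfl⟩ : ∃ m, n = m + 1 := ⟨n - 1, by omega⟩
  obtain ⟨x, hx⟩ := hY.exact_covariant m (by omega) (h (m + 1)) (by
    have := H.succ (m + 1)
    rw [hk, (X.isZero (m + 3) (by omega)).eq_of_tgt (X.K.d (m + 1 + 1) (m + 1 + 2)) 0, zero_comp,
      add_zero] at this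
    exact this.symm)
  let h' : ∀ j, X.K.X (j + 1) ⟶ Y.K.X j :=
    Function.update (Function.update h (m + 1) 0) m (h m + X.K.d (m + 1) (m + 2) ≫ x)
  have h'm : h' m = h m + X.K.d (m + 1) (m + 2) ≫ x := Function.update_self _ _ _
  have h'n : h' (m + 1) = 0 := by
    simp only [h']
    rw [Function.update_of_ne (by omega), Function.update_self]
  have h'ne : ∀ j, j < m → h' j = h j := fun j hj => by
    simp only [h']
    rw [Function.update_of_ne (by omega), Function.update_of_ne (by omega)]
  have hd : ∀ j, j ≤ m → X.K.d j (j + 1) ≫ h' j = X.K.d j (j + 1) ≫ h j := fun j hj => by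
    rcases hj.lt_or_eq with hj | rfl
    · rw [h'ne j hj]
    · rw [h'm, Preadditive.comp_add, ← Category.assoc, X.K.d_comp_d, zero_comp, add_zero]
  refine ⟨h', nullHtpy_of_le ?_ ?_ ?_, h'n⟩
  · rw [H.zero, hd 0 (by omega)]
  · intro j hj
    by_cases hjm : j = m
    · subst hjm
      rw [h'n, h'm, H.succ, ← hx]
      simp
    · rw [h'ne j (by omega), hd (j + 1) (by omega), H.succ]
  · rw [hk, h'n, zero_comp]

/-- A map `g ν` into an `n`-exangle that vanishes at both ends is null-homotopic, if `ν` is an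
idempotent up to homotopy whose first component factors through the first differential. -/
lemma IsNExangle.nullRight_of_split_target (hn : 1 ≤ n) {X : NComplex n B D}
    {Y : NComplex n A C} {δ : Ext E C A} (hY : Y.IsNExangle E δ) {K' : CochainComplex 𝒞 ℕ}
    {p : Y.K ⟶ K'} {i : K' ⟶ Y.K} (hip : NullRight n (𝟙 K' - i ≫ p)) (τ : Y.K.X 1 ⟶ Y.K.X 0)
    (hτ : (𝟙 Y.K - p ≫ i).f 0 = Y.K.d 0 1 ≫ τ) (g : X.K ⟶ Y.K)
    (h0 : (g ≫ (𝟙 Y.K - p ≫ i)).f 0 = 0) (h1 : (g ≫ (𝟙 Y.K - p ≫ i)).f (n + 1) = 0) :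
    NullRight n (g ≫ (𝟙 Y.K - p ≫ i)) := by
  generalize hν : 𝟙 Y.K - p ≫ i = ν at *
  have e : g ≫ ν = (g ≫ ν) ≫ ν + g ≫ p ≫ (𝟙 K' - i ≫ p) ≫ i := by
    rw [← hν]
    simp only [Preadditive.comp_sub, Preadditive.sub_comp, Category.assoc, Category.comp_id,
      Category.id_comp]
    abel
  rw [e]
  refine NullRight.add ?_ (((hip.postcomp _).precomp _).precomp _)
  obtain ⟨h, hh0, hh⟩ := hY.exists_partial_right (g ≫ ν) h1
  refine ⟨fun j => h j ≫ ν.f j, nullHtpy_of_le ?_ ?_ ?_, by simp [hh0]⟩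
  · have e3 : X.K.d 0 1 ≫ h 0 ≫ Y.K.d 0 1 = 0 := by
      have := (g ≫ ν).comm 0 1
      rw [h0, zero_comp, hh 0 (by omega)] at this
      simpa [Preadditive.comp_add] using this.symm
    rw [HomologicalComplex.comp_f, h0, zero_comp, hτ]
    simpa using (congrArg (· ≫ τ) e3).symm
  · intro j hj
    rw [HomologicalComplex.comp_f, hh j hj, Preadditive.add_comp, Category.assoc, Category.assoc,
      Category.assoc, ν.comm]
  · rw [HomologicalComplex.comp_f, h1, hh0]
    simp

/-- A map `ν g` into an `n`-exangle that vanishes at both ends is null-homotopic, if `ν` is an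
idempotent up to homotopy whose first component factors through the first differential. -/
lemma IsNExangle.nullRight_of_split_source (hn : 1 ≤ n) {X : NComplex n B D}
    {Y : NComplex n A C} {δ : Ext E C A} (hY : Y.IsNExangle E δ) {K' : CochainComplex 𝒞 ℕ}
    {p : X.K ⟶ K'} {i : K' ⟶ X.K} (hip : NullRight n (𝟙 K' - i ≫ p)) (τ : X.K.X 1 ⟶ X.K.X 0)
    (hτ : (𝟙 X.K - p ≫ i).f 0 = X.K.d 0 1 ≫ τ) (g : X.K ⟶ Y.K)
    (h0 : ((𝟙 X.K - p ≫ i) ≫ g).f 0 = 0) (h1 : ((𝟙 X.K - p ≫ i) ≫ g).f (n + 1) = 0) :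
    NullRight n ((𝟙 X.K - p ≫ i) ≫ g) := by
  generalize hν : 𝟙 X.K - p ≫ i = ν at *
  have e : ν ≫ g = ν ≫ ν ≫ g + p ≫ (𝟙 K' - i ≫ p) ≫ i ≫ g := by
    rw [← hν]
    simp only [Preadditive.comp_sub, Preadditive.sub_comp, Category.assoc,
      Category.id_comp]
    abel
  rw [e]
  refine NullRight.add ?_ ((hip.postcomp _).precomp _)
  obtain ⟨h, hh0, hh⟩ := hY.exists_partial_right (ν ≫ g) h1
  have e3 : X.K.d 0 1 ≫ h 0 ≫ Y.K.d 0 1 = 0 := by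
    have := (ν ≫ g).comm 0 1
    rw [h0, zero_comp, hh 0 (by omega)] at this
    simpa [Preadditive.comp_add] using this.symm
  let h' : ∀ j, X.K.X (j + 1) ⟶ Y.K.X j :=
    Function.update (fun j => ν.f (j + 1) ≫ h j) 0 (ν.f 1 ≫ h 0 - τ ≫ X.K.d 0 1 ≫ h 0)
  have h'0 : h' 0 = ν.f 1 ≫ h 0 - τ ≫ X.K.d 0 1 ≫ h 0 := Function.update_self _ _ _
  have h'ne : ∀ j, j ≠ 0 → h' j = ν.f (j + 1) ≫ h j := fun j hj => Function.update_of_ne hj _ _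
  refine ⟨h', nullHtpy_of_le ?_ ?_ ?_, by rw [h'ne n (by omega), hh0, comp_zero]⟩
  · rw [HomologicalComplex.comp_f, h0, comp_zero, h'0, Preadditive.comp_sub, ← Category.assoc,
      ← ν.comm, ← Category.assoc _ τ, ← hτ, Category.assoc, sub_self]
  · intro j hj
    have e4 : h' j ≫ Y.K.d j (j + 1) = ν.f (j + 1) ≫ h j ≫ Y.K.d j (j + 1) := by
      rcases j with _ | j
      · rw [h'0, Preadditive.sub_comp, Category.assoc, sub_eq_self, Category.assoc,
          Category.assoc]
        rw [e3, comp_zero]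
      · rw [h'ne _ (by omega), Category.assoc]
    rw [e4, h'ne (j + 1) (by omega), HomologicalComplex.comp_f, hh j hj, Preadditive.comp_add,
      ← Category.assoc _ (X.K.d _ _), ν.comm, Category.assoc]
  · rw [HomologicalComplex.comp_f, h1, h'ne n (by omega), hh0]
    simp

end NComplex

/-! ### Realisations -/

namespace ExtData

variable {n : ℕ} {𝒞 : Type u} [Category.{v} 𝒞] [Preadditive 𝒞]

/-- The axioms of an exact realisation, except for the realisation of the trivial complexes. -/
structure IsRealisation (S : ExtData.{w} n 𝒞) : Prop where
  isClass : ∀ {A C : 𝒞} (δ : Ext S.E C A), ∃ X : NComplex n A C, S.s δ = X.cls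
  exists_lift : ∀ {A B C D : 𝒞} (δ : Ext S.E C A) (ρ : Ext S.E D B) (a : A ⟶ B) (c : C ⟶ D),
    push S.E a δ = pull S.E c ρ → ∀ X ∈ S.s δ, ∀ Y ∈ S.s ρ,
      ∃ f : X.K ⟶ Y.K, NComplex.Lifts (X := X) (Y := Y) f a c
  isNExangle : ∀ {A C : 𝒞} (δ : Ext S.E C A), ∀ X ∈ S.s δ, X.IsNExangle S.E δ

lemma IsExactRealisation.isRealisation {S : ExtData.{w} n 𝒞} (hS : S.IsExactRealisation) :
    S.IsRealisation :=
  ⟨hS.isClass, hS.exists_lift, hS.isNExangle⟩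

namespace IsRealisation

variable {S : ExtData.{w} n 𝒞} {A C : 𝒞}

lemma exists_mem (hS : S.IsRealisation) (δ : Ext S.E C A) : ∃ X, X ∈ S.s δ := by
  obtain ⟨X, hX⟩ := hS.isClass δ
  exact ⟨X, hX ▸ NComplex.HtpyEquiv.refl X⟩

lemma mem_of_htpyEquiv (hS : S.IsRealisation) {δ : Ext S.E C A} {X Y : NComplex n A C}
    (hX : X ∈ S.s δ)
    (h : X.HtpyEquiv Y) : Y ∈ S.s δ := by
  obtain ⟨Z, hZ⟩ := hS.isClass δ
  rw [hZ] at hX ⊢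
  exact NComplex.HtpyEquiv.trans hX h

/-- An `n`-exangle that is comparable with a realisation is itself a realisation. -/
lemma mem_of_isNExangle (hS : S.IsRealisation) {δ : Ext S.E C A} {X Y : NComplex n A C}
    (hX : X ∈ S.s δ)
    (hY : Y.IsNExangle S.E δ) {f : X.K ⟶ Y.K} {g : Y.K ⟶ X.K}
    (hf : NComplex.Lifts (X := X) (Y := Y) f (𝟙 A) (𝟙 C))
    (hg : NComplex.Lifts (X := Y) (Y := X) g (𝟙 A) (𝟙 C)) : Y ∈ S.s δ :=
  hS.mem_of_htpyEquiv hX ((hS.isNExangle δ X hX).htpyEquiv hY hf hg)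

/-- A homotopy retract of a realisation is a realisation. -/
lemma mem_of_retract (hS : S.IsRealisation) {A' C' : 𝒞} {δ : Ext S.E C A}
    {δ' : Ext S.E C' A'} {X : NComplex n A C}
    {X' : NComplex n A' C'} (hX : X ∈ S.s δ) {i : X'.K ⟶ X.K} {p : X.K ⟶ X'.K} {a : A' ⟶ A}
    {c : C' ⟶ C} {a' : A ⟶ A'} {c' : C ⟶ C'}
    (hi : NComplex.Lifts (X := X') (Y := X) i a c)
    (hp : NComplex.Lifts (X := X) (Y := X') p a' c')
    (ha : a ≫ a' = 𝟙 A') (hc : c ≫ c' = 𝟙 C')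
    (h₁ : push S.E a δ' = pull S.E c δ) (h₂ : push S.E a' δ = pull S.E c' δ')
    (H : ∀ j, j < n → ∃ (s : X'.K.X (j + 1) ⟶ X'.K.X j) (t : X'.K.X (j + 2) ⟶ X'.K.X (j + 1)),
      i.f (j + 1) ≫ p.f (j + 1) = 𝟙 _ + s ≫ X'.K.d j (j + 1) + X'.K.d (j + 1) (j + 2) ≫ t) :
    X' ∈ S.s δ' := by
  obtain ⟨N, hN⟩ := hS.exists_mem δ'
  obtain ⟨f, hf⟩ := hS.exists_lift δ' δ a c h₁ N hN X hX
  obtain ⟨g, hg⟩ := hS.exists_lift δ δ' a' c' h₂ X hX N hN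
  exact hS.mem_of_isNExangle hN ((hS.isNExangle δ X hX).of_retract hi hp ha hc h₁ h₂ H)
    ((hf.comp hp).of_eq ha hc) ((hi.comp hg).of_eq ha hc)

end IsRealisation

end ExtData

/-! ### Contractible complexes concentrated in two degrees -/

section Disk

variable {𝒞 : Type u} [Category.{v} 𝒞] [Preadditive 𝒞]

/-- `T` is isomorphic to a complex `D = D`, concentrated in the degrees `m` and `m + 1`. -/
structure IsDisk (T : CochainComplex 𝒞 ℕ) (m : ℕ) : Prop where
  isIso : IsIso (T.d m (m + 1))
  isZero : ∀ i, i ≠ m → i ≠ m + 1 → IsZero (T.X i)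

lemma exists_isDisk [HasZeroObject 𝒞] (m : ℕ) (D : 𝒞) :
    ∃ T : CochainComplex 𝒞 ℕ, IsDisk T m ∧ Nonempty (T.X m ≅ D) ∧
      Nonempty (T.X (m + 1) ≅ D) := by
  have hm : (ComplexShape.up ℕ).Rel m (m + 1) := rfl
  refine ⟨HomologicalComplex.double (𝟙 D) hm, ⟨?_, fun i h₀ h₁ => ?_⟩,
    ⟨HomologicalComplex.doubleXIso₀ (𝟙 D) hm⟩,
    ⟨HomologicalComplex.doubleXIso₁ (𝟙 D) hm (Nat.succ_ne_self m).symm⟩⟩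
  · rw [HomologicalComplex.double_d (𝟙 D) hm (Nat.succ_ne_self m).symm]
    infer_instance
  · exact HomologicalComplex.isZero_double_X (𝟙 D) hm i h₀ h₁

variable {T K : CochainComplex 𝒞 ℕ} {m : ℕ}

lemma IsDisk.exists_hom_from (hT : IsDisk T m) (φ : T.X m ⟶ K.X m) :
    ∃ f : T ⟶ K, f.f m = φ := by
  have := hT.isIso
  let F : ∀ i, T.X i ⟶ K.X i := Function.update (Function.update (fun _ => 0) (m + 1)
    (inv (T.d m (m + 1)) ≫ φ ≫ K.d m (m + 1))) m φ
  have h0 : F m = φ := Function.update_self _ _ _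
  have h1 : F (m + 1) = inv (T.d m (m + 1)) ≫ φ ≫ K.d m (m + 1) := by
    simp only [F]
    rw [Function.update_of_ne (by omega), Function.update_self]
  refine ⟨{ f := F, comm' := ?_ }, h0⟩
  rintro i _ rfl
  by_cases hi : i = m
  · subst hi
    rw [h0, h1, IsIso.hom_inv_id_assoc]
  by_cases hi' : i = m + 1
  · subst hi'
    rw [h1, (hT.isZero (m + 1 + 1) (by omega) (by omega)).eq_of_tgt (T.d (m + 1) (m + 1 + 1)) 0]
    simp
  · exact (hT.isZero i hi hi').eq_of_src _ _

lemma IsDisk.exists_hom_to (hT : IsDisk T m) (ψ : K.X (m + 1) ⟶ T.X (m + 1)) :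
    ∃ f : K ⟶ T, f.f (m + 1) = ψ := by
  have := hT.isIso
  let F : ∀ i, K.X i ⟶ T.X i := Function.update (Function.update (fun _ => 0) (m + 1) ψ) m
    (K.d m (m + 1) ≫ ψ ≫ inv (T.d m (m + 1)))
  have h0 : F m = K.d m (m + 1) ≫ ψ ≫ inv (T.d m (m + 1)) := Function.update_self _ _ _
  have h1 : F (m + 1) = ψ := by
    simp only [F]
    rw [Function.update_of_ne (by omega), Function.update_self]
  refine ⟨{ f := F, comm' := ?_ }, h1⟩
  rintro i _ rfl
  by_cases hi : i = m
  · subst hi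
    rw [h0, h1]
    simp
  by_cases hi' : i + 1 = m
  · subst hi'
    rw [h0, (hT.isZero i (by omega) (by omega)).eq_of_src (T.d i (i + 1)) 0]
    simp
  · exact (hT.isZero (i + 1) hi' (by omega)).eq_of_tgt _ _

variable {n : ℕ} {A C : 𝒞}

lemma NComplex.IsTrivFirst.isDisk {X : NComplex n A C} (hX : X.IsTrivFirst) : IsDisk X.K 0 :=
  ⟨hX.isIso, fun i h₀ h₁ => hX.isZero i (by omega)⟩

lemma NComplex.IsTrivLast.isDisk {X : NComplex n A C} (hX : X.IsTrivLast) : IsDisk X.K n := by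
  refine ⟨hX.isIso, fun i h₀ h₁ => ?_⟩
  rcases lt_or_ge i n with hi | hi
  · exact hX.isZero i hi
  · exact X.isZero i (by omega)

lemma exists_isTrivFirst [HasZeroObject 𝒞] (hn : 1 ≤ n) (A : 𝒞) {Z : 𝒞} (hZ : IsZero Z) :
    ∃ X : NComplex n A Z, X.IsTrivFirst := by
  obtain ⟨T, hT, ⟨e⟩, -⟩ := exists_isDisk (𝒞 := 𝒞) 0 A
  exact ⟨⟨T, fun i hi => hT.isZero i (by omega) (by omega), e,
    (hT.isZero (n + 1) (by omega) (by omega)).iso hZ⟩, hT.isIso,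
    fun i hi => hT.isZero i (by omega) (by omega)⟩

lemma exists_isTrivLast [HasZeroObject 𝒞] (hn : 1 ≤ n) (C : 𝒞) {Z : 𝒞} (hZ : IsZero Z) :
    ∃ X : NComplex n Z C, X.IsTrivLast := by
  obtain ⟨T, hT, -, ⟨e⟩⟩ := exists_isDisk (𝒞 := 𝒞) n C
  exact ⟨⟨T, fun i hi => hT.isZero i (by omega) (by omega),
    (hT.isZero 0 (by omega) (by omega)).iso hZ, e⟩, hT.isIso,
    fun i hi => hT.isZero i (by omega) (by omega)⟩

end Disk

/-! ### Lifting a pair of idempotents to an idempotent -/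

namespace NComplex

variable {𝒞 : Type u} [Category.{v} 𝒞] [Preadditive 𝒞] [HasBinaryBiproducts 𝒞] {n : ℕ} {A C : 𝒞}

/-- The direct sum of `X` and a complex concentrated in inner degrees, as a complex with the same
ends as `X`. -/
noncomputable def addInner (X : NComplex n A C) (T : CochainComplex 𝒞 ℕ)
    (h0 : IsZero (T.X 0)) (h1 : ∀ i, n < i → IsZero (T.X i)) : NComplex n A C where
  K := X.K ⊞ T
  isZero i hi := by
    rw [IsZero.iff_id_eq_zero, ← HomologicalComplex.biprod_total_f,
      (X.isZero i hi).eq_of_tgt ((biprod.fst : X.K ⊞ T ⟶ X.K).f i) 0,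
      (h1 i (by omega)).eq_of_tgt ((biprod.snd : X.K ⊞ T ⟶ T).f i) 0]
    simp
  left :=
    { hom := (biprod.fst : X.K ⊞ T ⟶ X.K).f 0 ≫ X.left.hom
      inv := X.left.inv ≫ (biprod.inl : X.K ⟶ X.K ⊞ T).f 0
      hom_inv_id := by
        have := HomologicalComplex.biprod_total_f X.K T 0
        rw [h0.eq_of_tgt ((biprod.snd : X.K ⊞ T ⟶ T).f 0) 0, zero_comp, add_zero] at this
        simpa using this
      inv_hom_id := by simp }
  right :=
    { hom := (biprod.fst : X.K ⊞ T ⟶ X.K).f (n + 1) ≫ X.right.hom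
      inv := X.right.inv ≫ (biprod.inl : X.K ⟶ X.K ⊞ T).f (n + 1)
      hom_inv_id := by
        have := HomologicalComplex.biprod_total_f X.K T (n + 1)
        rw [(h1 (n + 1) (by omega)).eq_of_tgt ((biprod.snd : X.K ⊞ T ⟶ T).f (n + 1)) 0, zero_comp,
          add_zero] at this
        simpa using this
      inv_hom_id := by simp }

end NComplex

namespace ExtData.IsRealisation

variable {n : ℕ} {𝒞 : Type u} [Category.{v} 𝒞] [Preadditive 𝒞] [HasBinaryBiproducts 𝒞]
  {S : ExtData.{w} n 𝒞} {A C : 𝒞} {δ : Ext S.E C A}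

/-- Adding a contractible complex in inner degrees does not change the realisation. -/
lemma addInner_mem (hS : S.IsRealisation) {X : NComplex n A C} (hX : X ∈ S.s δ)
    {T : CochainComplex 𝒞 ℕ} {m : ℕ} (hT : IsDisk T m) (h0 : IsZero (T.X 0))
    (h1 : ∀ i, n < i → IsZero (T.X i)) : X.addInner T h0 h1 ∈ S.s δ := by
  have := hT.isIso
  refine hS.mem_of_retract hX (X' := X.addInner T h0 h1) (i := biprod.fst) (p := biprod.inl)
    (a := 𝟙 A) (c := 𝟙 C) (a' := 𝟙 A) (c' := 𝟙 C) ?_ ?_ (by simp) (by simp) (by simp) (by simp) ?_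
  · exact ⟨(Category.comp_id _).symm, (Category.comp_id _).symm⟩
  · constructor <;> simp [NComplex.addInner]
  · intro j hj
    have tot : (biprod.fst : X.K ⊞ T ⟶ X.K).f (j + 1) ≫ (biprod.inl : X.K ⟶ X.K ⊞ T).f (j + 1) =
        𝟙 _ - (biprod.snd : X.K ⊞ T ⟶ T).f (j + 1) ≫ (biprod.inr : T ⟶ X.K ⊞ T).f (j + 1) := by
      rw [eq_sub_iff_add_eq, HomologicalComplex.biprod_total_f]
    change ∃ (s : (X.K ⊞ T).X (j + 1) ⟶ (X.K ⊞ T).X j)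
      (t : (X.K ⊞ T).X (j + 2) ⟶ (X.K ⊞ T).X (j + 1)), _ ≫ _ = 𝟙 ((X.K ⊞ T).X (j + 1)) +
        s ≫ (X.K ⊞ T).d j (j + 1) + (X.K ⊞ T).d (j + 1) (j + 2) ≫ t
    rw [tot]
    by_cases h : j + 1 = m
    · subst h
      refine ⟨0, -((biprod.snd : X.K ⊞ T ⟶ T).f (j + 2) ≫ inv (T.d (j + 1) (j + 2)) ≫
        (biprod.inr : T ⟶ X.K ⊞ T).f (j + 1)), ?_⟩
      rw [Preadditive.comp_neg, ← Category.assoc ((X.K ⊞ T).d _ _),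
        ← (biprod.snd : X.K ⊞ T ⟶ T).comm, Category.assoc, IsIso.hom_inv_id_assoc, zero_comp,
        add_zero, sub_eq_add_neg]
    by_cases h' : j = m
    · subst h'
      refine ⟨-((biprod.snd : X.K ⊞ T ⟶ T).f (j + 1) ≫ inv (T.d j (j + 1)) ≫
        (biprod.inr : T ⟶ X.K ⊞ T).f j), 0, ?_⟩
      rw [Preadditive.neg_comp, Category.assoc, Category.assoc,
        (biprod.inr : T ⟶ X.K ⊞ T).comm, IsIso.inv_hom_id_assoc, comp_zero,
        add_zero, sub_eq_add_neg]
    · refine ⟨0, 0, ?_⟩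
      rw [(hT.isZero (j + 1) h (by omega)).eq_of_tgt ((biprod.snd : X.K ⊞ T ⟶ T).f (j + 1)) 0]
      simp

/-- A lift of `(r, q)` that is idempotent in the degrees `≤ m` may be replaced by one that is
idempotent in the degrees `≤ m + 1`, at the cost of adding a contractible summand to `X`. -/
lemma exists_lift_idem_succ [HasZeroObject 𝒞] (hS : S.IsRealisation) {r : A ⟶ A} {q : C ⟶ C}
    {m : ℕ} (hm : m + 2 ≤ n) {X : NComplex n A C} (hX : X ∈ S.s δ) {f : X.K ⟶ X.K}
    (hf : NComplex.Lifts (X := X) (Y := X) f r q) (hi : ∀ i, i ≤ m → f.f i ≫ f.f i = f.f i) :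
    ∃ X' ∈ S.s δ, ∃ f' : X'.K ⟶ X'.K, NComplex.Lifts (X := X') (Y := X') f' r q ∧
      ∀ i, i ≤ m + 1 → f'.f i ≫ f'.f i = f'.f i := by
  obtain ⟨h, hh⟩ := (hS.isNExangle δ X hX).exact_contravariant m (by omega)
    (f.f (m + 1) ≫ f.f (m + 1) - f.f (m + 1)) (by
      rw [Preadditive.comp_sub, ← Category.assoc, ← f.comm, Category.assoc, ← f.comm,
        ← Category.assoc, hi m le_rfl, sub_self])
  obtain ⟨T, hT, ⟨e⟩, -⟩ := exists_isDisk (𝒞 := 𝒞) (m + 1) (X.K.X (m + 1))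
  have := hT.isIso
  have hT0 : IsZero (T.X 0) := hT.isZero 0 (by omega) (by omega)
  have hT1 : ∀ i, n < i → IsZero (T.X i) := fun i hi => hT.isZero i (by omega) (by omega)
  -- The matrix `(f, f - f²; 1, 1 - f)` is idempotent; its entries in degree `m + 1` extend to
  -- morphisms of complexes because `f² - f` factors through the differential of `X`.
  obtain ⟨b, hb⟩ := hT.exists_hom_from (K := X.K) e.hom
  obtain ⟨a, ha'⟩ := hT.exists_hom_to (K := X.K) (-h ≫ e.inv ≫ T.d (m + 1) (m + 2))
  obtain ⟨c, hc⟩ := hT.exists_hom_from (K := T) (e.hom ≫ (𝟙 _ - f.f (m + 1)) ≫ e.inv)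
  have ha : a.f (m + 1) = (f.f (m + 1) - f.f (m + 1) ≫ f.f (m + 1)) ≫ e.inv := by
    rw [← cancel_mono (T.d (m + 1) (m + 2)), a.comm, show a.f (m + 2) = _ from ha',
      Preadditive.comp_neg, ← Category.assoc, hh, ← Preadditive.neg_comp, neg_sub, Category.assoc]
  let F : X.K ⊞ T ⟶ X.K ⊞ T := biprod.fst ≫ f ≫ biprod.inl + biprod.fst ≫ a ≫ biprod.inr +
    biprod.snd ≫ b ≫ biprod.inl + biprod.snd ≫ c ≫ biprod.inr
  have hF : F ≫ F - F = biprod.fst ≫ (f ≫ f + a ≫ b - f) ≫ biprod.inl +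
      biprod.fst ≫ (f ≫ a + a ≫ c - a) ≫ biprod.inr +
      biprod.snd ≫ (b ≫ f + c ≫ b - b) ≫ biprod.inl +
      biprod.snd ≫ (b ≫ a + c ≫ c - c) ≫ biprod.inr := by
    simp only [F, Preadditive.add_comp, Preadditive.comp_add, Preadditive.comp_sub,
      Preadditive.sub_comp, Category.assoc, biprod.inl_fst_assoc, biprod.inl_snd_assoc,
      biprod.inr_fst_assoc, biprod.inr_snd_assoc, zero_comp, comp_zero, add_zero, zero_add]
    abel
  refine ⟨X.addInner T hT0 hT1, hS.addInner_mem hX hT hT0 hT1, F, ⟨?_, ?_⟩, fun i him => ?_⟩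
  · have : (F ≫ biprod.fst).f 0 = (biprod.fst ≫ f).f 0 + (biprod.snd ≫ b).f 0 := by
      rw [← HomologicalComplex.add_f_apply]
      congr 1
      simp [F]
    change F.f 0 ≫ (biprod.fst : X.K ⊞ T ⟶ X.K).f 0 ≫ X.left.hom = (_ ≫ X.left.hom) ≫ r
    rw [← Category.assoc, ← HomologicalComplex.comp_f, this, HomologicalComplex.comp_f,
      HomologicalComplex.comp_f, hT0.eq_of_src (b.f 0) 0, comp_zero, add_zero, Category.assoc,
      hf.1, Category.assoc]
  · have : (F ≫ biprod.fst).f (n + 1) = (biprod.fst ≫ f).f (n + 1) + (biprod.snd ≫ b).f (n + 1) := by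
      rw [← HomologicalComplex.add_f_apply]
      congr 1
      simp [F]
    change F.f (n + 1) ≫ (biprod.fst : X.K ⊞ T ⟶ X.K).f (n + 1) ≫ X.right.hom =
      (_ ≫ X.right.hom) ≫ q
    rw [← Category.assoc, ← HomologicalComplex.comp_f, this, HomologicalComplex.comp_f,
      HomologicalComplex.comp_f, (hT1 (n + 1) (by omega)).eq_of_src (b.f (n + 1)) 0, comp_zero,
      add_zero, Category.assoc, hf.2, Category.assoc]
  · change F.f i ≫ F.f i = F.f i
    rw [← sub_eq_zero, ← HomologicalComplex.comp_f, ← HomologicalComplex.sub_f_apply, hF]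
    simp only [HomologicalComplex.add_f_apply, HomologicalComplex.comp_f,
      HomologicalComplex.sub_f_apply]
    by_cases him' : i = m + 1
    · subst him'
      rw [hb, ha, hc]
      simp only [Preadditive.add_comp, Preadditive.comp_add, Preadditive.comp_sub,
        Preadditive.sub_comp, Category.assoc, Iso.inv_hom_id, Iso.inv_hom_id_assoc,
        Category.comp_id, Category.id_comp]
      abel
    · rw [(hT.isZero i him' (by omega)).eq_of_src (b.f i) 0,
        (hT.isZero i him' (by omega)).eq_of_src (c.f i) 0,
        (hT.isZero i him' (by omega)).eq_of_tgt (a.f i) 0, hi i (by omega)]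
      simp

/-- Every extension that is fixed by idempotents `r` and `q` of its ends has a realisation with an
idempotent endomorphism lifting `(r, q)`. -/
theorem exists_idempotent_lift [HasZeroObject 𝒞] (hn : 1 ≤ n) (hS : S.IsRealisation)
    {r : A ⟶ A} {q : C ⟶ C} (hr : r ≫ r = r) (hq : q ≫ q = q) (h₁ : push S.E r δ = δ)
    (h₂ : pull S.E q δ = δ) :
    ∃ X ∈ S.s δ, ∃ e : X.K ⟶ X.K, e ≫ e = e ∧ NComplex.Lifts (X := X) (Y := X) e r q := by
  have step : ∀ m, m + 1 ≤ n → ∃ X ∈ S.s δ, ∃ f : X.K ⟶ X.K,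
      NComplex.Lifts (X := X) (Y := X) f r q ∧ ∀ i, i ≤ m → f.f i ≫ f.f i = f.f i := by
    intro m
    induction m with
    | zero =>
      intro _
      obtain ⟨X, hX⟩ := hS.exists_mem δ
      obtain ⟨f, hf⟩ := hS.exists_lift δ δ r q (h₁.trans h₂.symm) X hX X hX
      refine ⟨X, hX, f, hf, fun i hi => ?_⟩
      obtain rfl : i = 0 := by omega
      rw [← cancel_mono X.left.hom, Category.assoc, hf.1, ← Category.assoc, hf.1, Category.assoc,
        hr]
    | succ m ih =>
      intro hm
      obtain ⟨X, hX, f, hf, hi⟩ := ih (by omega)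
      exact hS.exists_lift_idem_succ (by omega) hX hf hi
  obtain ⟨m, rfl⟩ : ∃ m, n = m + 1 := ⟨n - 1, by omega⟩
  obtain ⟨X, hX, f, hf, hi⟩ := step m le_rfl
  have hlast : f.f (m + 2) ≫ f.f (m + 2) = f.f (m + 2) := by
    rw [← cancel_mono X.right.hom, Category.assoc, hf.2, ← Category.assoc, hf.2, Category.assoc,
      hq]
  -- In the remaining degree `m + 1`, the square of `f² - f` is zero.
  obtain ⟨h, hh⟩ := (hS.isNExangle δ X hX).exact_contravariant m (by omega)
    (f.f (m + 1) ≫ f.f (m + 1) - f.f (m + 1)) (by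
      rw [Preadditive.comp_sub, ← Category.assoc, ← f.comm, Category.assoc, ← f.comm,
        ← Category.assoc, hi m le_rfl, sub_self])
  have hsq : (f.f (m + 1) ≫ f.f (m + 1) - f.f (m + 1)) ≫
      (f.f (m + 1) ≫ f.f (m + 1) - f.f (m + 1)) = 0 := by
    nth_rw 2 [← hh]
    rw [← Category.assoc, Preadditive.sub_comp, Category.assoc, f.comm, ← Category.assoc, f.comm,
      Category.assoc, hlast, sub_self, zero_comp]
  refine ⟨X, hX, f ≫ f + f ≫ f + f ≫ f - (f ≫ f ≫ f + f ≫ f ≫ f), ?_, ?_⟩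
  · ext i
    rcases lt_trichotomy i (m + 1) with him | rfl | him
    · have := hi i (by omega)
      simp [Preadditive.sub_comp, Preadditive.comp_sub, this]
    · simp only [HomologicalComplex.comp_f, HomologicalComplex.sub_f_apply,
        HomologicalComplex.add_f_apply]
      -- With `k = f² - f` and `e = 3f² - 2f³`, one has `e² - e = k² (4 f² - 4 f - 3)`.
      generalize f.f (m + 1) = x at hsq
      have key : ∀ x : End (X.K.X (m + 1)), (x * x - x) * (x * x - x) = 0 →
          (x * x + x * x + x * x - ((x * x) * x + (x * x) * x)) *
            (x * x + x * x + x * x - ((x * x) * x + (x * x) * x)) =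
            x * x + x * x + x * x - ((x * x) * x + (x * x) * x) := by
        intro x hx
        have : (x * x + x * x + x * x - ((x * x) * x + (x * x) * x)) *
            (x * x + x * x + x * x - ((x * x) * x + (x * x) * x)) -
            (x * x + x * x + x * x - ((x * x) * x + (x * x) * x)) =
            ((x * x - x) * (x * x - x)) * (4 • (x * x) - 4 • x - 3) := by noncomm_ring
        rw [hx, zero_mul, sub_eq_zero] at this
        exact this
      exact key x hsq
    · rcases Nat.lt_or_ge (m + 2) i with him' | him'
      · exact (X.isZero i (by omega)).eq_of_src _ _
      · obtain rfl : i = m + 2 := by omega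
        simp [Preadditive.sub_comp, Preadditive.comp_sub, hlast]
  · refine ((((hf.comp hf).add (hf.comp hf)).add (hf.comp hf)).sub
      ((hf.comp (hf.comp hf)).add (hf.comp (hf.comp hf)))).of_eq ?_ ?_
    · rw [hr, hr]
      abel
    · rw [hq, hq]
      abel

end ExtData.IsRealisation

/-! ### The realisation on the idempotent completion -/

section KaroubiExtensions

variable {𝒞 : Type u} [Category.{v} 𝒞]

/-- The inclusion of `P = (X, e)` into `(X, 1)`. This is `Karoubi.decompId_i`, with its target written
as a value of `toKaroubi`. -/
def karoubiInc (P : Karoubi 𝒞) : P ⟶ (toKaroubi 𝒞).obj P.X := ⟨P.p, by simp⟩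

/-- The projection of `(X, 1)` onto `P = (X, e)`. This is `Karoubi.decompId_p`, with its source
written as a value of `toKaroubi`. -/
def karoubiProj (P : Karoubi 𝒞) : (toKaroubi 𝒞).obj P.X ⟶ P := ⟨P.p, by simp⟩

@[simp]
lemma karoubiInc_f (P : Karoubi 𝒞) : (karoubiInc P).f = P.p := rfl

@[simp]
lemma karoubiProj_f (P : Karoubi 𝒞) : (karoubiProj P).f = P.p := rfl

@[simp]
lemma karoubiInc_proj (P : Karoubi 𝒞) : karoubiInc P ≫ karoubiProj P = 𝟙 P := by
  ext
  simp

variable {E : Bifunctor.{w} 𝒞} {C D A B : Karoubi 𝒞}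

lemma underlying_injective {δ δ' : Ext (karoubiBifunctor E) C A}
    (h : underlying E δ = underlying E δ') : δ = δ' :=
  Subtype.ext h

lemma push_p_underlying (δ : Ext (karoubiBifunctor E) C A) :
    push E A.p (underlying E δ) = underlying E δ :=
  (show underlying E δ ∈ karoubiExt E C A from Subtype.property _).1

lemma pull_p_underlying (δ : Ext (karoubiBifunctor E) C A) :
    pull E C.p (underlying E δ) = underlying E δ :=
  (show underlying E δ ∈ karoubiExt E C A from Subtype.property _).2

lemma push_inc_eq (δ : Ext (karoubiBifunctor E) C A) :
    push (karoubiBifunctor E) (karoubiInc A) δ =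
      pull (karoubiBifunctor E) (karoubiInc C) (extMap (karoubiGamma E) (underlying E δ)) :=
  underlying_injective ((push_p_underlying δ).trans (pull_p_underlying δ).symm)

lemma push_proj_eq (δ : Ext (karoubiBifunctor E) C A) :
    push (karoubiBifunctor E) (karoubiProj A) (extMap (karoubiGamma E) (underlying E δ)) =
      pull (karoubiBifunctor E) (karoubiProj C) δ :=
  underlying_injective ((push_p_underlying δ).trans (pull_p_underlying δ).symm)

lemma karoubiBifunctor_isBiadditive [Preadditive 𝒞] (hE : IsBiadditive E) :
    IsBiadditive (karoubiBifunctor E) where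
  push_add a a' δ := underlying_injective (hE.push_add a.f a'.f (underlying E δ))
  pull_add c c' δ := underlying_injective (hE.pull_add c.f c'.f (underlying E δ))

end KaroubiExtensions

section KaroubiComplexes

variable {n : ℕ} {𝒞 : Type u} [Category.{v} 𝒞] [Preadditive 𝒞]

/-- The image of an `n`-exangle in the idempotent completion is an `n`-exangle. -/
lemma NComplex.IsNExangle.map_toKaroubi {E : Bifunctor.{w} 𝒞} {A C : 𝒞} {X : NComplex n A C}
    {δ : Ext E C A} (hX : X.IsNExangle E δ) :
    (X.map (toKaroubi 𝒞)).IsNExangle (karoubiBifunctor E) (extMap (karoubiGamma E) δ) where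
  push_eq_zero := underlying_injective hX.push_eq_zero
  pull_eq_zero := underlying_injective hX.pull_eq_zero
  exact_covariant i hi W g hg := by
    obtain ⟨h, hh⟩ := hX.exact_covariant i hi g.f (congrArg Karoubi.Hom.f hg)
    refine ⟨⟨W.p ≫ h, by
      change W.p ≫ (W.p ≫ h) ≫ 𝟙 _ = W.p ≫ h
      simp⟩, ?_⟩
    ext
    exact (Category.assoc _ _ _).trans ((congrArg (W.p ≫ ·) hh).trans (Karoubi.p_comp g))
  exact_covariant_last {W} g hg := by
    obtain ⟨h, hh⟩ := hX.exact_covariant_last g.f (congrArg (underlying E) hg)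
    refine ⟨⟨W.p ≫ h, by
      change W.p ≫ (W.p ≫ h) ≫ 𝟙 _ = W.p ≫ h
      simp⟩, ?_⟩
    ext
    exact (Category.assoc _ _ _).trans ((congrArg (W.p ≫ ·) hh).trans (Karoubi.p_comp g))
  exact_contravariant i hi W g hg := by
    obtain ⟨h, hh⟩ := hX.exact_contravariant i hi g.f (congrArg Karoubi.Hom.f hg)
    refine ⟨⟨h ≫ W.p, by
      change 𝟙 _ ≫ (h ≫ W.p) ≫ W.p = h ≫ W.p
      simp⟩, ?_⟩
    ext
    exact (Category.assoc _ _ _).symm.trans ((congrArg (· ≫ W.p) hh).trans (Karoubi.comp_p g))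
  exact_contravariant_last {W} g hg := by
    obtain ⟨h, hh⟩ := hX.exact_contravariant_last g.f (congrArg (underlying E) hg)
    refine ⟨⟨h ≫ W.p, by
      change 𝟙 _ ≫ (h ≫ W.p) ≫ W.p = h ≫ W.p
      simp⟩, ?_⟩
    ext
    exact (Category.assoc _ _ _).symm.trans ((congrArg (· ≫ W.p) hh).trans (Karoubi.comp_p g))

section Summand

variable {P Q : Karoubi 𝒞} (X : NComplex n P.X Q.X) (e : X.K ⟶ X.K) (he : e ≫ e = e)
    (hl : NComplex.Lifts (X := X) (Y := X) e P.p Q.p)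

/-- The inclusion of `(X, e)` into `(X, 1)`. -/
def karoubiComplexInc :
    (karoubiComplex X e he hl).K ⟶ (X.map (toKaroubi 𝒞)).K where
  f i := ⟨e.f i, by
    change e.f i ≫ e.f i ≫ 𝟙 _ = e.f i
    rw [Category.comp_id, ← HomologicalComplex.comp_f, he]⟩
  comm' i j _ := by
    ext
    change e.f i ≫ X.K.d i j = (e.f i ≫ X.K.d i j) ≫ e.f j
    rw [Category.assoc, ← e.comm, ← Category.assoc, ← HomologicalComplex.comp_f, he]

/-- The projection of `(X, 1)` onto `(X, e)`. -/
def karoubiComplexProj :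
    (X.map (toKaroubi 𝒞)).K ⟶ (karoubiComplex X e he hl).K where
  f i := ⟨e.f i, by
    change 𝟙 _ ≫ e.f i ≫ e.f i = e.f i
    rw [Category.id_comp, ← HomologicalComplex.comp_f, he]⟩
  comm' i j _ := by
    ext
    change e.f i ≫ e.f i ≫ X.K.d i j = X.K.d i j ≫ e.f j
    rw [← Category.assoc, ← HomologicalComplex.comp_f, he, e.comm]

lemma karoubiComplexInc_proj :
    karoubiComplexInc X e he hl ≫ karoubiComplexProj X e he hl = 𝟙 _ := by
  ext i
  exact HomologicalComplex.congr_hom he i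

lemma karoubiComplexInc_lifts :
    NComplex.Lifts (X := karoubiComplex X e he hl) (Y := X.map (toKaroubi 𝒞))
      (karoubiComplexInc X e he hl) (karoubiInc P) (karoubiInc Q) := by
  constructor
  · ext
    change e.f 0 ≫ X.left.hom = (e.f 0 ≫ X.left.hom) ≫ P.p
    rw [Category.assoc, ← hl.1, ← Category.assoc, ← HomologicalComplex.comp_f, he]
  · ext
    change e.f (n + 1) ≫ X.right.hom = (e.f (n + 1) ≫ X.right.hom) ≫ Q.p
    rw [Category.assoc, ← hl.2, ← Category.assoc, ← HomologicalComplex.comp_f, he]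

lemma karoubiComplexProj_lifts :
    NComplex.Lifts (X := X.map (toKaroubi 𝒞)) (Y := karoubiComplex X e he hl)
      (karoubiComplexProj X e he hl) (karoubiProj P) (karoubiProj Q) := by
  constructor
  · ext
    change e.f 0 ≫ e.f 0 ≫ X.left.hom = X.left.hom ≫ P.p
    rw [← Category.assoc, ← HomologicalComplex.comp_f, he, hl.1]
  · ext
    change e.f (n + 1) ≫ e.f (n + 1) ≫ X.right.hom = X.right.hom ≫ Q.p
    rw [← Category.assoc, ← HomologicalComplex.comp_f, he, hl.2]

end Summand

variable {S : ExtData.{w} n 𝒞} {P Q : Karoubi 𝒞}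

/-- Every realisation in the idempotent completion is a homotopy retract of a realisation in
`𝒞`. -/
lemma ExtData.exists_retract_of_mem_karoubi {δ : Ext S.karoubi.E Q P} {Z : NComplex n P Q}
    (hZ : Z ∈ S.karoubi.s δ) :
    ∃ X ∈ S.s (underlying S.E δ), ∃ (i : Z.K ⟶ (X.map (toKaroubi 𝒞)).K)
      (p : (X.map (toKaroubi 𝒞)).K ⟶ Z.K),
      NComplex.Lifts (X := Z) (Y := X.map (toKaroubi 𝒞)) i (karoubiInc P) (karoubiInc Q) ∧
      NComplex.Lifts (X := X.map (toKaroubi 𝒞)) (Y := Z) p (karoubiProj P) (karoubiProj Q) ∧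
      ∃ h, NullHtpy (𝟙 Z.K - i ≫ p) h := by
  obtain ⟨X, hX, e, he, hl, f, g, hf, hg, -, ⟨H⟩⟩ := hZ
  refine ⟨X, hX, g ≫ karoubiComplexInc X e he hl, karoubiComplexProj X e he hl ≫ f,
    (hg.comp (karoubiComplexInc_lifts X e he hl)).of_eq (Category.id_comp _) (Category.id_comp _),
    ((karoubiComplexProj_lifts X e he hl).comp hf).of_eq (Category.comp_id _)
      (Category.comp_id _), ?_⟩
  obtain ⟨h, hh⟩ := exists_nullHtpy_of_homotopy H.symm
  refine ⟨h, ?_⟩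
  rw [Category.assoc, ← Category.assoc (karoubiComplexInc X e he hl), karoubiComplexInc_proj,
    Category.id_comp]
  exact hh

/-- The per-degree form of a null-homotopy of `1 - i p`. -/
lemma exists_of_nullHtpy_id_sub {K L : CochainComplex 𝒞 ℕ} {i : K ⟶ L} {p : L ⟶ K}
    {h : ∀ j, K.X (j + 1) ⟶ K.X j} (H : NullHtpy (𝟙 K - i ≫ p) h) (j : ℕ) :
    ∃ (s : K.X (j + 1) ⟶ K.X j) (t : K.X (j + 2) ⟶ K.X (j + 1)),
      i.f (j + 1) ≫ p.f (j + 1) = 𝟙 _ + s ≫ K.d j (j + 1) + K.d (j + 1) (j + 2) ≫ t := by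
  refine ⟨-h j, -h (j + 1), ?_⟩
  have := H.succ j
  simp only [HomologicalComplex.sub_f_apply, HomologicalComplex.comp_f,
    HomologicalComplex.id_f] at this
  rw [Preadditive.neg_comp, Preadditive.comp_neg, add_assoc, ← neg_add, ← this]
  abel

lemma ExtData.IsRealisation.isNExangle_of_mem_karoubi (hS : S.IsRealisation)
    {δ : Ext S.karoubi.E Q P} {Z : NComplex n P Q} (hZ : Z ∈ S.karoubi.s δ) :
    Z.IsNExangle S.karoubi.E δ := by
  obtain ⟨X, hX, i, p, hi, hp, h, hh⟩ := ExtData.exists_retract_of_mem_karoubi hZ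
  exact (hS.isNExangle _ X hX).map_toKaroubi.of_retract hi hp (karoubiInc_proj P)
    (karoubiInc_proj Q) (push_inc_eq δ) (push_proj_eq δ)
    (fun j _ => exists_of_nullHtpy_id_sub hh j)

lemma NComplex.Lifts.map {A B C D : 𝒞} {X : NComplex n A C} {Y : NComplex n B D} {f : X.K ⟶ Y.K}
    {a : A ⟶ B} {c : C ⟶ D} (hf : NComplex.Lifts (X := X) (Y := Y) f a c) {𝒞' : Type u'}
    [Category.{v'} 𝒞'] [Preadditive 𝒞'] (F : 𝒞 ⥤ 𝒞') [F.Additive] :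
    NComplex.Lifts (X := X.map F) (Y := Y.map F) ((F.mapHomologicalComplex _).map f) (F.map a)
      (F.map c) :=
  ⟨(F.map_comp _ _).symm.trans ((congrArg F.map hf.1).trans (F.map_comp _ _)),
    (F.map_comp _ _).symm.trans ((congrArg F.map hf.2).trans (F.map_comp _ _))⟩

lemma ExtData.IsRealisation.exists_lift_karoubi (hS : S.IsRealisation) {A B C D : Karoubi 𝒞}
    (δ : Ext S.karoubi.E C A) (ρ : Ext S.karoubi.E D B) (a : A ⟶ B) (c : C ⟶ D)
    (h : push S.karoubi.E a δ = pull S.karoubi.E c ρ) (X : NComplex n A C)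
    (hX : X ∈ S.karoubi.s δ) (Y : NComplex n B D) (hY : Y ∈ S.karoubi.s ρ) :
    ∃ f : X.K ⟶ Y.K, NComplex.Lifts (X := X) (Y := Y) f a c := by
  obtain ⟨X', hX', i, -, hi, -, -⟩ := ExtData.exists_retract_of_mem_karoubi hX
  obtain ⟨Y', hY', -, p, -, hp, -⟩ := ExtData.exists_retract_of_mem_karoubi hY
  obtain ⟨f, hf⟩ := hS.exists_lift (underlying S.E δ) (underlying S.E ρ) a.f c.f
    (congrArg (underlying S.E) h) X' hX' Y' hY'
  refine ⟨i ≫ ((toKaroubi 𝒞).mapHomologicalComplex _).map f ≫ p,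
    (hi.comp ((hf.map (toKaroubi 𝒞)).comp hp)).of_eq ?_ ?_⟩
  · ext
    simp
  · ext
    simp

lemma IsDisk.map {A C : 𝒞} {X : NComplex n A C} {m : ℕ} (hX : IsDisk X.K m) {𝒞' : Type u'}
    [Category.{v'} 𝒞'] [Preadditive 𝒞'] (F : 𝒞 ⥤ 𝒞') [F.Additive] : IsDisk (X.map F).K m := by
  have := hX.isIso
  exact ⟨inferInstanceAs (IsIso (F.map (X.K.d m (m + 1)))),
    fun i h₀ h₁ => F.map_isZero (hX.isZero i h₀ h₁)⟩

/-- Among the trivial complexes `A = A ⟶ 0 ⟶ ⋯ ⟶ 0`, being a realisation of the zero extension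
passes to retracts of `A`. -/
lemma ExtData.IsRealisation.mem_zero_of_isDisk_first (hS : S.IsRealisation)
    (hE : IsBiadditive S.E) {A C A' C' : 𝒞} {X : NComplex n A C} {X' : NComplex n A' C'}
    (hX : X ∈ S.s 0) (hd : IsDisk X.K 0) (hd' : IsDisk X'.K 0) (hC : IsZero C) (hC' : IsZero C')
    {a : A' ⟶ A} {a' : A ⟶ A'} (ha : a ≫ a' = 𝟙 A') : X' ∈ S.s 0 := by
  obtain ⟨i, hi⟩ := hd'.exists_hom_from (K := X.K) (X'.left.hom ≫ a ≫ X.left.inv)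
  obtain ⟨p, hp⟩ := hd.exists_hom_from (K := X'.K) (X.left.hom ≫ a' ≫ X'.left.inv)
  refine hS.mem_of_retract hX (i := i) (p := p) (a := a) (c := 0) (a' := a') (c' := 0)
    ⟨by simp [hi], hC.eq_of_tgt _ _⟩ ⟨by simp [hp], hC'.eq_of_tgt _ _⟩ ha (hC'.eq_of_src _ _)
    (by rw [map_zero, hE.pull_zero]) (by rw [map_zero, hE.pull_zero]) fun j _ => ⟨0, 0, ?_⟩
  rw [zero_comp, comp_zero, add_zero, add_zero]
  rcases j with _ | j
  · have := hd'.isIso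
    have h2 : i.f 0 ≫ p.f 0 = 𝟙 _ := by
      rw [hi, hp]
      simp [reassoc_of% ha]
    have h1 : X'.K.d 0 1 ≫ i.f 1 ≫ p.f 1 = X'.K.d 0 1 := by
      rw [← Category.assoc, ← i.comm, Category.assoc, ← p.comm, ← Category.assoc, h2,
        Category.id_comp]
    exact (cancel_epi (X'.K.d 0 1)).mp (h1.trans (Category.comp_id _).symm)
  · exact (hd'.isZero _ (by omega) (by omega)).eq_of_src _ _

/-- Among the trivial complexes `0 ⟶ ⋯ ⟶ 0 ⟶ C = C`, being a realisation of the zero extension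
passes to retracts of `C`. -/
lemma ExtData.IsRealisation.mem_zero_of_isDisk_last (hS : S.IsRealisation)
    {A C A' C' : 𝒞} {X : NComplex n A C} {X' : NComplex n A' C'}
    (hX : X ∈ S.s 0) (hd : IsDisk X.K n) (hd' : IsDisk X'.K n) (hA : IsZero A) (hA' : IsZero A')
    {c : C' ⟶ C} {c' : C ⟶ C'} (hc : c ≫ c' = 𝟙 C') : X' ∈ S.s 0 := by
  obtain ⟨i, hi⟩ := hd.exists_hom_to (K := X'.K) (X'.right.hom ≫ c ≫ X.right.inv)
  obtain ⟨p, hp⟩ := hd'.exists_hom_to (K := X.K) (X.right.hom ≫ c' ≫ X'.right.inv)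
  refine hS.mem_of_retract hX (i := i) (p := p) (a := 0) (c := c) (a' := 0) (c' := c')
    ⟨hA.eq_of_tgt _ _, by simp [hi]⟩ ⟨hA'.eq_of_tgt _ _, by simp [hp]⟩ (hA'.eq_of_src _ _) hc
    (by rw [map_zero, map_zero]) (by rw [map_zero, map_zero]) fun j hj => ⟨0, 0, ?_⟩
  rw [zero_comp, comp_zero, add_zero, add_zero]
  by_cases hjn : j + 1 = n
  · subst hjn
    have := hd'.isIso
    have h2 : i.f (j + 1 + 1) ≫ p.f (j + 1 + 1) = 𝟙 _ := by
      rw [hi, hp]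
      simp [reassoc_of% hc]
    have h1 : (i.f (j + 1) ≫ p.f (j + 1)) ≫ X'.K.d (j + 1) (j + 1 + 1) =
        X'.K.d (j + 1) (j + 1 + 1) := by
      rw [Category.assoc, p.comm, ← Category.assoc, i.comm, Category.assoc, h2, Category.comp_id]
    exact (cancel_mono (X'.K.d (j + 1) (j + 1 + 1))).mp (h1.trans (Category.id_comp _).symm)
  · exact (hd'.isZero _ (by omega) (by omega)).eq_of_src _ _

variable [HasBinaryBiproducts 𝒞] [HasZeroObject 𝒞]

theorem ExtData.IsRealisation.karoubi (hn : 1 ≤ n) (hS : S.IsRealisation) :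
    S.karoubi.IsRealisation where
  isClass {P Q} δ := by
    obtain ⟨X, hX, e, he, hl⟩ := hS.exists_idempotent_lift hn P.idem Q.idem
      (push_p_underlying δ) (pull_p_underlying δ)
    have hmem : karoubiComplex X e he hl ∈ S.karoubi.s δ :=
      ⟨X, hX, e, he, hl, NComplex.HtpyEquiv.refl _⟩
    refine ⟨karoubiComplex X e he hl, Set.eq_of_subset_of_subset (fun Z hZ => ?_)
      fun Z hZ => ⟨X, hX, e, he, hl, hZ⟩⟩
    have h : push S.karoubi.E (𝟙 P) δ = pull S.karoubi.E (𝟙 Q) δ := by simp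
    obtain ⟨f, hf⟩ := hS.exists_lift_karoubi δ δ (𝟙 P) (𝟙 Q) h _ hmem _ hZ
    obtain ⟨g, hg⟩ := hS.exists_lift_karoubi δ δ (𝟙 P) (𝟙 Q) h _ hZ _ hmem
    exact (hS.isNExangle_of_mem_karoubi hmem).htpyEquiv (hS.isNExangle_of_mem_karoubi hZ) hf hg
  exists_lift := hS.exists_lift_karoubi
  isNExangle _ _ hZ := hS.isNExangle_of_mem_karoubi hZ

theorem isNExangulatedFunctor_toKaroubi (hn : 1 ≤ n) (hS : S.IsRealisation) :
    IsNExangulatedFunctor S S.karoubi (toKaroubi 𝒞) (karoubiGamma S.E) := by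
  intro A C δ X hX
  have he : 𝟙 X.K ≫ 𝟙 X.K = 𝟙 X.K := Category.id_comp _
  have hl : NComplex.Lifts (X := X) (Y := X) (𝟙 X.K) ((toKaroubi 𝒞).obj A).p
      ((toKaroubi 𝒞).obj C).p := NComplex.Lifts.id
  have hmem : karoubiComplex (P := (toKaroubi 𝒞).obj A) (Q := (toKaroubi 𝒞).obj C) X (𝟙 X.K) he hl
      ∈ S.karoubi.s (extMap (karoubiGamma S.E) δ) :=
    ⟨X, hX, 𝟙 X.K, he, hl, NComplex.HtpyEquiv.refl _⟩
  exact (hS.karoubi hn).mem_of_isNExangle hmem (hS.isNExangle δ X hX).map_toKaroubi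
    (karoubiComplexInc_lifts _ _ he hl) (karoubiComplexProj_lifts _ _ he hl)

theorem ExtData.IsExactRealisation.karoubi (hn : 1 ≤ n) (hE : IsBiadditive S.E)
    (hS : S.IsExactRealisation) : S.karoubi.IsExactRealisation := by
  have hK := hS.isRealisation.karoubi hn
  have hEK : IsBiadditive S.karoubi.E := karoubiBifunctor_isBiadditive hE
  obtain ⟨O, hO⟩ := HasZeroObject.zero (C := 𝒞)
  have hO' : IsZero ((toKaroubi 𝒞).obj O) := (toKaroubi 𝒞).map_isZero hO
  refine ⟨hK.isClass, hK.exists_lift, hK.isNExangle, fun {A Z} hZ X hX => ?_,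
    fun {Z C} hZ X hX => ?_⟩
  · obtain ⟨T, hT⟩ := exists_isTrivFirst hn A.X hO
    have hT' := isNExangulatedFunctor_toKaroubi hn hS.isRealisation 0 T (hS.triv_first hO T hT)
    rw [map_zero] at hT'
    exact hK.mem_zero_of_isDisk_first hEK hT' (hT.isDisk.map (toKaroubi 𝒞)) hX.isDisk hO' hZ
      (karoubiInc_proj A)
  · obtain ⟨T, hT⟩ := exists_isTrivLast hn C.X hO
    have hT' := isNExangulatedFunctor_toKaroubi hn hS.isRealisation 0 T (hS.triv_last hO T hT)
    rw [map_zero] at hT'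
    exact hK.mem_zero_of_isDisk_last hT' (hT.isDisk.map (toKaroubi 𝒞)) hX.isDisk hO' hZ
      (karoubiInc_proj C)

end KaroubiComplexes

/-! ### Inflations and deflations of an `n`-exangulated category -/

section InflationCalculus

attribute [local instance] hasBinaryBiproducts_of_finite_biproducts

namespace ExtData

variable {n : ℕ} {𝒞 : Type u} [Category.{v} 𝒞] [Preadditive 𝒞]
  {S : ExtData.{w} n 𝒞} {A B C E E' : 𝒞}

lemma IsInflation.comp_iso {g : A ⟶ B} (hg : S.IsInflation g) (e : B ≅ E) :
    S.IsInflation (g ≫ e.hom) := by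
  obtain ⟨C, δ, X, hX, φ, hφ⟩ := hg
  exact ⟨C, δ, X, hX, φ ≪≫ e, by rw [← hφ, Iso.trans_hom, Category.assoc]⟩

lemma IsDeflation.iso_comp {g : B ⟶ C} (hg : S.IsDeflation g) (e : E ≅ B) :
    S.IsDeflation (e.hom ≫ g) := by
  obtain ⟨C, δ, X, hX, φ, hφ⟩ := hg
  exact ⟨C, δ, X, hX, e ≪≫ φ, by rw [← hφ, Iso.trans_hom, Category.assoc]⟩

namespace IsNExangulated

variable [HasFiniteBiproducts 𝒞]

lemma isInflation_id (hS : S.IsNExangulated) (hn : 1 ≤ n) (A : 𝒞) : S.IsInflation (𝟙 A) := by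
  obtain ⟨O, hO⟩ := HasZeroObject.zero (C := 𝒞)
  obtain ⟨X, hX⟩ := exists_isTrivFirst hn A hO
  have := hX.isIso
  exact ⟨O, 0, X, hS.isExactRealisation.triv_first hO X hX, (asIso (X.K.d 0 1)).symm ≪≫ X.left,
    by simp [NComplex.dFirst]⟩

lemma isDeflation_id (hS : S.IsNExangulated) (hn : 1 ≤ n) (A : 𝒞) : S.IsDeflation (𝟙 A) := by
  obtain ⟨O, hO⟩ := HasZeroObject.zero (C := 𝒞)
  obtain ⟨X, hX⟩ := exists_isTrivLast hn A hO
  have := hX.isIso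
  exact ⟨O, 0, X, hS.isExactRealisation.triv_last hO X hX,
    X.right.symm ≪≫ (asIso (X.K.d n (n + 1))).symm, by simp [NComplex.dLast]⟩

/-- An inflation `g` remains one after adding an arbitrary component `a`, as the first morphism of a
mapping cocone over `a`. -/
lemma isInflation_lift (hS : S.IsNExangulated) (hn : 1 ≤ n) {g : A ⟶ E} (hg : S.IsInflation g)
    (a : A ⟶ B) : S.IsInflation (biprod.lift g a) := by
  obtain ⟨C, δ, X, hX, φ, hφ⟩ := hg
  obtain ⟨Y, hY⟩ := hS.isExactRealisation.isRealisation.exists_mem (push S.E a δ)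
  obtain ⟨f, hf, M, hM, ψ, h, -, -⟩ := hS.exists_cocone δ a Y hY X hX
  refine ⟨_, _, M, hM, ψ 0 1 rfl hn ≪≫ biprod.mapIso φ Y.left, ?_⟩
  rw [Iso.trans_hom, ← Category.assoc, h hn]
  ext
  · simp [hφ]
  · simp [hf.1]

/-- A deflation `g` remains one after adding an arbitrary component `c`, as the last morphism of a
mapping cone over `c`. -/
lemma isDeflation_desc (hS : S.IsNExangulated) (hn : 1 ≤ n) {g : E ⟶ C} (hg : S.IsDeflation g)
    (c : B ⟶ C) : S.IsDeflation (biprod.desc c g) := by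
  obtain ⟨A, δ, X, hX, φ, hφ⟩ := hg
  obtain ⟨Y, hY⟩ := hS.isExactRealisation.isRealisation.exists_mem (pull S.E c δ)
  obtain ⟨f, hf, M, hM, ψ, -, -, h⟩ := hS.exists_cone δ c Y hY X hX
  refine ⟨_, _, M, hM, biprod.mapIso Y.right.symm φ ≪≫ (ψ n hn le_rfl).symm, ?_⟩
  rw [Iso.trans_hom, Iso.symm_hom, Category.assoc, h hn]
  ext
  · simp [hf.2]
  · simp [hφ]

/-- A morphism through which an inflation factors is itself an inflation up to adding a zero
component. -/
lemma isInflation_lift_zero (hS : S.IsNExangulated) (hn : 1 ≤ n) {g : A ⟶ E}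
    (hg : S.IsInflation g) {g' : A ⟶ E'} (l : E' ⟶ E)
    (hl : g' ≫ l = g) : S.IsInflation (biprod.lift g' (0 : A ⟶ E)) := by
  let e : E ⊞ E' ≅ E' ⊞ E :=
    { hom := biprod.lift biprod.snd (biprod.fst - biprod.snd ≫ l)
      inv := biprod.lift (biprod.snd + biprod.fst ≫ l) biprod.fst
      hom_inv_id := by
        ext <;> simp [Preadditive.comp_add]
      inv_hom_id := by
        ext <;> simp [Preadditive.comp_sub] }
  convert (hS.isInflation_lift hn hg g').comp_iso e using 1
  ext
  · simp [e]
  · simp [e, Preadditive.comp_sub, hl]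

lemma isDeflation_desc_zero (hS : S.IsNExangulated) (hn : 1 ≤ n) {g : E ⟶ C}
    (hg : S.IsDeflation g) {g' : E' ⟶ C} (l : E ⟶ E')
    (hl : l ≫ g' = g) : S.IsDeflation (biprod.desc g' (0 : E ⟶ C)) := by
  let e : E' ⊞ E ≅ E' ⊞ E :=
    { hom := biprod.desc biprod.inl (biprod.inr - l ≫ biprod.inl)
      inv := biprod.desc biprod.inl (biprod.inr + l ≫ biprod.inl)
      hom_inv_id := by
        ext <;> simp [Preadditive.sub_comp]
      inv_hom_id := by
        ext <;> simp [Preadditive.add_comp] }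
  convert (hS.isDeflation_desc hn hg g').iso_comp e using 1
  ext
  · simp [e]
  · simp [e, Preadditive.sub_comp, hl]

/-- `1 ⊕ h` is an inflation if `h` is one, up to adding a zero component. -/
lemma exists_isInflation_map_id (hS : S.IsNExangulated) (hn : 1 ≤ n) {h : B ⟶ C}
    (hh : S.IsInflation h) (F : 𝒞) :
    ∃ W : 𝒞, S.IsInflation (biprod.lift (biprod.map (𝟙 F) h) (0 : F ⊞ B ⟶ W)) := by
  obtain ⟨D, θ, X, hX, φ, hφ⟩ := hh
  have hR := hS.isExactRealisation.isRealisation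
  obtain ⟨Y, hY⟩ := hR.exists_mem (push S.E (biprod.inr : B ⟶ F ⊞ B) θ)
  obtain ⟨f, hf⟩ := hR.exists_lift θ _ (biprod.inr : B ⟶ F ⊞ B) (𝟙 D) (by simp) X hX Y hY
  have e₁ := hf.dFirst
  refine ⟨Y.K.X 1, hS.isInflation_lift_zero hn (g := Y.dFirst)
    ⟨D, _, Y, hY, Iso.refl _, Category.comp_id _⟩
    (biprod.desc (biprod.inl ≫ Y.dFirst) (φ.inv ≫ f.f 1)) ?_⟩
  · ext
    · simp
    · simp [← hφ, e₁]

lemma exists_isDeflation_map_id (hS : S.IsNExangulated) (hn : 1 ≤ n) {h : E ⟶ B}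
    (hh : S.IsDeflation h) (F : 𝒞) :
    ∃ W : 𝒞, S.IsDeflation (biprod.desc (biprod.map (𝟙 F) h) (0 : W ⟶ F ⊞ B)) := by
  obtain ⟨A, θ, X, hX, φ, hφ⟩ := hh
  have hR := hS.isExactRealisation.isRealisation
  obtain ⟨Y, hY⟩ := hR.exists_mem (pull S.E (biprod.snd : F ⊞ B ⟶ B) θ)
  obtain ⟨f, hf⟩ := hR.exists_lift _ θ (𝟙 A) (biprod.snd : F ⊞ B ⟶ B) (by simp) Y hY X hX
  have e₁ := hf.dLast
  refine ⟨Y.K.X n, hS.isDeflation_desc_zero hn (g := Y.dLast)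
    ⟨A, _, Y, hY, Iso.refl _, Category.id_comp _⟩
    (biprod.lift (Y.dLast ≫ biprod.fst) (f.f n ≫ φ.inv)) ?_⟩
  · ext
    · simp
    · simp [← hφ, e₁]

end IsNExangulated

end ExtData

end InflationCalculus

/-! ### Inflations and deflations of the idempotent completion -/

/-- A modification of the identity of a complex in three consecutive degrees. -/
lemma exists_idempotent_of_three {𝒞 : Type u} [Category.{v} 𝒞] [Preadditive 𝒞]
    {K : CochainComplex 𝒞 ℕ} (m : ℕ) {x : K.X m ⟶ K.X m} {y : K.X (m + 1) ⟶ K.X (m + 1)}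
    {z : K.X (m + 2) ⟶ K.X (m + 2)} (hx : ∀ i, i + 1 = m → K.d i m ≫ x = K.d i m)
    (hxy : x ≫ K.d m (m + 1) = K.d m (m + 1) ≫ y)
    (hyz : y ≫ K.d (m + 1) (m + 2) = K.d (m + 1) (m + 2) ≫ z)
    (hz : z ≫ K.d (m + 2) (m + 3) = K.d (m + 2) (m + 3))
    (hxx : x ≫ x = x) (hyy : y ≫ y = y) (hzz : z ≫ z = z) :
    ∃ e : K ⟶ K, e ≫ e = e ∧ e.f m = x ∧ e.f (m + 1) = y ∧ e.f (m + 2) = z ∧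
      ∀ i, i ≠ m → i ≠ m + 1 → i ≠ m + 2 → e.f i = 𝟙 _ := by
  let F : ∀ i, K.X i ⟶ K.X i := Function.update (Function.update (Function.update
    (fun i => 𝟙 (K.X i)) m x) (m + 1) y) (m + 2) z
  have h2 : F (m + 2) = z := Function.update_self _ _ _
  have h1 : F (m + 1) = y := by
    simp only [F]
    rw [Function.update_of_ne (by omega), Function.update_self]
  have h0 : F m = x := by
    simp only [F]
    rw [Function.update_of_ne (by omega), Function.update_of_ne (by omega), Function.update_self]
  have h : ∀ i, i ≠ m → i ≠ m + 1 → i ≠ m + 2 → F i = 𝟙 _ := fun i h0 h1 h2 => by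
    simp only [F]
    rw [Function.update_of_ne h2, Function.update_of_ne h1, Function.update_of_ne h0]
  refine ⟨{ f := F, comm' := ?_ }, ?_, h0, h1, h2, h⟩
  · rintro i _ rfl
    by_cases e0 : i = m
    · subst e0
      rw [h0, h1, hxy]
    by_cases e1 : i = m + 1
    · subst e1
      rw [h1]
      exact hyz.trans (congrArg (_ ≫ ·) h2.symm)
    by_cases e2 : i = m + 2
    · subst e2
      rw [h2, h (m + 2 + 1) (by omega) (by omega) (by omega), Category.comp_id]
      exact hz
    rw [h i e0 e1 e2, Category.id_comp]
    by_cases e3 : i + 1 = m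
    · subst e3
      rw [h0, hx i rfl]
    · rw [h (i + 1) e3 (by omega) (by omega), Category.comp_id]
  · ext i
    change F i ≫ F i = F i
    by_cases e0 : i = m
    · subst e0
      rw [h0, hxx]
    by_cases e1 : i = m + 1
    · subst e1
      rw [h1, hyy]
    by_cases e2 : i = m + 2
    · subst e2
      rw [h2, hzz]
    rw [h i e0 e1 e2, Category.comp_id]

section KaroubiInflations

variable {n : ℕ} {𝒞 : Type u} [Category.{v} 𝒞] [Preadditive 𝒞] {P Q : Karoubi 𝒞} {E : 𝒞}

/-- The morphism `g : P ⟶ Q` of the idempotent completion is a direct summand of the morphism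
`G : P.X ⟶ E` of `𝒞`; the complementary summand of `P.X` is split off by a retraction `T`, and
`a`, `b` identify `Q` with a direct summand of `E`. -/
structure IsSourceSummand (g : P ⟶ Q) (G : P.X ⟶ E) (a : E ⟶ Q.X) (b : Q.X ⟶ E) (T : E ⟶ P.X) :
    Prop where
  a_p : a ≫ Q.p = a
  p_b : Q.p ≫ b = b
  b_a : b ≫ a = Q.p
  G_a : G ≫ a = g.f
  p_G : P.p ≫ G = g.f ≫ b
  G_T : G ≫ T = 𝟙 _ - P.p

/-- The morphism `g : P ⟶ Q` of the idempotent completion is a direct summand of the morphism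
`G : E ⟶ Q.X` of `𝒞`; the complementary summand of `Q.X` is split off by a section `T`, and
`a`, `b` identify `P` with a direct summand of `E`. -/
structure IsTargetSummand (g : P ⟶ Q) (G : E ⟶ Q.X) (a : P.X ⟶ E) (b : E ⟶ P.X) (T : Q.X ⟶ E) :
    Prop where
  p_a : P.p ≫ a = a
  b_p : b ≫ P.p = b
  a_b : a ≫ b = P.p
  a_G : a ≫ G = g.f
  G_p : G ≫ Q.p = b ≫ g.f
  T_G : T ≫ G = 𝟙 _ - Q.p

namespace ExtData

variable {S : ExtData.{w} n 𝒞}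

/-- If `g` is a summand of an inflation of `𝒞`, with complementary summand as in
`IsSourceSummand`, then it is an inflation. -/
lemma IsRealisation.isInflation_of_isSourceSummand (hS : S.IsRealisation)
    (hE : IsBiadditive S.E) (hn : 1 ≤ n) {g : P ⟶ Q} {G : P.X ⟶ E} {a : E ⟶ Q.X} {b : Q.X ⟶ E}
    {T : E ⟶ P.X} (hG : S.IsInflation G) (h : IsSourceSummand g G a b T) :
    S.karoubi.IsInflation g := by
  obtain ⟨C, θ, Z, hZ, ψ, hψ⟩ := hG
  have hex := hS.isNExangle θ Z hZ
  have hd : Z.K.d 0 1 = Z.left.hom ≫ G ≫ ψ.inv := by simp [← hψ, NComplex.dFirst]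
  have hGab : G ≫ a ≫ b = P.p ≫ G := by rw [reassoc_of% h.G_a, h.p_G]
  have habab : a ≫ b ≫ a ≫ b = a ≫ b := by rw [reassoc_of% h.b_a, h.p_b]
  -- The retraction `T`, corrected so that it vanishes on the summand `Q`.
  obtain ⟨T', hGT, haT⟩ : ∃ T' : E ⟶ P.X, G ≫ T' = 𝟙 _ - P.p ∧ a ≫ b ≫ T' = 0 := by
    refine ⟨(𝟙 _ - a ≫ b) ≫ T, ?_, ?_⟩
    · have e : G ≫ (𝟙 _ - a ≫ b) = (𝟙 _ - P.p) ≫ G := by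
        rw [Preadditive.comp_sub, Preadditive.sub_comp, hGab, Category.comp_id, Category.id_comp]
      rw [← Category.assoc, e, Category.assoc, h.G_T]
      simp [Preadditive.comp_sub, Preadditive.sub_comp]
    · have e : a ≫ b ≫ (𝟙 _ - a ≫ b) = 0 := by
        rw [Preadditive.comp_sub, Preadditive.comp_sub, Category.comp_id, habab, sub_self]
      rw [← Category.assoc, ← Category.assoc, Category.assoc a b, e, zero_comp]
  -- In degree `1`, the identity is the sum of `y`, which projects onto `Q`, of `s d`, which accounts
  -- for the complement of `P`, and of an idempotent `k` that factors through the differential. The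
  -- idempotent lift of `P.p` is `y` in degree `1`, and removes the copy of `k` in degree `2`.
  let s : Z.K.X 1 ⟶ Z.K.X 0 := ψ.hom ≫ T' ≫ Z.left.inv
  let y : Z.K.X 1 ⟶ Z.K.X 1 := ψ.hom ≫ a ≫ b ≫ ψ.inv
  let k : Z.K.X 1 ⟶ Z.K.X 1 := 𝟙 _ - s ≫ Z.K.d 0 1 - y
  have hyy : y ≫ y = y := by
    simp only [y, Category.assoc, Iso.inv_hom_id_assoc]
    rw [reassoc_of% habab]
  have hds : Z.K.d 0 1 ≫ s = Z.left.hom ≫ (𝟙 _ - P.p) ≫ Z.left.inv := by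
    simp only [s, hd, Category.assoc, Iso.inv_hom_id_assoc]
    rw [reassoc_of% hGT]
  have hdy : Z.K.d 0 1 ≫ y = Z.left.hom ≫ P.p ≫ Z.left.inv ≫ Z.K.d 0 1 := by
    simp only [y, hd, Category.assoc, Iso.inv_hom_id_assoc]
    rw [reassoc_of% hGab]
  have hys : y ≫ s = 0 := by
    simp only [y, s, Category.assoc, Iso.inv_hom_id_assoc]
    rw [reassoc_of% haT]
    simp
  have hdk : Z.K.d 0 1 ≫ k = 0 := by
    simp only [k, Preadditive.comp_sub, hdy]
    rw [reassoc_of% hds]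
    simp [Preadditive.comp_sub, Preadditive.sub_comp]
  have hkk : k ≫ k = k := by
    have : (s ≫ Z.K.d 0 1) ≫ k = 0 := by rw [Category.assoc, hdk, comp_zero]
    have h2 : y ≫ k = 0 := by
      simp only [k, Preadditive.comp_sub, hyy, reassoc_of% hys]
      simp
    nth_rw 1 [show k = 𝟙 _ - s ≫ Z.K.d 0 1 - y from rfl]
    rw [Preadditive.sub_comp, Preadditive.sub_comp, this, h2, Category.id_comp, sub_zero, sub_zero]
  obtain ⟨t₀, ht₀⟩ := hex.exact_contravariant 0 hn k hdk
  obtain ⟨t, ht, htk⟩ : ∃ t, Z.K.d 1 2 ≫ t = k ∧ t ≫ k = t :=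
    ⟨t₀ ≫ k, by rw [← Category.assoc, ht₀, hkk], by rw [Category.assoc, hkk]⟩
  have hkd : k ≫ Z.K.d 1 2 = Z.K.d 1 2 - y ≫ Z.K.d 1 2 := by
    simp [k, Preadditive.sub_comp]
  obtain ⟨e, he, he0, he1, he2, he3⟩ := exists_idempotent_of_three (K := Z.K) 0
    (x := Z.left.hom ≫ P.p ≫ Z.left.inv) (y := y) (z := 𝟙 _ - t ≫ Z.K.d 1 2) (by omega)
    (by rw [hdy]; simp)
    (by
      rw [Preadditive.comp_sub, Category.comp_id, ← Category.assoc, ht, hkd]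
      abel)
    (by
      rw [Preadditive.sub_comp, Category.assoc, Z.K.d_comp_d]
      simp)
    (by simp) hyy
    (by
      simp only [Preadditive.sub_comp, Preadditive.comp_sub, Category.assoc, Category.comp_id,
        Category.id_comp]
      rw [← Category.assoc (Z.K.d 1 2) t, ht, ← Category.assoc t k, htk]
      abel)
  let q : C ⟶ C := Z.right.inv ≫ e.f (n + 1) ≫ Z.right.hom
  have hq : q ≫ q = q := by
    simp only [q, Category.assoc, Iso.hom_inv_id_assoc]
    rw [← Category.assoc (e.f (n + 1)), ← HomologicalComplex.comp_f, he]
  have hl : NComplex.Lifts (X := Z) (Y := Z) e P.p q := ⟨by rw [he0]; simp, by simp [q]⟩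
  have hθ : θ ∈ karoubiExt S.E ⟨C, q, hq⟩ P := by
    constructor
    · have e0 : push S.E (𝟙 _ - P.p) θ = 0 := by
        rw [← h.G_T, ← hψ, push_comp, push_comp, hex.push_eq_zero, map_zero, map_zero]
      rw [hE.push_sub, push_id, sub_eq_zero] at e0
      exact e0.symm
    · change pull S.E q θ = θ
      by_cases hn1 : n = 1
      · subst hn1
        have : q = 𝟙 _ - (Z.right.inv ≫ t) ≫ Z.dLast := by
          have he2' : e.f 2 = 𝟙 _ - t ≫ Z.K.d 1 2 := he2
          simp [q, he2', NComplex.dLast, Preadditive.sub_comp, Preadditive.comp_sub]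
        rw [this, hE.pull_sub, pull_id, pull_comp, hex.pull_eq_zero, map_zero, sub_zero]
      · have : q = 𝟙 _ := by
          simp [q, he3 (n + 1) (by omega) (by omega) (by omega)]
        rw [this, pull_id]
  have he1' : e.f 1 = y := he1
  have hya : y ≫ (ψ.hom ≫ a) ≫ Q.p = ψ.hom ≫ a := by
    simp [y, h.a_p, h.b_a]
  have hby : Q.p ≫ (b ≫ ψ.inv) ≫ y = b ≫ ψ.inv := by
    simp [y, reassoc_of% h.p_b, reassoc_of% h.b_a]
  refine ⟨⟨C, q, hq⟩, (⟨θ, hθ⟩ : karoubiExt S.E ⟨C, q, hq⟩ P), karoubiComplex Z e he hl,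
    ⟨Z, hZ, e, he, hl, NComplex.HtpyEquiv.refl _⟩,
    { hom := ⟨ψ.hom ≫ a, ?_⟩, inv := ⟨b ≫ ψ.inv, ?_⟩, hom_inv_id := ?_, inv_hom_id := ?_ }, ?_⟩
  · change e.f 1 ≫ (ψ.hom ≫ a) ≫ Q.p = ψ.hom ≫ a
    rw [he1']
    exact hya
  · change Q.p ≫ (b ≫ ψ.inv) ≫ e.f 1 = b ≫ ψ.inv
    rw [he1']
    exact hby
  · ext
    change (ψ.hom ≫ a) ≫ b ≫ ψ.inv = e.f 1
    rw [he1']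
    exact Category.assoc _ _ _
  · ext
    change (b ≫ ψ.inv) ≫ ψ.hom ≫ a = Q.p
    simp [h.b_a]
  · ext
    change ((Z.left.inv ≫ e.f 0) ≫ e.f 0 ≫ Z.K.d 0 1) ≫ ψ.hom ≫ a = g.f
    rw [he0, hd]
    simp [h.G_a]

lemma IsRealisation.isDeflation_of_isTargetSummand (hS : S.IsRealisation)
    (hE : IsBiadditive S.E) (hn : 1 ≤ n) {g : P ⟶ Q} {G : E ⟶ Q.X} {a : P.X ⟶ E} {b : E ⟶ P.X}
    {T : Q.X ⟶ E} (hG : S.IsDeflation G) (h : IsTargetSummand g G a b T) :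
    S.karoubi.IsDeflation g := by
  obtain ⟨m, rfl⟩ : ∃ m, n = m + 1 := ⟨n - 1, by omega⟩
  obtain ⟨A, θ, Z, hZ, ψ, hψ⟩ := hG
  have hex := hS.isNExangle θ Z hZ
  have hd : Z.K.d (m + 1) (m + 2) = ψ.inv ≫ G ≫ Z.right.inv := by simp [← hψ, NComplex.dLast]
  have hbaG : b ≫ a ≫ G = G ≫ Q.p := by rw [h.a_G, h.G_p]
  have hbaba : b ≫ a ≫ b ≫ a = b ≫ a := by rw [reassoc_of% h.a_b, h.p_a]
  -- The section `T`, corrected so that it has its values in the complement of `P`.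
  obtain ⟨T', hTG, hTb⟩ : ∃ T' : Q.X ⟶ E, T' ≫ G = 𝟙 _ - Q.p ∧ T' ≫ b ≫ a = 0 := by
    refine ⟨T ≫ (𝟙 _ - b ≫ a), ?_, ?_⟩
    · have e : (𝟙 _ - b ≫ a) ≫ G = G ≫ (𝟙 _ - Q.p) := by
        rw [Preadditive.comp_sub, Preadditive.sub_comp, Category.assoc, hbaG, Category.comp_id,
          Category.id_comp]
      rw [Category.assoc, e, ← Category.assoc T, h.T_G]
      simp [Preadditive.comp_sub, Preadditive.sub_comp]
    · have e : (𝟙 _ - b ≫ a) ≫ b ≫ a = 0 := by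
        rw [Preadditive.sub_comp, Category.id_comp, Category.assoc, hbaba, sub_self]
      rw [Category.assoc, e, comp_zero]
  let s : Z.K.X (m + 2) ⟶ Z.K.X (m + 1) := Z.right.hom ≫ T' ≫ ψ.hom
  let y : Z.K.X (m + 1) ⟶ Z.K.X (m + 1) := ψ.inv ≫ b ≫ a ≫ ψ.hom
  let k : Z.K.X (m + 1) ⟶ Z.K.X (m + 1) := 𝟙 _ - Z.K.d (m + 1) (m + 2) ≫ s - y
  have hyy : y ≫ y = y := by
    simp only [y, Category.assoc, Iso.hom_inv_id_assoc]
    rw [reassoc_of% hbaba]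
  have hsd : s ≫ Z.K.d (m + 1) (m + 2) = Z.right.hom ≫ (𝟙 _ - Q.p) ≫ Z.right.inv := by
    simp only [s, hd, Category.assoc, Iso.hom_inv_id_assoc]
    rw [reassoc_of% hTG]
  have hyd : y ≫ Z.K.d (m + 1) (m + 2) =
      Z.K.d (m + 1) (m + 2) ≫ Z.right.hom ≫ Q.p ≫ Z.right.inv := by
    simp only [y, hd, Category.assoc, Iso.hom_inv_id_assoc, Iso.inv_hom_id_assoc]
    rw [reassoc_of% hbaG]
  have hsy : s ≫ y = 0 := by
    simp only [y, s, Category.assoc, Iso.hom_inv_id_assoc]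
    rw [reassoc_of% hTb]
    simp
  have hkd : k ≫ Z.K.d (m + 1) (m + 2) = 0 := by
    simp only [k, Preadditive.sub_comp, hyd, Category.assoc, hsd]
    simp [Preadditive.comp_sub]
  have hkk : k ≫ k = k := by
    have h1 : k ≫ Z.K.d (m + 1) (m + 2) ≫ s = 0 := by rw [← Category.assoc, hkd, zero_comp]
    have h2 : k ≫ y = 0 := by
      simp only [k, Preadditive.sub_comp, hyy, Category.assoc, hsy]
      simp
    nth_rw 2 [show k = 𝟙 _ - Z.K.d (m + 1) (m + 2) ≫ s - y from rfl]
    rw [Preadditive.comp_sub, Preadditive.comp_sub, h1, h2, Category.comp_id, sub_zero, sub_zero]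
  obtain ⟨t₀, ht₀⟩ := hex.exact_covariant m (by omega) k hkd
  obtain ⟨t, ht, hkt⟩ : ∃ t, t ≫ Z.K.d m (m + 1) = k ∧ k ≫ t = t :=
    ⟨k ≫ t₀, by rw [Category.assoc, ht₀, hkk], by rw [← Category.assoc, hkk]⟩
  have hdk : Z.K.d m (m + 1) ≫ k = Z.K.d m (m + 1) - Z.K.d m (m + 1) ≫ y := by
    simp [k, Preadditive.comp_sub]
  obtain ⟨e, he, he0, he1, he2, he3⟩ := exists_idempotent_of_three (K := Z.K) m
    (x := 𝟙 _ - Z.K.d m (m + 1) ≫ t) (y := y) (z := Z.right.hom ≫ Q.p ≫ Z.right.inv)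
    (by
      rintro i rfl
      rw [Preadditive.comp_sub, ← Category.assoc, Z.K.d_comp_d]
      simp)
    (by
      rw [Preadditive.sub_comp, Category.id_comp, Category.assoc, ht, hdk]
      abel)
    hyd ((Z.isZero (m + 3) (by omega)).eq_of_tgt _ _)
    (by
      simp only [Preadditive.sub_comp, Preadditive.comp_sub, Category.assoc, Category.comp_id,
        Category.id_comp]
      rw [← Category.assoc t (Z.K.d m (m + 1)), ht, hkt]
      abel)
    hyy (by simp)
  let q : A ⟶ A := Z.left.inv ≫ e.f 0 ≫ Z.left.hom
  have hq : q ≫ q = q := by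
    simp only [q, Category.assoc, Iso.hom_inv_id_assoc]
    rw [← Category.assoc (e.f 0), ← HomologicalComplex.comp_f, he]
  have he2' : e.f (m + 1 + 1) = Z.right.hom ≫ Q.p ≫ Z.right.inv := he2
  have hl : NComplex.Lifts (X := Z) (Y := Z) e q Q.p := ⟨by simp [q], by rw [he2']; simp⟩
  have hθ : θ ∈ karoubiExt S.E Q ⟨A, q, hq⟩ := by
    constructor
    · change push S.E q θ = θ
      by_cases hm : m = 0
      · subst hm
        have : q = 𝟙 _ - Z.dFirst ≫ t ≫ Z.left.hom := by
          simp [q, he0, NComplex.dFirst, Preadditive.sub_comp, Preadditive.comp_sub]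
        rw [this, hE.push_sub, push_id, push_comp, hex.push_eq_zero, map_zero, sub_zero]
      · have : q = 𝟙 _ := by
          simp [q, he3 0 (by omega) (by omega) (by omega)]
        rw [this, push_id]
    · have e0 : pull S.E (𝟙 _ - Q.p) θ = 0 := by
        rw [← h.T_G, ← hψ, pull_comp, pull_comp, hex.pull_eq_zero, map_zero, map_zero]
      rw [hE.pull_sub, pull_id, sub_eq_zero] at e0
      exact e0.symm
  have hay : P.p ≫ (a ≫ ψ.hom) ≫ y = a ≫ ψ.hom := by
    simp [y, reassoc_of% h.p_a, reassoc_of% h.a_b]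
  have hyb : y ≫ (ψ.inv ≫ b) ≫ P.p = ψ.inv ≫ b := by
    simp [y, h.b_p, h.a_b]
  refine ⟨⟨A, q, hq⟩, (⟨θ, hθ⟩ : karoubiExt S.E Q ⟨A, q, hq⟩), karoubiComplex Z e he hl,
    ⟨Z, hZ, e, he, hl, NComplex.HtpyEquiv.refl _⟩,
    { hom := ⟨a ≫ ψ.hom, ?_⟩, inv := ⟨ψ.inv ≫ b, ?_⟩, hom_inv_id := ?_, inv_hom_id := ?_ }, ?_⟩
  · change P.p ≫ (a ≫ ψ.hom) ≫ e.f (m + 1) = a ≫ ψ.hom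
    rw [he1]
    exact hay
  · change e.f (m + 1) ≫ (ψ.inv ≫ b) ≫ P.p = ψ.inv ≫ b
    rw [he1]
    exact hyb
  · ext
    change (a ≫ ψ.hom) ≫ ψ.inv ≫ b = P.p
    simp [h.a_b]
  · ext
    change (ψ.inv ≫ b) ≫ a ≫ ψ.hom = e.f (m + 1)
    rw [he1]
    exact Category.assoc _ _ _
  · ext
    change (a ≫ ψ.hom) ≫ (e.f (m + 1) ≫ Z.K.d (m + 1) (m + 2)) ≫ e.f (m + 2) ≫ Z.right.hom = g.f
    rw [he1, he2, hyd, hd]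
    simp [reassoc_of% h.a_G]

end ExtData

end KaroubiInflations

section KaroubiInflationsComp

attribute [local instance] hasBinaryBiproducts_of_finite_biproducts

variable {n : ℕ} {𝒞 : Type u} [Category.{v} 𝒞] [Preadditive 𝒞] [HasFiniteBiproducts 𝒞]
  {P Q R : Karoubi 𝒞} {S : ExtData.{w} n 𝒞}

namespace ExtData.IsNExangulated

/-- Every inflation of the idempotent completion is a summand of an inflation of `𝒞`. -/
lemma exists_isSourceSummand (hS : S.IsNExangulated) (hn : 1 ≤ n) {g : P ⟶ Q}
    (hg : S.karoubi.IsInflation g) :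
    ∃ (E : 𝒞) (G : P.X ⟶ E) (a : E ⟶ Q.X) (b : Q.X ⟶ E) (T : E ⟶ P.X),
      S.IsInflation G ∧ IsSourceSummand g G a b T := by
  obtain ⟨C, δ, Z, hZ, φ, hφ⟩ := hg
  obtain ⟨X, hX, i, p, hi, hp, -⟩ := exists_retract_of_mem_karoubi hZ
  have hex := hS.isExactRealisation.isNExangle _ X hX
  obtain ⟨T, hT⟩ := hex.exact_contravariant_last (𝟙 _ - P.p) (by
    rw [hS.isBiadditive.push_sub, push_id]
    exact sub_eq_zero.mpr (push_p_underlying δ).symm)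
  -- In terms of `Z`, the morphism `(d₀, 0) : P.X ⟶ X₁ ⊞ Q.X` differs by an automorphism of the
  -- target from the sum of `g` and of the differential of the complement of `Z` in `X`.
  let f₁ : Q.X ⟶ X.K.X 1 := (φ.inv ≫ i.f 1).f
  let g₁ : X.K.X 1 ⟶ Q.X := (p.f 1 ≫ φ.hom).f
  have hf₁ : Q.p ≫ f₁ = f₁ := Karoubi.p_comp (φ.inv ≫ i.f 1)
  have hg₁ : g₁ ≫ Q.p = g₁ := Karoubi.comp_p (p.f 1 ≫ φ.hom)
  have hgf : g.f ≫ f₁ = P.p ≫ X.dFirst := by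
    have : g ≫ φ.inv ≫ i.f 1 = karoubiInc P ≫ (X.map (toKaroubi 𝒞)).dFirst := by
      rw [← hφ, Category.assoc, Iso.hom_inv_id_assoc, hi.dFirst]
    exact congrArg Karoubi.Hom.f this
  have hdg : X.dFirst ≫ g₁ = g.f := by
    have : (X.map (toKaroubi 𝒞)).dFirst ≫ p.f 1 ≫ φ.hom = karoubiProj P ≫ g := by
      rw [← hφ, ← Category.assoc, hp.dFirst, Category.assoc]
    exact (congrArg Karoubi.Hom.f this).trans (Karoubi.p_comp g)
  refine ⟨X.K.X 1 ⊞ Q.X, biprod.lift X.dFirst 0, biprod.desc g₁ Q.p,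
    biprod.lift f₁ (Q.p - f₁ ≫ g₁), biprod.desc T 0,
    hS.isInflation_lift hn ⟨_, _, X, hX, Iso.refl _, Category.comp_id _⟩ 0,
    ⟨?_, ?_, ?_, ?_, ?_, ?_⟩⟩
  · ext <;> simp [hg₁]
  · ext <;> simp [hf₁, Preadditive.comp_sub, reassoc_of% hf₁]
  · simp [Preadditive.sub_comp, hg₁]
  · simp [hdg]
  · ext
    · simp [hgf]
    · simp [Preadditive.comp_sub, reassoc_of% hgf, hdg]
  · simp [hT]

/-- Every deflation of the idempotent completion is a summand of a deflation of `𝒞`. -/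
lemma exists_isTargetSummand (hS : S.IsNExangulated) (hn : 1 ≤ n) {g : P ⟶ Q}
    (hg : S.karoubi.IsDeflation g) :
    ∃ (E : 𝒞) (G : E ⟶ Q.X) (a : P.X ⟶ E) (b : E ⟶ P.X) (T : Q.X ⟶ E),
      S.IsDeflation G ∧ IsTargetSummand g G a b T := by
  obtain ⟨A, δ, Z, hZ, φ, hφ⟩ := hg
  obtain ⟨X, hX, i, p, hi, hp, -⟩ := exists_retract_of_mem_karoubi hZ
  have hex := hS.isExactRealisation.isNExangle _ X hX
  obtain ⟨T, hT⟩ := hex.exact_covariant_last (𝟙 _ - Q.p) (by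
    rw [hS.isBiadditive.pull_sub, pull_id]
    exact sub_eq_zero.mpr (pull_p_underlying δ).symm)
  let f₁ : P.X ⟶ X.K.X n := (φ.hom ≫ i.f n).f
  let g₁ : X.K.X n ⟶ P.X := (p.f n ≫ φ.inv).f
  have hf₁ : P.p ≫ f₁ = f₁ := Karoubi.p_comp (φ.hom ≫ i.f n)
  have hg₁ : g₁ ≫ P.p = g₁ := Karoubi.comp_p (p.f n ≫ φ.inv)
  have hgf : g₁ ≫ g.f = X.dLast ≫ Q.p := by
    have : (p.f n ≫ φ.inv) ≫ g = (X.map (toKaroubi 𝒞)).dLast ≫ karoubiProj Q := by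
      rw [← hφ, Category.assoc, Iso.inv_hom_id_assoc, hp.dLast]
    exact congrArg Karoubi.Hom.f this
  have hfd : f₁ ≫ X.dLast = g.f := by
    have : (φ.hom ≫ i.f n) ≫ (X.map (toKaroubi 𝒞)).dLast = g ≫ karoubiInc Q := by
      rw [← hφ, Category.assoc, hi.dLast, Category.assoc]
    exact (congrArg Karoubi.Hom.f this).trans (Karoubi.comp_p g)
  refine ⟨X.K.X n ⊞ P.X, biprod.desc X.dLast 0, biprod.lift f₁ P.p,
    biprod.desc g₁ (P.p - f₁ ≫ g₁), biprod.lift T 0,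
    ?_, ⟨?_, ?_, ?_, ?_, ?_, ?_⟩⟩
  · have h0 : S.IsDeflation (biprod.desc (0 : P.X ⟶ Q.X) X.dLast) :=
      hS.isDeflation_desc hn ⟨_, _, X, hX, Iso.refl _, Category.id_comp _⟩ 0
    convert h0.iso_comp (biprod.braiding _ _) using 1
    ext <;> simp
  · ext <;> simp [hf₁]
  · ext <;> simp [hg₁, Preadditive.sub_comp]
  · simp [Preadditive.comp_sub, reassoc_of% hf₁]
  · simp [hfd]
  · ext
    · simp [hgf]
    · simp [Preadditive.sub_comp, hgf, reassoc_of% hfd]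
  · simp [hT]

theorem karoubi_inflation_comp (hS : S.IsNExangulated) (hn : 1 ≤ n) {g : P ⟶ Q} {h : Q ⟶ R}
    (hg : S.karoubi.IsInflation g) (hh : S.karoubi.IsInflation h) :
    S.karoubi.IsInflation (g ≫ h) := by
  obtain ⟨E, G, a, b, T, hG, hgG⟩ := hS.exists_isSourceSummand hn hg
  obtain ⟨D, H, a', b', T', hH, hhH⟩ := hS.exists_isSourceSummand hn hh
  obtain ⟨W, hW⟩ := hS.exists_isInflation_map_id hn hH E
  -- The summands `Q` of `E` and of `Q.X` are identified by exchanging them in `E ⊞ Q.X`.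
  have hJ : S.IsInflation (biprod.lift (𝟙 E - a ≫ b) a) := by
    let ω : E ⊞ Q.X ≅ E ⊞ Q.X :=
      { hom := biprod.lift (biprod.fst - biprod.snd ≫ b) biprod.snd
        inv := biprod.lift (biprod.fst + biprod.snd ≫ b) biprod.snd
        hom_inv_id := by ext <;> simp [Preadditive.comp_add]
        inv_hom_id := by ext <;> simp [Preadditive.comp_sub] }
    convert (hS.isInflation_lift hn (hS.isInflation_id hn E) a).comp_iso ω using 1
    ext <;> simp [ω, Preadditive.comp_sub]
  refine hS.isExactRealisation.isRealisation.isInflation_of_isSourceSummand hS.isBiadditive hn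
    (hS.inflation_comp _ _ (hS.inflation_comp _ _ hG hJ) hW)
    (a := biprod.fst ≫ biprod.snd ≫ a') (b := b' ≫ biprod.inr ≫ biprod.inl)
    (T := biprod.fst ≫ biprod.fst ≫ T) ⟨?_, ?_, ?_, ?_, ?_, ?_⟩
  · simp [hhH.a_p]
  · simp [reassoc_of% hhH.p_b]
  · simp [hhH.b_a]
  · have : biprod.lift (𝟙 E - a ≫ b) a ≫ biprod.map (𝟙 E) H ≫ biprod.snd ≫ a' = a ≫ h.f := by
      simp [hhH.G_a]
    simp only [Category.assoc, biprod.lift_fst_assoc, this, reassoc_of% hgG.G_a, Karoubi.comp_f]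
  · have e1 : P.p ≫ G ≫ (𝟙 E - a ≫ b) = 0 := by
      rw [Preadditive.comp_sub, reassoc_of% hgG.G_a, Preadditive.comp_sub, Category.comp_id,
        hgG.p_G, ← Category.assoc P.p, Karoubi.p_comp, sub_self]
    have e2 : g.f ≫ H = (g.f ≫ h.f) ≫ b' := by
      rw [Category.assoc, ← hhH.p_G, ← Category.assoc, Karoubi.comp_p]
    ext
    · simpa [Preadditive.comp_sub] using e1
    · simp [reassoc_of% hgG.G_a, e2]
    · simp
  · have e1 : G ≫ (𝟙 E - a ≫ b) ≫ T = 𝟙 _ - P.p := by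
      rw [← Category.assoc, Preadditive.comp_sub, reassoc_of% hgG.G_a, ← hgG.p_G,
        Preadditive.sub_comp, Category.comp_id, Category.assoc, hgG.G_T, Preadditive.comp_sub]
      simp
    simp only [Category.assoc, biprod.lift_fst_assoc, biprod.map_fst_assoc, Category.id_comp, e1]

theorem karoubi_deflation_comp (hS : S.IsNExangulated) (hn : 1 ≤ n) {g : P ⟶ Q} {h : Q ⟶ R}
    (hg : S.karoubi.IsDeflation g) (hh : S.karoubi.IsDeflation h) :
    S.karoubi.IsDeflation (g ≫ h) := by
  obtain ⟨E, G, a, b, T, hG, hgG⟩ := hS.exists_isTargetSummand hn hg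
  obtain ⟨D, H, a', b', T', hH, hhH⟩ := hS.exists_isTargetSummand hn hh
  obtain ⟨W, hW⟩ := hS.exists_isDeflation_map_id hn hG D
  have hJ : S.IsDeflation (biprod.desc (𝟙 D - b' ≫ a') a') := by
    let ω : D ⊞ Q.X ≅ Q.X ⊞ D :=
      { hom := biprod.desc (biprod.inr - b' ≫ biprod.inl) biprod.inl
        inv := biprod.desc biprod.inr (biprod.inl + b' ≫ biprod.inr)
        hom_inv_id := by ext <;> simp [Preadditive.sub_comp]
        inv_hom_id := by ext <;> simp [Preadditive.add_comp] }
    convert (hS.isDeflation_desc hn (hS.isDeflation_id hn D) a').iso_comp ω using 1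
    ext <;> simp [ω, Preadditive.sub_comp]
  refine hS.isExactRealisation.isRealisation.isDeflation_of_isTargetSummand hS.isBiadditive hn
    (hS.deflation_comp _ _ hW (hS.deflation_comp _ _ hJ hH))
    (a := a ≫ biprod.inr ≫ biprod.inl) (b := biprod.fst ≫ biprod.snd ≫ b)
    (T := T' ≫ biprod.inl ≫ biprod.inl) ⟨?_, ?_, ?_, ?_, ?_, ?_⟩
  · simp [reassoc_of% hgG.p_a]
  · simp [hgG.b_p]
  · simp [hgG.a_b]
  · simp [reassoc_of% hgG.a_G, hhH.a_G]
  · have e1 : (𝟙 D - b' ≫ a') ≫ H ≫ R.p = 0 := by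
      rw [hhH.G_p, Preadditive.sub_comp, Category.id_comp, Category.assoc, reassoc_of% hhH.a_b,
        Karoubi.p_comp, sub_self]
    have e2 : G ≫ h.f = b ≫ g.f ≫ h.f := by
      rw [← Category.assoc, ← hgG.G_p, Category.assoc, Karoubi.p_comp]
    ext
    · simpa [Preadditive.sub_comp] using e1
    · simp [reassoc_of% hhH.a_G, e2]
    · simp
  · have e1 : T' ≫ (𝟙 D - b' ≫ a') ≫ H = 𝟙 _ - R.p := by
      rw [Preadditive.sub_comp, Category.id_comp, Category.assoc, hhH.a_G, ← hhH.G_p,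
        Preadditive.comp_sub, ← Category.assoc, hhH.T_G, Preadditive.sub_comp]
      simp
    simpa [Preadditive.sub_comp, Preadditive.comp_sub] using e1

end ExtData.IsNExangulated

end KaroubiInflationsComp

/-! ### Mapping cones -/

section Cones

variable {n : ℕ} {𝒞 : Type u} [Category.{v} 𝒞] [Preadditive 𝒞]

/-- A lift of a pair of morphisms of the ends that is null-homotopic through a homotopy
concentrated in the lowest degree. -/
lemma NComplex.exists_lifts_dFirst_comp (hn : 1 ≤ n) {A B C D : 𝒞} (X : NComplex n A C)
    (Y : NComplex n B D) (k : X.K.X 1 ⟶ B) :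
    ∃ θ : X.K ⟶ Y.K, NComplex.Lifts (X := X) (Y := Y) θ (X.dFirst ≫ k) 0 := by
  obtain ⟨m, rfl⟩ : ∃ m, n = m + 1 := ⟨n - 1, by omega⟩
  let k' : X.K.X 1 ⟶ Y.K.X 0 := k ≫ Y.left.inv
  refine ⟨{ f := fun
              | 0 => X.K.d 0 1 ≫ k'
              | 1 => k' ≫ Y.K.d 0 1
              | _ + 2 => 0
            comm' := ?_ }, ?_, ?_⟩
  · rintro (_ | _ | i) _ rfl
    · simp
    · simp
    · simp
  · simp [NComplex.dFirst, k']
  · simp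

namespace NComplex

/-- A presentation of `M` as the mapping cone of `f : X ⟶ Y`, in terms of the projections and the
inclusions of the two summands in `Mᵢ = Xᵢ₊₁ ⊞ Yᵢ`.  In degree `0` the second summand is absent.
The relations hold in all degrees, so that the two ends need no special treatment. -/
structure ConeData {A B C D : 𝒞} (X : NComplex n A C) (Y : NComplex n B D) (f : X.K ⟶ Y.K)
    (M : NComplex n (X.K.X 1) D) where
  /-- projection to the first summand -/
  p₁ : ∀ i, M.K.X i ⟶ X.K.X (i + 1)
  /-- projection to the second summand -/
  p₂ : ∀ i, M.K.X i ⟶ Y.K.X i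
  /-- inclusion of the first summand -/
  i₁ : ∀ i, X.K.X (i + 1) ⟶ M.K.X i
  /-- inclusion of the second summand -/
  i₂ : ∀ i, Y.K.X i ⟶ M.K.X i
  p₂_zero : p₂ 0 = 0
  total : ∀ i, p₁ i ≫ i₁ i + p₂ i ≫ i₂ i = 𝟙 _
  i₁_p₁ : ∀ i, i₁ i ≫ p₁ i = 𝟙 _
  i₁_p₂ : ∀ i, i₁ i ≫ p₂ i = 0
  i₂_p₁ : ∀ i, i₂ i ≫ p₁ i = 0
  i₂_p₂ : ∀ i, i₂ (i + 1) ≫ p₂ (i + 1) = 𝟙 _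
  d_p₁ : ∀ i, M.K.d i (i + 1) ≫ p₁ (i + 1) = -(p₁ i ≫ X.K.d (i + 1) (i + 2))
  d_p₂ : ∀ i, M.K.d i (i + 1) ≫ p₂ (i + 1) = p₁ i ≫ f.f (i + 1) + p₂ i ≫ Y.K.d i (i + 1)
  left_hom : M.left.hom = p₁ 0
  right_hom : M.right.hom = p₂ (n + 1) ≫ Y.right.hom

namespace ConeData

variable {A B C D : 𝒞} {X : NComplex n A C} {Y : NComplex n B D} {f : X.K ⟶ Y.K}
  {M : NComplex n (X.K.X 1) D}

lemma ext_to (c : ConeData X Y f M) {i : ℕ} {W : 𝒞} {g h : W ⟶ M.K.X i}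
    (h₁ : g ≫ c.p₁ i = h ≫ c.p₁ i) (h₂ : g ≫ c.p₂ i = h ≫ c.p₂ i) : g = h := by
  rw [← Category.comp_id g, ← Category.comp_id h, ← c.total, Preadditive.comp_add,
    Preadditive.comp_add, reassoc_of% h₁, reassoc_of% h₂]

lemma comp_d_p₁ (c : ConeData X Y f M) {i : ℕ} {W : 𝒞} (g : W ⟶ M.K.X i) :
    g ≫ M.K.d i (i + 1) ≫ c.p₁ (i + 1) = -((g ≫ c.p₁ i) ≫ X.K.d (i + 1) (i + 2)) := by
  rw [c.d_p₁, Preadditive.comp_neg, Category.assoc]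

lemma comp_d_p₂ (c : ConeData X Y f M) {i : ℕ} {W : 𝒞} (g : W ⟶ M.K.X i) :
    g ≫ M.K.d i (i + 1) ≫ c.p₂ (i + 1) =
      (g ≫ c.p₁ i) ≫ f.f (i + 1) + (g ≫ c.p₂ i) ≫ Y.K.d i (i + 1) := by
  rw [c.d_p₂, Preadditive.comp_add, Category.assoc, Category.assoc]

lemma d_comp (c : ConeData X Y f M) {i : ℕ} {W : 𝒞} (g : M.K.X (i + 1) ⟶ W) :
    M.K.d i (i + 1) ≫ g = c.p₁ i ≫ (f.f (i + 1) ≫ c.i₂ (i + 1) ≫ g -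
      X.K.d (i + 1) (i + 2) ≫ c.i₁ (i + 1) ≫ g) +
      c.p₂ i ≫ Y.K.d i (i + 1) ≫ c.i₂ (i + 1) ≫ g := by
  have h : M.K.d i (i + 1) = (M.K.d i (i + 1) ≫ c.p₁ (i + 1)) ≫ c.i₁ (i + 1) +
      (M.K.d i (i + 1) ≫ c.p₂ (i + 1)) ≫ c.i₂ (i + 1) := by
    rw [Category.assoc, Category.assoc, ← Preadditive.comp_add, c.total, Category.comp_id]
  conv_lhs => rw [h, c.d_p₁, c.d_p₂]
  simp only [Preadditive.add_comp, Preadditive.neg_comp, Preadditive.comp_sub, Category.assoc]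
  abel

/-- A homotopy commutative square induces a morphism of the mapping cones. -/
lemma exists_hom (c : ConeData X Y f M) {A' B' C' D' : 𝒞} {X' : NComplex n A' C'}
    {Y' : NComplex n B' D'} {f' : X'.K ⟶ Y'.K} {M' : NComplex n (X'.K.X 1) D'}
    (c' : ConeData X' Y' f' M') (α : X.K ⟶ X'.K) (β : Y.K ⟶ Y'.K)
    (H : NullLeft (f ≫ β - α ≫ f')) {b : D ⟶ D'}
    (hβ : β.f (n + 1) ≫ Y'.right.hom = Y.right.hom ≫ b) :
    ∃ Φ : M.K ⟶ M'.K, Lifts (X := M) (Y := M') Φ (α.f 1) b := by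
  obtain ⟨s, hs, hs0⟩ := H
  let Φ : ∀ i, M.K.X i ⟶ M'.K.X i := fun i =>
    c.p₁ i ≫ α.f (i + 1) ≫ c'.i₁ i + (c.p₂ i ≫ β.f i + c.p₁ i ≫ s i) ≫ c'.i₂ i
  have h₁ : ∀ i, Φ i ≫ c'.p₁ i = c.p₁ i ≫ α.f (i + 1) := fun i => by
    simp [Φ, c'.i₁_p₁, c'.i₂_p₁]
  have h₂ : ∀ i, Φ i ≫ c'.p₂ i = c.p₂ i ≫ β.f i + c.p₁ i ≫ s i := fun i => by
    rcases i with _ | i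
    · simp [c'.p₂_zero, c.p₂_zero, hs0]
    · simp [Φ, c'.i₁_p₂, c'.i₂_p₂]
  refine ⟨{ f := Φ, comm' := ?_ }, ?_, ?_⟩
  · rintro i _ rfl
    refine c'.ext_to ?_ ?_
    · rw [Category.assoc, c'.comp_d_p₁, h₁, Category.assoc (M.K.d i (i + 1)), h₁,
        ← Category.assoc (M.K.d i (i + 1)), c.d_p₁]
      simp
    · have e := hs.succ i
      simp only [HomologicalComplex.sub_f_apply, HomologicalComplex.comp_f] at e
      rw [sub_eq_iff_eq_add] at e
      rw [Category.assoc, c'.comp_d_p₂, h₁, h₂, Category.assoc (M.K.d i (i + 1)), h₂,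
        Preadditive.comp_add, ← Category.assoc (M.K.d i (i + 1)),
        ← Category.assoc (M.K.d i (i + 1)), c.d_p₁, c.d_p₂]
      simp only [Preadditive.add_comp, Preadditive.neg_comp, Category.assoc]
      rw [e]
      simp only [Preadditive.comp_add, β.comm]
      abel
  · rw [c.left_hom, c'.left_hom]
    exact h₁ 0
  · have e : c.p₁ (n + 1) = 0 := (X.isZero (n + 2) (by omega)).eq_of_tgt _ _
    have := h₂ (n + 1)
    rw [e, zero_comp, add_zero] at this
    rw [c'.right_hom, ← Category.assoc, this, c.right_hom, Category.assoc, hβ, Category.assoc]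

/-- The image of a mapping cone under an additive functor. -/
def map (c : ConeData X Y f M) {𝒞' : Type u'} [Category.{v'} 𝒞'] [Preadditive 𝒞'] (F : 𝒞 ⥤ 𝒞')
    [F.Additive] : ConeData (X.map F) (Y.map F) ((F.mapHomologicalComplex _).map f) (M.map F) where
  p₁ i := F.map (c.p₁ i)
  p₂ i := F.map (c.p₂ i)
  i₁ i := F.map (c.i₁ i)
  i₂ i := F.map (c.i₂ i)
  p₂_zero := (congrArg F.map c.p₂_zero).trans (F.map_zero _ _)
  total i := by
    have := congrArg F.map (c.total i)
    rw [F.map_add, F.map_comp, F.map_comp, F.map_id] at this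
    exact this
  i₁_p₁ i := by
    have := congrArg F.map (c.i₁_p₁ i)
    rw [F.map_comp, F.map_id] at this
    exact this
  i₁_p₂ i := by
    have := congrArg F.map (c.i₁_p₂ i)
    rw [F.map_comp, F.map_zero] at this
    exact this
  i₂_p₁ i := by
    have := congrArg F.map (c.i₂_p₁ i)
    rw [F.map_comp, F.map_zero] at this
    exact this
  i₂_p₂ i := by
    have := congrArg F.map (c.i₂_p₂ i)
    rw [F.map_comp, F.map_id] at this
    exact this
  d_p₁ i := by
    have := congrArg F.map (c.d_p₁ i)
    rw [F.map_neg, F.map_comp, F.map_comp] at this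
    exact this
  d_p₂ i := by
    have := congrArg F.map (c.d_p₂ i)
    rw [F.map_add, F.map_comp, F.map_comp, F.map_comp] at this
    exact this
  left_hom := congrArg F.map c.left_hom
  right_hom := (congrArg F.map c.right_hom).trans (F.map_comp _ _)

/-- The last terms of an exact mapping cone. -/
lemma exists_of_isNExangle (c : ConeData X Y f M) (hn : 1 ≤ n) {E : Bifunctor.{w} 𝒞}
    {ρ : Ext E D (X.K.X 1)} (hM : M.IsNExangle E ρ) {a : A ⟶ B} {b : C ⟶ D}
    (hf : Lifts (X := X) (Y := Y) f a b) {W : 𝒞} (z : C ⟶ W) (hz : X.dLast ≫ z = 0) :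
    ∃ h : D ⟶ W, Y.dLast ≫ h = 0 ∧ b ≫ h = z := by
  obtain ⟨m, rfl⟩ : ∃ m, n = m + 1 := ⟨n - 1, by omega⟩
  obtain ⟨h, hh⟩ := hM.exact_contravariant m (by omega) (c.p₁ (m + 1) ≫ X.right.hom ≫ z) (by
    have : X.K.d (m + 1) (m + 2) ≫ X.right.hom ≫ z = 0 := (Category.assoc _ _ _).symm.trans hz
    rw [← Category.assoc, c.d_p₁, Preadditive.neg_comp, Category.assoc, this, comp_zero, neg_zero])
  have e₃ : X.K.d (m + 1 + 1) (m + 1 + 2) = 0 := (X.isZero (m + 3) (by omega)).eq_of_tgt _ _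
  replace hh := (c.d_comp h).symm.trans hh
  simp only [e₃, zero_comp, sub_zero] at hh
  have e₁ := congrArg (c.i₁ (m + 1) ≫ ·) hh
  have e₂ := congrArg (c.i₂ (m + 1) ≫ ·) hh
  simp only [Preadditive.comp_add, reassoc_of% c.i₁_p₁, reassoc_of% c.i₁_p₂, zero_comp,
    add_zero] at e₁
  simp only [Preadditive.comp_add, reassoc_of% c.i₂_p₁, reassoc_of% c.i₂_p₂, zero_comp,
    zero_add] at e₂
  refine ⟨Y.right.inv ≫ c.i₂ (m + 2) ≫ h, ?_, ?_⟩
  · simpa [dLast] using e₂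
  · rw [← cancel_epi X.right.hom, ← e₁, ← Category.assoc, ← hf.2, Category.assoc,
      Iso.hom_inv_id_assoc]

/-- A mapping cone of a morphism of `n`-exangles is an `n`-exangle, if it is comparable with one and
if its last term `C ⊞ Yₙ ⟶ D` has the property of a weak pushout (`hc`). -/
lemma isNExangle {A C D : 𝒞} {X : NComplex n A C} {Y : NComplex n A D} {f : X.K ⟶ Y.K}
    {M : NComplex n (X.K.X 1) D} (c : ConeData X Y f M) {E : Bifunctor.{w} 𝒞} {δ : Ext E D A}
    {b : C ⟶ D} (hX : X.IsNExangle E (pull E b δ)) (hY : Y.IsNExangle E δ)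
    (hf : Lifts (X := X) (Y := Y) f (𝟙 A) b) {ρ : Ext E D (X.K.X 1)}
    {N : NComplex n (X.K.X 1) D} (hN : N.IsNExangle E ρ) {u : N.K ⟶ M.K} {v : M.K ⟶ N.K}
    (hu : Lifts (X := N) (Y := M) u (𝟙 _) (𝟙 D)) (hv : Lifts (X := M) (Y := N) v (𝟙 _) (𝟙 D))
    (hc : ∀ {W : 𝒞} (z : C ⟶ W), X.dLast ≫ z = 0 →
      ∃ h : D ⟶ W, Y.dLast ≫ h = 0 ∧ b ≫ h = z) : M.IsNExangle E ρ := by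
  obtain ⟨r, hrf⟩ : ∃ r, r ≫ f.f 0 = 𝟙 _ := by
    refine ⟨Y.left.hom ≫ X.left.inv, ?_⟩
    rw [← cancel_mono Y.left.hom, Category.assoc, hf.1]
    simp
  refine ⟨?_, ?_, fun i hi W g hg => ?_, fun g hg => ?_, fun i hi W g hg => ?_, fun g hg => ?_⟩
  · have := hu.dFirst
    rw [Category.id_comp] at this
    rw [← this, push_comp, hN.push_eq_zero, map_zero]
  · have := hv.dLast
    rw [Category.comp_id] at this
    rw [← this, pull_comp, hN.pull_eq_zero, map_zero]
  · have hx : (g ≫ c.p₁ (i + 1)) ≫ X.K.d (i + 2) (i + 3) = 0 := by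
      have := c.comp_d_p₁ g
      rw [← Category.assoc, hg, zero_comp] at this
      exact neg_eq_zero.mp this.symm
    have hy : (g ≫ c.p₁ (i + 1)) ≫ f.f (i + 2) + (g ≫ c.p₂ (i + 1)) ≫ Y.K.d (i + 1) (i + 2) =
        0 := by
      have := c.comp_d_p₂ g
      rw [← Category.assoc, hg, zero_comp] at this
      exact this.symm
    obtain ⟨x, hx'⟩ : ∃ x : W ⟶ X.K.X (i + 1), x ≫ X.K.d (i + 1) (i + 2) = g ≫ c.p₁ (i + 1) := by
      by_cases hin : i + 1 < n
      · exact hX.exact_covariant (i + 1) hin _ hx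
      · obtain rfl : n = i + 1 := by omega
        obtain ⟨x, hx'⟩ := hX.exact_covariant_last ((g ≫ c.p₁ (i + 1)) ≫ X.right.hom) (by
          have : ((g ≫ c.p₁ (i + 1)) ≫ X.right.hom) ≫ b = (-(g ≫ c.p₂ (i + 1))) ≫ Y.dLast := by
            rw [Category.assoc, ← hf.2, ← Category.assoc, eq_neg_of_add_eq_zero_left hy, dLast]
            simp
          rw [← pull_comp, this, pull_comp, hY.pull_eq_zero, map_zero])
        refine ⟨x, ?_⟩
        rw [← cancel_mono X.right.hom, ← hx', dLast, Category.assoc]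
    obtain ⟨y, hy'⟩ := hY.exact_covariant i hi (g ≫ c.p₂ (i + 1) + x ≫ f.f (i + 1)) (by
      rw [Preadditive.add_comp, Category.assoc x, f.comm, ← Category.assoc x, hx']
      exact (add_comm _ _).trans hy)
    -- In degree `0` there is no second summand, and `y` is absorbed into `x`.
    obtain ⟨x', y', h₁, h₂, h₃⟩ : ∃ (x' : W ⟶ X.K.X (i + 1)) (y' : W ⟶ Y.K.X i),
        x' ≫ X.K.d (i + 1) (i + 2) = g ≫ c.p₁ (i + 1) ∧
        y' ≫ Y.K.d i (i + 1) = g ≫ c.p₂ (i + 1) + x' ≫ f.f (i + 1) ∧ y' ≫ c.i₂ i ≫ c.p₂ i = y' := by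
      rcases i with _ | i
      · refine ⟨x - (y ≫ r) ≫ X.K.d 0 1, 0, ?_, ?_, by simp⟩
        · rw [Preadditive.sub_comp, hx', Category.assoc, X.K.d_comp_d, comp_zero, sub_zero]
        · rw [Preadditive.sub_comp, Category.assoc, ← f.comm, ← Category.assoc,
            Category.assoc y, hrf, Category.comp_id, hy']
          simp
      · exact ⟨x, y, hx', hy', by rw [c.i₂_p₂, Category.comp_id]⟩
    have k₁ : (y' ≫ c.i₂ i - x' ≫ c.i₁ i) ≫ c.p₁ i = -x' := by
      simp [Preadditive.sub_comp, c.i₁_p₁, c.i₂_p₁]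
    have k₂ : (y' ≫ c.i₂ i - x' ≫ c.i₁ i) ≫ c.p₂ i = y' := by
      simp [Preadditive.sub_comp, c.i₁_p₂, h₃]
    refine ⟨y' ≫ c.i₂ i - x' ≫ c.i₁ i, c.ext_to ?_ ?_⟩
    · rw [Category.assoc, c.comp_d_p₁, k₁, Preadditive.neg_comp, neg_neg, h₁]
    · rw [Category.assoc, c.comp_d_p₂, k₁, k₂, h₂, Preadditive.neg_comp]
      abel
  · obtain ⟨h, hh⟩ := hN.exact_covariant_last g hg
    have := hu.dLast
    rw [Category.comp_id] at this
    exact ⟨h ≫ u.f n, by rw [Category.assoc, this, hh]⟩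
  · have hd := (c.d_comp g).symm.trans hg
    have ha : f.f (i + 1) ≫ c.i₂ (i + 1) ≫ g = X.K.d (i + 1) (i + 2) ≫ c.i₁ (i + 1) ≫ g := by
      have := congrArg (c.i₁ i ≫ ·) hd
      simp only [Preadditive.comp_add, reassoc_of% c.i₁_p₁, reassoc_of% c.i₁_p₂, zero_comp,
        add_zero, comp_zero] at this
      exact sub_eq_zero.mp this
    have hb : Y.K.d i (i + 1) ≫ c.i₂ (i + 1) ≫ g = 0 := by
      rcases i with _ | i
      · rw [← Category.id_comp (Y.K.d 0 1), ← hrf, Category.assoc, Category.assoc,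
          ← Category.assoc (f.f 0), f.comm, Category.assoc]
        have ha' : X.K.d 0 1 ≫ f.f 1 ≫ c.i₂ 1 ≫ g = 0 := by
          refine (congrArg (X.K.d 0 1 ≫ ·) ha).trans ?_
          change X.K.d 0 1 ≫ X.K.d 1 2 ≫ _ = 0
          rw [← Category.assoc, X.K.d_comp_d, zero_comp]
        exact (congrArg (r ≫ ·) ha').trans comp_zero
      · have := congrArg (c.i₂ (i + 1) ≫ ·) hd
        simp only [Preadditive.comp_add, reassoc_of% c.i₂_p₁, reassoc_of% c.i₂_p₂, zero_comp,
          zero_add, comp_zero] at this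
        exact this
    obtain ⟨y, hy⟩ := hY.exact_contravariant i hi _ hb
    have hxy : X.K.d (i + 1) (i + 2) ≫ (c.i₁ (i + 1) ≫ g - f.f (i + 2) ≫ y) = 0 := by
      rw [Preadditive.comp_sub, ← ha, ← Category.assoc (X.K.d _ _), ← f.comm, Category.assoc, hy,
        sub_self]
    obtain ⟨x, y', hx', hy'⟩ : ∃ (x : X.K.X (i + 3) ⟶ W) (y' : Y.K.X (i + 2) ⟶ W),
        X.K.d (i + 2) (i + 3) ≫ x = c.i₁ (i + 1) ≫ g - f.f (i + 2) ≫ y' ∧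
        Y.K.d (i + 1) (i + 2) ≫ y' = c.i₂ (i + 1) ≫ g := by
      by_cases hin : i + 1 < n
      · obtain ⟨x, hx⟩ := hX.exact_contravariant (i + 1) hin _ hxy
        exact ⟨x, y, hx, hy⟩
      · obtain rfl : n = i + 1 := by omega
        obtain ⟨h, h₁, h₂⟩ := hc (X.right.inv ≫ (c.i₁ (i + 1) ≫ g - f.f (i + 2) ≫ y)) (by
          rw [dLast, Category.assoc, Iso.hom_inv_id_assoc, hxy])
        have h₂' : f.f (i + 2) ≫ Y.right.hom ≫ h = c.i₁ (i + 1) ≫ g - f.f (i + 2) ≫ y := by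
          have e : f.f (i + 2) ≫ Y.right.hom = X.right.hom ≫ b := hf.2
          rw [reassoc_of% e, h₂, Iso.hom_inv_id_assoc]
        have h₁' : Y.K.d (i + 1) (i + 2) ≫ Y.right.hom ≫ h = 0 :=
          (Category.assoc _ _ _).symm.trans h₁
        refine ⟨0, y + Y.right.hom ≫ h, ?_, ?_⟩
        · rw [comp_zero, Preadditive.comp_add, h₂']
          abel
        · rw [Preadditive.comp_add, hy, h₁', add_zero]
    have k₁ : c.i₁ (i + 2) ≫ (c.p₂ (i + 2) ≫ y' - c.p₁ (i + 2) ≫ x) = -x := by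
      simp [Preadditive.comp_sub, reassoc_of% c.i₁_p₁, reassoc_of% c.i₁_p₂]
    have k₂ : c.i₂ (i + 2) ≫ (c.p₂ (i + 2) ≫ y' - c.p₁ (i + 2) ≫ x) = y' := by
      simp [Preadditive.comp_sub, reassoc_of% c.i₂_p₁, reassoc_of% c.i₂_p₂]
    refine ⟨c.p₂ (i + 2) ≫ y' - c.p₁ (i + 2) ≫ x, ?_⟩
    have e := c.d_comp (c.p₂ (i + 2) ≫ y' - c.p₁ (i + 2) ≫ x)
    refine e.trans ?_
    rw [k₁, k₂, Preadditive.comp_neg, hy', hx']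
    conv_rhs => rw [← Category.id_comp g, ← c.total, Preadditive.add_comp, Category.assoc,
      Category.assoc]
    simp
  · obtain ⟨h, hh⟩ := hN.exact_contravariant_last g hg
    have := hv.dFirst
    rw [Category.id_comp] at this
    exact ⟨v.f 1 ≫ h, by rw [← Category.assoc, this, hh]⟩

/-- The canonical isomorphism `Mᵢ ≅ Xᵢ₊₁ ⊞ Yᵢ`, for `i` positive. -/
noncomputable def iso [HasBinaryBiproducts 𝒞] (c : ConeData X Y f M) (i : ℕ) (hi : 1 ≤ i) :
    M.K.X i ≅ X.K.X (i + 1) ⊞ Y.K.X i where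
  hom := biprod.lift (c.p₁ i) (c.p₂ i)
  inv := biprod.desc (c.i₁ i) (c.i₂ i)
  hom_inv_id := by rw [biprod.lift_desc, c.total]
  inv_hom_id := by
    obtain ⟨i, rfl⟩ : ∃ j, i = j + 1 := ⟨i - 1, by omega⟩
    ext <;> simp [c.i₁_p₁, c.i₁_p₂, c.i₂_p₁, c.i₂_p₂]

lemma isMappingCone [HasBinaryBiproducts 𝒞] {Y : NComplex n A D} {f : X.K ⟶ Y.K}
    (c : ConeData X Y f M) : IsMappingCone f M := by
  refine ⟨fun i hi _ => c.iso i hi, fun h => ?_, fun i h₁ h₂ => ?_, fun h => ?_⟩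
  · have e : M.left.inv ≫ c.p₁ 0 = 𝟙 _ := by rw [← c.left_hom, Iso.inv_hom_id]
    have e₁ := c.comp_d_p₁ M.left.inv
    have e₂ := c.comp_d_p₂ M.left.inv
    rw [e, Category.id_comp] at e₁
    rw [e, Category.id_comp, c.p₂_zero, comp_zero, zero_comp, add_zero] at e₂
    ext
    · simpa [iso, dFirst] using e₁
    · simpa [iso, dFirst] using e₂
  · obtain ⟨i, rfl⟩ : ∃ j, i = j + 1 := ⟨i - 1, by omega⟩
    have e₁ := c.comp_d_p₁ (c.i₁ (i + 1))
    have e₂ := c.comp_d_p₂ (c.i₁ (i + 1))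
    have e₃ := c.comp_d_p₁ (c.i₂ (i + 1))
    have e₄ := c.comp_d_p₂ (c.i₂ (i + 1))
    rw [c.i₁_p₁, Category.id_comp] at e₁
    rw [c.i₁_p₁, c.i₁_p₂, Category.id_comp, zero_comp, add_zero] at e₂
    rw [c.i₂_p₁, zero_comp, neg_zero] at e₃
    rw [c.i₂_p₁, c.i₂_p₂, Category.id_comp, zero_comp, zero_add] at e₄
    ext
    · simpa [iso] using e₁
    · simpa [iso] using e₂
    · simpa [iso] using e₃
    · simpa [iso] using e₄
  · obtain ⟨n, rfl⟩ : ∃ j, n = j + 1 := ⟨n - 1, by omega⟩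
    have e₁ := c.comp_d_p₂ (c.i₁ (n + 1))
    have e₂ := c.comp_d_p₂ (c.i₂ (n + 1))
    rw [c.i₁_p₁, c.i₁_p₂, Category.id_comp, zero_comp, add_zero] at e₁
    rw [c.i₂_p₁, c.i₂_p₂, Category.id_comp, zero_comp, zero_add] at e₂
    ext
    · simp [iso, dLast, c.right_hom, ← e₁]
    · simp [iso, dLast, c.right_hom, ← e₂]

end ConeData

end NComplex

end Cones

section ExistenceOfCones

variable {n : ℕ} {𝒞 : Type u} [Category.{v} 𝒞] [Preadditive 𝒞] [HasBinaryBiproducts 𝒞]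

namespace NComplex

open Classical in
/-- Conversely to `ConeData.isMappingCone`, the isomorphisms `Mᵢ ≅ Xᵢ₊₁ ⊞ Yᵢ` in the degrees
`1, …, n` that exhibit a mapping cone extend to a presentation in all degrees. -/
lemma IsMappingCone.nonempty_coneData (hn : 1 ≤ n) {A C D : 𝒞} {X : NComplex n A C}
    {Y : NComplex n A D} {f : X.K ⟶ Y.K} {M : NComplex n (X.K.X 1) D} (h : IsMappingCone f M) :
    Nonempty (ConeData X Y f M) := by
  obtain ⟨φ, h₁, h₂, h₃⟩ := h
  obtain ⟨ψ, hψ⟩ : ∃ ψ : ∀ i, n ≤ i → (M.K.X (i + 1) ≅ Y.K.X (i + 1)),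
      ψ n le_rfl = M.right ≪≫ Y.right.symm :=
    ⟨fun i hi => if h : i = n then by subst h; exact M.right ≪≫ Y.right.symm else
      (M.isZero (i + 1) (by omega)).iso (Y.isZero (i + 1) (by omega)), dif_pos rfl⟩
  let p₁ : ∀ i, M.K.X i ⟶ X.K.X (i + 1) := fun
    | 0 => M.left.hom
    | i + 1 => if h : i + 1 ≤ n then (φ (i + 1) (by omega) h).hom ≫ biprod.fst else 0
  let p₂ : ∀ i, M.K.X i ⟶ Y.K.X i := fun
    | 0 => 0
    | i + 1 => if h : i + 1 ≤ n then (φ (i + 1) (by omega) h).hom ≫ biprod.snd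
        else (ψ i (by omega)).hom
  let i₁ : ∀ i, X.K.X (i + 1) ⟶ M.K.X i := fun
    | 0 => M.left.inv
    | i + 1 => if h : i + 1 ≤ n then biprod.inl ≫ (φ (i + 1) (by omega) h).inv else 0
  let i₂ : ∀ i, Y.K.X i ⟶ M.K.X i := fun
    | 0 => 0
    | i + 1 => if h : i + 1 ≤ n then biprod.inr ≫ (φ (i + 1) (by omega) h).inv
        else (ψ i (by omega)).inv
  have p₁_le : ∀ i (h : i + 1 ≤ n), p₁ (i + 1) = (φ (i + 1) (by omega) h).hom ≫ biprod.fst :=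
    fun i h => dif_pos h
  have p₂_le : ∀ i (h : i + 1 ≤ n), p₂ (i + 1) = (φ (i + 1) (by omega) h).hom ≫ biprod.snd :=
    fun i h => dif_pos h
  have i₁_le : ∀ i (h : i + 1 ≤ n), i₁ (i + 1) = biprod.inl ≫ (φ (i + 1) (by omega) h).inv :=
    fun i h => dif_pos h
  have i₂_le : ∀ i (h : i + 1 ≤ n), i₂ (i + 1) = biprod.inr ≫ (φ (i + 1) (by omega) h).inv :=
    fun i h => dif_pos h
  have p₂_gt : ∀ i (h : ¬ i + 1 ≤ n), p₂ (i + 1) = (ψ i (by omega)).hom := fun i h => dif_neg h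
  have i₂_gt : ∀ i (h : ¬ i + 1 ≤ n), i₂ (i + 1) = (ψ i (by omega)).inv := fun i h => dif_neg h
  have hX : ∀ i, ¬ i + 1 ≤ n → IsZero (X.K.X (i + 2)) := fun i h => X.isZero _ (by omega)
  refine ⟨{ p₁ := p₁, p₂ := p₂, i₁ := i₁, i₂ := i₂, p₂_zero := rfl, total := ?_, i₁_p₁ := ?_,
            i₁_p₂ := ?_, i₂_p₁ := ?_, i₂_p₂ := ?_, d_p₁ := ?_, d_p₂ := ?_, left_hom := rfl,
            right_hom := ?_ }⟩
  · rintro (_ | i)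
    · simp [p₁, p₂, i₁, i₂]
    by_cases h : i + 1 ≤ n
    · rw [p₁_le i h, p₂_le i h, i₁_le i h, i₂_le i h, Category.assoc, Category.assoc,
        ← Category.assoc biprod.fst, ← Category.assoc biprod.snd, ← Preadditive.comp_add,
        ← Preadditive.add_comp, biprod.total, Category.id_comp, Iso.hom_inv_id]
    · rw [p₂_gt i h, i₂_gt i h, (hX i h).eq_of_tgt (p₁ (i + 1)) 0, zero_comp, zero_add,
        Iso.hom_inv_id]
  · rintro (_ | i)
    · simp [p₁, i₁]
    by_cases h : i + 1 ≤ n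
    · simp [p₁_le i h, i₁_le i h]
    · exact (hX i h).eq_of_src _ _
  · rintro (_ | i)
    · simp [p₂, i₁]
    by_cases h : i + 1 ≤ n
    · simp [p₂_le i h, i₁_le i h]
    · exact (hX i h).eq_of_src _ _
  · rintro (_ | i)
    · simp [p₁, i₂]
    by_cases h : i + 1 ≤ n
    · simp [p₁_le i h, i₂_le i h]
    · exact (hX i h).eq_of_tgt _ _
  · intro i
    by_cases h : i + 1 ≤ n
    · simp [p₂_le i h, i₂_le i h]
    · simp [p₂_gt i h, i₂_gt i h]
  · rintro (_ | i)
    · have e := congrArg (M.left.hom ≫ · ≫ biprod.fst) (h₁ hn)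
      simp only [dFirst, Category.assoc, Iso.hom_inv_id_assoc, biprod.lift_fst,
        Preadditive.comp_neg] at e
      rw [p₁_le 0 hn]
      exact e
    by_cases h : i + 2 ≤ n
    · have e := congrArg ((φ (i + 1) (by omega) (by omega)).hom ≫ · ≫ biprod.fst)
        (h₂ (i + 1) (by omega) h)
      simp only [Category.assoc, Iso.hom_inv_id_assoc] at e
      rw [p₁_le (i + 1) h, p₁_le i (by omega)]
      refine e.trans ?_
      rw [Category.assoc, ← Preadditive.comp_neg]
      congr 1
      ext <;> simp
    · exact (hX (i + 1) h).eq_of_tgt _ _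
  · rintro (_ | i)
    · have e := congrArg (M.left.hom ≫ · ≫ biprod.snd) (h₁ hn)
      simp only [dFirst, Category.assoc, Iso.hom_inv_id_assoc, biprod.lift_snd] at e
      rw [p₂_le 0 hn, show p₂ 0 = 0 from rfl, zero_comp, add_zero]
      exact e
    by_cases h : i + 2 ≤ n
    · have e := congrArg ((φ (i + 1) (by omega) (by omega)).hom ≫ · ≫ biprod.snd)
        (h₂ (i + 1) (by omega) h)
      simp only [Category.assoc, Iso.hom_inv_id_assoc] at e
      rw [p₂_le (i + 1) h, p₂_le i (by omega), p₁_le i (by omega)]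
      refine e.trans ?_
      rw [Category.assoc, Category.assoc, ← Preadditive.comp_add]
      congr 1
      ext <;> simp
    by_cases h' : i + 1 = n
    · subst h'
      have e := congrArg ((φ (i + 1) (by omega) le_rfl).hom ≫ · ≫ Y.right.inv)
        (h₃ (by omega))
      simp only [dLast, Category.assoc, Iso.hom_inv_id_assoc] at e
      rw [p₂_gt (i + 1) (by omega), hψ, p₂_le i le_rfl, p₁_le i le_rfl]
      refine e.trans ?_
      rw [Category.assoc, Category.assoc, ← Preadditive.comp_add]
      congr 1
      ext <;> simp
    · exact (Y.isZero (i + 2) (by omega)).eq_of_tgt _ _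
  · rw [p₂_gt n (by omega), hψ]
    simp

/-- Mapping cones exist. -/
lemma exists_coneData {A B C D : 𝒞} (X : NComplex n A C) (Y : NComplex n B D) (f : X.K ⟶ Y.K) :
    ∃ M : NComplex n (X.K.X 1) D, Nonempty (ConeData X Y f M) := by
  let T : ℕ → 𝒞 := fun
    | 0 => X.K.X 1
    | i + 1 => X.K.X (i + 2) ⊞ Y.K.X (i + 1)
  let d : ∀ i, T i ⟶ T (i + 1) := fun
    | 0 => (biprod.lift (-X.K.d 1 2) (f.f 1) : X.K.X 1 ⟶ X.K.X 2 ⊞ Y.K.X 1)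
    | i + 1 => (biprod.desc (biprod.lift (-X.K.d (i + 2) (i + 3)) (f.f (i + 2)))
        (biprod.lift 0 (Y.K.d (i + 1) (i + 2))) :
        X.K.X (i + 2) ⊞ Y.K.X (i + 1) ⟶ X.K.X (i + 3) ⊞ Y.K.X (i + 2))
  have sq : ∀ i, d i ≫ d (i + 1) = 0 := by
    rintro (_ | i)
    · ext <;> simp [d]
    · ext <;> simp [d]
  let K : CochainComplex 𝒞 ℕ := CochainComplex.of T d sq
  have hd : ∀ i, K.d i (i + 1) = d i := fun i => CochainComplex.of_d _ _ i
  have hz : ∀ i, n < i → IsZero (X.K.X (i + 1)) := fun i hi => X.isZero _ (by omega)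
  refine ⟨{ K := K
            isZero := ?_
            left := Iso.refl (X.K.X 1)
            right := (⟨biprod.snd, biprod.inr, ?_, ?_⟩ :
              X.K.X (n + 2) ⊞ Y.K.X (n + 1) ≅ Y.K.X (n + 1)) ≪≫ Y.right }, ⟨{
            p₁ := fun
              | 0 => 𝟙 (X.K.X 1)
              | i + 1 => (biprod.fst : X.K.X (i + 2) ⊞ Y.K.X (i + 1) ⟶ X.K.X (i + 2))
            p₂ := fun
              | 0 => 0
              | i + 1 => (biprod.snd : X.K.X (i + 2) ⊞ Y.K.X (i + 1) ⟶ Y.K.X (i + 1))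
            i₁ := fun
              | 0 => 𝟙 (X.K.X 1)
              | i + 1 => (biprod.inl : X.K.X (i + 2) ⟶ X.K.X (i + 2) ⊞ Y.K.X (i + 1))
            i₂ := fun
              | 0 => 0
              | i + 1 => (biprod.inr : Y.K.X (i + 1) ⟶ X.K.X (i + 2) ⊞ Y.K.X (i + 1))
            p₂_zero := rfl
            total := ?_
            i₁_p₁ := ?_
            i₁_p₂ := ?_
            i₂_p₁ := ?_
            i₂_p₂ := fun _ => biprod.inr_snd
            d_p₁ := ?_
            d_p₂ := ?_
            left_hom := rfl
            right_hom := rfl }⟩⟩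
  · rintro (_ | i) hi
    · omega
    · rw [IsZero.iff_id_eq_zero]
      exact biprod.hom_ext _ _ ((X.isZero _ (by omega)).eq_of_tgt _ _)
        ((Y.isZero _ (by omega)).eq_of_tgt _ _)
  · exact biprod.hom_ext _ _ ((hz _ (by omega)).eq_of_tgt _ _) (by simp)
  · exact biprod.inr_snd
  · rintro (_ | i)
    · exact (congrArg₂ (· + ·) (Category.id_comp (𝟙 (X.K.X 1))) zero_comp).trans (add_zero _)
    · exact biprod.total
  · rintro (_ | i)
    · exact Category.id_comp (𝟙 (X.K.X 1))
    · exact biprod.inl_fst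
  · rintro (_ | i)
    · exact comp_zero
    · exact biprod.inl_snd
  · rintro (_ | i)
    · exact zero_comp
    · exact biprod.inr_fst
  · intro i
    refine (congrArg (· ≫ _) (hd i)).trans ?_
    rcases i with _ | i
    · exact (biprod.lift_fst _ _).trans (congrArg Neg.neg (Category.id_comp _).symm)
    · change biprod.desc _ _ ≫ biprod.fst = -(biprod.fst ≫ _)
      ext <;> simp
  · intro i
    refine (congrArg (· ≫ _) (hd i)).trans ?_
    rcases i with _ | i
    · refine (biprod.lift_snd _ _).trans ?_
      change _ = 𝟙 (X.K.X 1) ≫ f.f 1 + 0 ≫ Y.K.d 0 1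
      simp
    · change biprod.desc _ _ ≫ biprod.snd = biprod.fst ≫ _ + biprod.snd ≫ _
      ext <;> simp

end NComplex

end ExistenceOfCones

section ConeOfRetract

attribute [local instance] hasBinaryBiproducts_of_finite_biproducts

variable {n : ℕ} {𝒞 : Type u} [Category.{v} 𝒞] [Preadditive 𝒞] [HasFiniteBiproducts 𝒞]

/-- The existence of good lifts, whose mapping cones are realisations, passes to retracts. -/
theorem ExtData.IsRealisation.exists_cone_of_retract {S : ExtData.{w} n 𝒞} (hS : S.IsRealisation)
    (hE : IsBiadditive S.E) (hn : 1 ≤ n)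
    {A₀ C₀ D₀ : 𝒞} {δ₀ : Ext S.E D₀ A₀} {c₀ : C₀ ⟶ D₀}
    {X₀ : NComplex n A₀ C₀} (hX₀ : X₀ ∈ S.s (pull S.E c₀ δ₀))
    {Y₀ : NComplex n A₀ D₀} (hY₀ : Y₀ ∈ S.s δ₀)
    {f₀ : X₀.K ⟶ Y₀.K} (hf₀ : NComplex.Lifts (X := X₀) (Y := Y₀) f₀ (𝟙 A₀) c₀)
    {M₀ : NComplex n (X₀.K.X 1) D₀} (hM₀ : M₀ ∈ S.s (push S.E X₀.dFirst δ₀))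
    (m₀ : NComplex.ConeData X₀ Y₀ f₀ M₀)
    {A C D : 𝒞} {δ : Ext S.E D A} {c : C ⟶ D}
    {X : NComplex n A C} (hX : X ∈ S.s (pull S.E c δ)) {Y : NComplex n A D} (hY : Y ∈ S.s δ)
    {a : A ⟶ A₀} {a' : A₀ ⟶ A} {k : C ⟶ C₀} {k' : C₀ ⟶ C} {l : D ⟶ D₀} {l' : D₀ ⟶ D}
    (ha : a ≫ a' = 𝟙 A) (hk : k ≫ k' = 𝟙 C) (hl : l ≫ l' = 𝟙 D)
    {iX : X.K ⟶ X₀.K} (hiX : NComplex.Lifts (X := X) (Y := X₀) iX a k)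
    {pX : X₀.K ⟶ X.K} (hpX : NComplex.Lifts (X := X₀) (Y := X) pX a' k')
    {sX : ∀ i, X.K.X (i + 1) ⟶ X.K.X i} (hsX : NullHtpy (𝟙 X.K - iX ≫ pX) sX)
    {iY : Y.K ⟶ Y₀.K} (hiY : NComplex.Lifts (X := Y) (Y := Y₀) iY a l)
    {pY : Y₀.K ⟶ Y.K} (hpY : NComplex.Lifts (X := Y₀) (Y := Y) pY a' l')
    {sY : ∀ i, Y.K.X (i + 1) ⟶ Y.K.X i} (hsY : NullHtpy (𝟙 Y.K - iY ≫ pY) sY)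
    (hc : c ≫ l = k ≫ c₀) (hc' : c₀ ≫ l' = k' ≫ c)
    (h₁ : push S.E a δ = pull S.E l δ₀) (h₂ : push S.E a' δ₀ = pull S.E l' δ)
    (hδ₀ : push S.E (a' ≫ a) δ₀ = δ₀) :
    ∃ f : X.K ⟶ Y.K, NComplex.Lifts (X := X) (Y := Y) f (𝟙 A) c ∧
      ∃ M ∈ S.s (push S.E X.dFirst δ), NComplex.IsMappingCone (X := X) (Y := Y) f M := by
  have eX₀ := hS.isNExangle _ X₀ hX₀
  have eY₀ := hS.isNExangle _ Y₀ hY₀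
  have eX := hS.isNExangle _ X hX
  have eY := hS.isNExangle _ Y hY
  have hδ₀' : pull S.E (l' ≫ l) δ₀ = δ₀ := by
    rw [pull_comp, ← h₁, ← push_pull, ← h₂, ← push_comp, hδ₀]
  have rX : NullLeft (𝟙 X.K - iX ≫ pX) := eX.nullLeft_of_nullHtpy hn
    ((NComplex.Lifts.id.sub (hiX.comp hpX)).of_eq (by rw [ha, sub_self]) rfl).f_zero hsX
  have rY : NullLeft (𝟙 Y.K - iY ≫ pY) := eY.nullLeft_of_nullHtpy hn
    ((NComplex.Lifts.id.sub (hiY.comp hpY)).of_eq (by rw [ha, sub_self]) rfl).f_zero hsY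
  have hf : NComplex.Lifts (X := X) (Y := Y) (iX ≫ f₀ ≫ pY) (𝟙 A) c :=
    (hiX.comp (hf₀.comp hpY)).of_eq (by rw [Category.id_comp, ha])
      (by rw [hc', reassoc_of% hk])
  obtain ⟨M, ⟨m⟩⟩ := NComplex.exists_coneData X Y (iX ≫ f₀ ≫ pY)
  -- The morphisms of mapping cones induced by `pX`, `pY` and by `iX`, `iY`.
  obtain ⟨Φ, hΦ⟩ := m₀.exists_hom m pX pY (b := l') (by
    obtain ⟨σ, hσ⟩ := eX₀.exact_covariant_last (𝟙 _ - k' ≫ k) (by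
      have e : (k' ≫ k) ≫ c₀ = c₀ ≫ l' ≫ l := by
        rw [Category.assoc, ← hc, reassoc_of% hc']
      rw [hE.pull_sub, pull_id, ← pull_comp, e, pull_comp, hδ₀', sub_self])
    have e : f₀ ≫ pY - pX ≫ iX ≫ f₀ ≫ pY = (𝟙 X₀.K - pX ≫ iX) ≫ f₀ ≫ pY := by
      rw [Preadditive.sub_comp, Category.id_comp, Category.assoc]
    have hL := (NComplex.Lifts.id.sub (hpX.comp hiX)).comp (hf₀.comp hpY)
    rw [e]
    refine eX₀.nullLeft_of_split_source hn rX (X₀.right.hom ≫ σ) ?_ _ ?_ ?_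
    · rw [← cancel_mono X₀.right.hom, (NComplex.Lifts.id.sub (hpX.comp hiX)).2, ← hσ]
      simp [NComplex.dLast]
    · refine (hL.of_eq ?_ rfl).f_zero
      rw [Preadditive.sub_comp, Category.id_comp, Category.id_comp, Category.assoc, ha,
        Category.comp_id, sub_self]
    · refine (hL.of_eq rfl ?_).f_last
      rw [hc', Preadditive.sub_comp, Category.id_comp, Category.assoc, reassoc_of% hk, sub_self])
    hpY.2
  obtain ⟨Φ', hΦ'⟩ := m.exists_hom m₀ iX iY (b := l) (by
    obtain ⟨σ, hσ⟩ := eY₀.exact_covariant_last (𝟙 _ - l' ≫ l) (by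
      rw [hE.pull_sub, pull_id, hδ₀', sub_self])
    have e : (iX ≫ f₀ ≫ pY) ≫ iY - iX ≫ f₀ = -((iX ≫ f₀) ≫ (𝟙 Y₀.K - pY ≫ iY)) := by
      simp only [Preadditive.comp_sub, Category.comp_id, Category.assoc, neg_sub]
    have hL := (hiX.comp hf₀).comp (NComplex.Lifts.id.sub (hpY.comp hiY))
    rw [e]
    refine NullLeft.neg (eX.nullLeft_of_split_target hn rY (Y₀.right.hom ≫ σ) ?_ _ ?_ ?_)
    · rw [← cancel_mono Y₀.right.hom, (NComplex.Lifts.id.sub (hpY.comp hiY)).2, ← hσ]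
      simp [NComplex.dLast]
    · refine (hL.of_eq ?_ rfl).f_zero
      rw [Preadditive.comp_sub, Category.comp_id, Category.comp_id, reassoc_of% ha, sub_self]
    · refine (hL.of_eq rfl ?_).f_last
      rw [← hc, Preadditive.comp_sub, Category.comp_id, Category.assoc, reassoc_of% hl, sub_self])
    hiY.2
  -- The composites with the comparison morphisms of realisations are the identity at the ends, up
  -- to an error `t` that factors through the differential `d₁` of `X`.
  obtain ⟨N, hN⟩ := hS.exists_mem (push S.E X.dFirst δ)
  have eN := hS.isNExangle _ N hN
  obtain ⟨u, hu⟩ := hS.exists_lift _ _ (iX.f 1) l (by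
    rw [← push_comp, hiX.dFirst, push_comp, h₁, push_pull]) N hN M₀ hM₀
  obtain ⟨v, hv⟩ := hS.exists_lift _ _ (pX.f 1) l' (by
    rw [← push_comp, hpX.dFirst, push_comp, h₂, push_pull]) M₀ hM₀ N hN
  obtain ⟨g, hg⟩ : ∃ g, 𝟙 (X.K.X 1) - iX.f 1 ≫ pX.f 1 = X.K.d 1 2 ≫ g := by
    obtain ⟨s, hs, hs0⟩ := rX
    refine ⟨s 1, ?_⟩
    refine (hs.succ 0).trans ?_
    rw [hs0, zero_comp]
    exact zero_add _
  obtain ⟨y, hy⟩ := eN.exact_contravariant_last (𝟙 (X.K.X 1) - iX.f 1 ≫ pX.f 1) (by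
    have : X.dFirst ≫ (𝟙 (X.K.X 1) - iX.f 1 ≫ pX.f 1) = 0 := by
      rw [hg, NComplex.dFirst, Category.assoc, ← Category.assoc (X.K.d 0 1), X.K.d_comp_d,
        zero_comp, comp_zero]
    rw [← push_comp, this, hE.push_zero])
  have hy' : M.dFirst ≫ (-(m.p₁ 1 ≫ g)) = 𝟙 (X.K.X 1) - iX.f 1 ≫ pX.f 1 := by
    have e : M.left.inv ≫ m.p₁ 0 = 𝟙 _ := by rw [← m.left_hom, Iso.inv_hom_id]
    have := m.comp_d_p₁ M.left.inv
    rw [e, Category.id_comp] at this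
    rw [Preadditive.comp_neg, ← Category.assoc, NComplex.dFirst, Category.assoc M.left.inv, this,
      Preadditive.neg_comp, neg_neg, hg]
  obtain ⟨θ, hθ⟩ := NComplex.exists_lifts_dFirst_comp hn N M y
  obtain ⟨θ', hθ'⟩ := NComplex.exists_lifts_dFirst_comp hn M N (-(m.p₁ 1 ≫ g))
  have hu' : NComplex.Lifts (X := N) (Y := M) (u ≫ Φ + θ) (𝟙 _) (𝟙 D) :=
    ((hu.comp hΦ).add hθ).of_eq (by rw [hy]; abel) (by rw [hl, add_zero])
  have hv' : NComplex.Lifts (X := M) (Y := N) (Φ' ≫ v + θ') (𝟙 _) (𝟙 D) :=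
    ((hΦ'.comp hv).add hθ').of_eq (by rw [hy']; abel) (by rw [hl, add_zero])
  refine ⟨iX ≫ f₀ ≫ pY, hf, M, hS.mem_of_isNExangle hN
    (m.isNExangle eX eY hf eN hu' hv' fun {W} z hz => ?_) hu' hv', m.isMappingCone⟩
  obtain ⟨h, e₁, e₂⟩ := m₀.exists_of_isNExangle hn (hS.isNExangle _ M₀ hM₀) hf₀ (k' ≫ z) (by
    rw [← Category.assoc, ← hpX.dLast, Category.assoc, hz, comp_zero])
  refine ⟨l ≫ h, ?_, ?_⟩
  · rw [← Category.assoc, ← hiY.dLast, Category.assoc, e₁, comp_zero]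
  · rw [reassoc_of% hc, e₂, reassoc_of% hk]

theorem ExtData.IsNExangulated.karoubi_exists_cone {S : ExtData.{w} n 𝒞} (hS : S.IsNExangulated)
    (hn : 1 ≤ n) {A C D : Karoubi 𝒞} (δ : Ext S.karoubi.E D A) (c : C ⟶ D)
    (X : NComplex n A C) (hX : X ∈ S.karoubi.s (pull S.karoubi.E c δ))
    (Y : NComplex n A D) (hY : Y ∈ S.karoubi.s δ) :
    ∃ f : X.K ⟶ Y.K, NComplex.Lifts (X := X) (Y := Y) f (𝟙 A) c ∧
      ∃ M ∈ S.karoubi.s (push S.karoubi.E X.dFirst δ),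
        NComplex.IsMappingCone (X := X) (Y := Y) f M := by
  have hR := hS.isExactRealisation.isRealisation
  have hI : IsNExangulatedFunctor S S.karoubi (toKaroubi 𝒞) (karoubiGamma S.E) :=
    isNExangulatedFunctor_toKaroubi hn hR
  obtain ⟨X₁, hX₁, iX, pX, hiX, hpX, sX, hsX⟩ := exists_retract_of_mem_karoubi hX
  obtain ⟨Y₁, hY₁, iY, pY, hiY, hpY, sY, hsY⟩ := exists_retract_of_mem_karoubi hY
  obtain ⟨f, hf, M, hM, hc⟩ := hS.exists_cone (underlying S.E δ) c.f X₁ hX₁ Y₁ hY₁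
  obtain ⟨m⟩ := hc.nonempty_coneData hn
  refine (hR.karoubi hn).exists_cone_of_retract (karoubiBifunctor_isBiadditive hS.isBiadditive) hn
    (δ₀ := extMap (karoubiGamma S.E) (underlying S.E δ)) (c₀ := (toKaroubi 𝒞).map c.f)
    (X₀ := X₁.map (toKaroubi 𝒞)) (Y₀ := Y₁.map (toKaroubi 𝒞)) (hI _ X₁ hX₁) (hI _ Y₁ hY₁)
    ((hf.map (toKaroubi 𝒞)).of_eq ((toKaroubi 𝒞).map_id _) rfl) (hI _ M hM)
    (m.map (toKaroubi 𝒞)) hX hY (karoubiInc_proj A) (karoubiInc_proj C) (karoubiInc_proj D)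
    hiX hpX hsX hiY hpY hsY ?_ ?_ (push_inc_eq δ) (push_proj_eq δ) ?_
  · ext
    change c.f ≫ D.p = C.p ≫ c.f
    rw [Karoubi.comp_p, Karoubi.p_comp]
  · ext
    change c.f ≫ D.p = C.p ≫ c.f
    rw [Karoubi.comp_p, Karoubi.p_comp]
  · refine underlying_injective ?_
    change push S.E (A.p ≫ A.p) (underlying S.E δ) = underlying S.E δ
    rw [A.idem]
    exact push_p_underlying δ

end ConeOfRetract

/-! ### Mapping cocones -/

section Cocones

variable {n : ℕ} {𝒞 : Type u} [Category.{v} 𝒞] [Preadditive 𝒞]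

/-- A lift of a pair of morphisms of the ends that is null-homotopic through a homotopy
concentrated in the highest degree. -/
lemma NComplex.exists_lifts_comp_dLast (hn : 1 ≤ n) {A B C D : 𝒞} (X : NComplex n A C)
    (Y : NComplex n B D) (k : C ⟶ Y.K.X n) :
    ∃ θ : X.K ⟶ Y.K, NComplex.Lifts (X := X) (Y := Y) θ 0 (k ≫ Y.dLast) := by
  obtain ⟨m, rfl⟩ : ∃ m, n = m + 1 := ⟨n - 1, by omega⟩
  obtain ⟨s, hs, hs'⟩ : ∃ s : ∀ i, X.K.X (i + 1) ⟶ Y.K.X i, s (m + 1) = X.right.hom ≫ k ∧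
      ∀ i, i ≠ m + 1 → s i = 0 :=
    ⟨Function.update (fun _ => 0) (m + 1) (X.right.hom ≫ k), Function.update_self _ _ _,
      fun i hi => Function.update_of_ne hi _ _⟩
  refine ⟨{ f := fun
              | 0 => X.K.d 0 1 ≫ s 0
              | i + 1 => s i ≫ Y.K.d i (i + 1) + X.K.d (i + 1) (i + 2) ≫ s (i + 1)
            comm' := ?_ }, ?_, ?_⟩
  · rintro (_ | i) _ rfl
    · simp [Preadditive.comp_add]
    · simp [Preadditive.comp_add, Preadditive.add_comp]
      rfl
  · simp [hs' 0 (by omega)]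
  · simp [hs, hs' (m + 1 + 1) (by omega), NComplex.dLast]

namespace NComplex

/-- A presentation of `M` as the mapping cocone of `f : X ⟶ Y`, in terms of the projections and the
inclusions of the two summands in `Mᵢ₊₁ = Xᵢ₊₁ ⊞ Yᵢ`.  In degree `0` the second summand is absent,
and in degree `n + 1` the first one. -/
structure CoconeData {A B C D : 𝒞} (X : NComplex n A C) (Y : NComplex n B D) (f : X.K ⟶ Y.K)
    (M : NComplex n A (Y.K.X n)) where
  /-- projection to the first summand -/
  p₁ : ∀ i, M.K.X i ⟶ X.K.X i
  /-- projection to the second summand -/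
  p₂ : ∀ i, M.K.X (i + 1) ⟶ Y.K.X i
  /-- inclusion of the first summand -/
  i₁ : ∀ i, X.K.X i ⟶ M.K.X i
  /-- inclusion of the second summand -/
  i₂ : ∀ i, Y.K.X i ⟶ M.K.X (i + 1)
  i₁_last : i₁ (n + 1) = 0
  total_zero : p₁ 0 ≫ i₁ 0 = 𝟙 _
  total : ∀ i, p₁ (i + 1) ≫ i₁ (i + 1) + p₂ i ≫ i₂ i = 𝟙 _
  i₁_p₁ : ∀ i, i ≤ n → i₁ i ≫ p₁ i = 𝟙 _
  i₁_p₂ : ∀ i, i₁ (i + 1) ≫ p₂ i = 0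
  i₂_p₁ : ∀ i, i₂ i ≫ p₁ (i + 1) = 0
  i₂_p₂ : ∀ i, i ≤ n → i₂ i ≫ p₂ i = 𝟙 _
  i₁_d : ∀ i, i₁ i ≫ M.K.d i (i + 1) = X.K.d i (i + 1) ≫ i₁ (i + 1) + f.f i ≫ i₂ i
  i₂_d : ∀ i, i₂ i ≫ M.K.d (i + 1) (i + 2) = -(Y.K.d i (i + 1) ≫ i₂ (i + 1))
  left_hom : M.left.hom = p₁ 0 ≫ X.left.hom
  right_hom : M.right.hom = p₂ n

namespace CoconeData

variable {A B C D : 𝒞} {X : NComplex n A C} {Y : NComplex n B D} {f : X.K ⟶ Y.K}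
  {M : NComplex n A (Y.K.X n)}

lemma ext_from (c : CoconeData X Y f M) {i : ℕ} {W : 𝒞} {g h : M.K.X (i + 1) ⟶ W}
    (h₁ : c.i₁ (i + 1) ≫ g = c.i₁ (i + 1) ≫ h) (h₂ : c.i₂ i ≫ g = c.i₂ i ≫ h) : g = h := by
  rw [← Category.id_comp g, ← Category.id_comp h, ← c.total, Preadditive.add_comp,
    Preadditive.add_comp, Category.assoc, Category.assoc, Category.assoc, Category.assoc, h₁, h₂]

lemma ext_from_zero (c : CoconeData X Y f M) {W : 𝒞} {g h : M.K.X 0 ⟶ W}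
    (h₁ : c.i₁ 0 ≫ g = c.i₁ 0 ≫ h) : g = h := by
  rw [← Category.id_comp g, ← Category.id_comp h, ← c.total_zero, Category.assoc, Category.assoc,
    h₁]

lemma i₁_d_comp (c : CoconeData X Y f M) {i : ℕ} {W : 𝒞} (g : M.K.X (i + 1) ⟶ W) :
    c.i₁ i ≫ M.K.d i (i + 1) ≫ g =
      X.K.d i (i + 1) ≫ c.i₁ (i + 1) ≫ g + f.f i ≫ c.i₂ i ≫ g := by
  rw [← Category.assoc, c.i₁_d, Preadditive.add_comp, Category.assoc, Category.assoc]

lemma i₂_d_comp (c : CoconeData X Y f M) {i : ℕ} {W : 𝒞} (g : M.K.X (i + 2) ⟶ W) :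
    c.i₂ i ≫ M.K.d (i + 1) (i + 2) ≫ g = -(Y.K.d i (i + 1) ≫ c.i₂ (i + 1) ≫ g) := by
  rw [← Category.assoc, c.i₂_d, Preadditive.neg_comp, Category.assoc]

lemma comp_d_zero (c : CoconeData X Y f M) {W : 𝒞} (g : W ⟶ M.K.X 0) :
    g ≫ M.K.d 0 1 = ((g ≫ c.p₁ 0) ≫ X.K.d 0 1) ≫ c.i₁ 1 + ((g ≫ c.p₁ 0) ≫ f.f 0) ≫ c.i₂ 0 := by
  conv_lhs => rw [← Category.id_comp (M.K.d 0 1), ← c.total_zero, Category.assoc, c.i₁_d]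
  simp only [Preadditive.comp_add, Category.assoc]

lemma comp_d_succ (c : CoconeData X Y f M) {i : ℕ} {W : 𝒞} (g : W ⟶ M.K.X (i + 1)) :
    g ≫ M.K.d (i + 1) (i + 2) = ((g ≫ c.p₁ (i + 1)) ≫ X.K.d (i + 1) (i + 2)) ≫ c.i₁ (i + 2) +
      ((g ≫ c.p₁ (i + 1)) ≫ f.f (i + 1) - (g ≫ c.p₂ i) ≫ Y.K.d i (i + 1)) ≫ c.i₂ (i + 1) := by
  conv_lhs => rw [← Category.id_comp (M.K.d (i + 1) (i + 2)), ← c.total, Preadditive.add_comp,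
    Category.assoc, Category.assoc, c.i₁_d, c.i₂_d]
  simp only [Preadditive.comp_add, Preadditive.comp_neg, Preadditive.sub_comp, Category.assoc]
  abel

/-- A homotopy commutative square induces a morphism of the mapping cocones. -/
lemma exists_hom (c : CoconeData X Y f M) {A' B' C' D' : 𝒞} {X' : NComplex n A' C'}
    {Y' : NComplex n B' D'} {f' : X'.K ⟶ Y'.K} {M' : NComplex n A' (Y'.K.X n)}
    (c' : CoconeData X' Y' f' M') (α : X.K ⟶ X'.K) (β : Y.K ⟶ Y'.K)
    (H : NullRight n (f ≫ β - α ≫ f')) {a : A ⟶ A'}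
    (hα : α.f 0 ≫ X'.left.hom = X.left.hom ≫ a) :
    ∃ Φ : M.K ⟶ M'.K, Lifts (X := M) (Y := M') Φ a (β.f n) := by
  obtain ⟨s, hs, hsn⟩ := H
  let Φ : ∀ i, M.K.X i ⟶ M'.K.X i := fun
    | 0 => c.p₁ 0 ≫ α.f 0 ≫ c'.i₁ 0
    | i + 1 => c.p₁ (i + 1) ≫ (α.f (i + 1) ≫ c'.i₁ (i + 1) - s i ≫ c'.i₂ i) +
        c.p₂ i ≫ β.f i ≫ c'.i₂ i
  have hM' : ∀ i, n < i → IsZero (M'.K.X (i + 1)) := fun i hi => M'.isZero _ (by omega)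
  have h₀ : c.i₁ 0 ≫ Φ 0 = α.f 0 ≫ c'.i₁ 0 := by
    change c.i₁ 0 ≫ c.p₁ 0 ≫ _ = _
    rw [← Category.assoc, c.i₁_p₁ 0 (by omega), Category.id_comp]
  have h₁ : ∀ i, c.i₁ (i + 1) ≫ Φ (i + 1) = α.f (i + 1) ≫ c'.i₁ (i + 1) - s i ≫ c'.i₂ i := by
    intro i
    rcases lt_trichotomy i n with hi | rfl | hi
    · simp [Φ, Preadditive.comp_add, reassoc_of% (c.i₁_p₁ (i + 1) hi), reassoc_of% (c.i₁_p₂ i)]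
    · rw [c.i₁_last, c'.i₁_last, hsn]
      simp
    · exact (hM' i hi).eq_of_tgt _ _
  have h₂ : ∀ i, c.i₂ i ≫ Φ (i + 1) = β.f i ≫ c'.i₂ i := by
    intro i
    by_cases hi : i ≤ n
    · simp [Φ, Preadditive.comp_add, reassoc_of% (c.i₂_p₁ i), reassoc_of% (c.i₂_p₂ i hi)]
    · exact (hM' i (by omega)).eq_of_tgt _ _
  have h₃ : Φ (n + 1) ≫ c'.p₂ n = c.p₂ n ≫ β.f n := by
    rw [← Category.id_comp (Φ (n + 1)), ← c.total, c.i₁_last, comp_zero, zero_add, Category.assoc,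
      Category.assoc, reassoc_of% h₂, c'.i₂_p₂ n le_rfl, Category.comp_id]
  refine ⟨{ f := Φ, comm' := ?_ }, ?_, ?_⟩
  · rintro i _ rfl
    have e₁ : (c.i₁ i ≫ Φ i) ≫ M'.K.d i (i + 1) = c.i₁ i ≫ M.K.d i (i + 1) ≫ Φ (i + 1) := by
      rw [c.i₁_d_comp, h₁, h₂]
      rcases i with _ | i
      · have e := hs.zero
        simp only [HomologicalComplex.sub_f_apply, HomologicalComplex.comp_f] at e
        rw [sub_eq_iff_eq_add] at e
        rw [h₀, Category.assoc, c'.i₁_d, ← Category.assoc (f.f 0), e]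
        simp only [Preadditive.add_comp, Preadditive.comp_add, Preadditive.comp_sub,
          Category.assoc, ← α.comm_assoc]
        abel
      · have e := hs.succ i
        simp only [HomologicalComplex.sub_f_apply, HomologicalComplex.comp_f] at e
        rw [sub_eq_iff_eq_add] at e
        rw [h₁, Preadditive.sub_comp, Category.assoc, Category.assoc, c'.i₁_d, c'.i₂_d,
          ← Category.assoc (f.f (i + 1)), e]
        simp only [Preadditive.add_comp, Preadditive.comp_add, Preadditive.comp_sub,
          Preadditive.comp_neg, Category.assoc, ← α.comm_assoc]
        abel
    rcases i with _ | i
    · exact c.ext_from_zero ((Category.assoc _ _ _).symm.trans e₁)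
    · refine c.ext_from ((Category.assoc _ _ _).symm.trans e₁) ?_
      change c.i₂ i ≫ Φ (i + 1) ≫ M'.K.d (i + 1) (i + 2) =
        c.i₂ i ≫ M.K.d (i + 1) (i + 2) ≫ Φ (i + 2)
      rw [← Category.assoc, h₂, Category.assoc, c'.i₂_d, c.i₂_d_comp,
        show c.i₂ (i + 1) ≫ Φ (i + 2) = _ from h₂ (i + 1)]
      simp
  · rw [c.left_hom, c'.left_hom]
    change (c.p₁ 0 ≫ α.f 0 ≫ c'.i₁ 0) ≫ c'.p₁ 0 ≫ X'.left.hom = _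
    rw [Category.assoc, Category.assoc, reassoc_of% (c'.i₁_p₁ 0 (by omega)), hα, Category.assoc]
  · rw [c.right_hom, c'.right_hom]
    exact h₃

/-- The image of a mapping cocone under an additive functor. -/
def map (c : CoconeData X Y f M) {𝒞' : Type u'} [Category.{v'} 𝒞'] [Preadditive 𝒞'] (F : 𝒞 ⥤ 𝒞')
    [F.Additive] :
    CoconeData (X.map F) (Y.map F) ((F.mapHomologicalComplex _).map f) (M.map F) where
  p₁ i := F.map (c.p₁ i)
  p₂ i := F.map (c.p₂ i)
  i₁ i := F.map (c.i₁ i)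
  i₂ i := F.map (c.i₂ i)
  i₁_last := (congrArg F.map c.i₁_last).trans (F.map_zero _ _)
  total_zero := by
    have := congrArg F.map c.total_zero
    rw [F.map_comp, F.map_id] at this
    exact this
  total i := by
    have := congrArg F.map (c.total i)
    rw [F.map_add, F.map_comp, F.map_comp, F.map_id] at this
    exact this
  i₁_p₁ i hi := by
    have := congrArg F.map (c.i₁_p₁ i hi)
    rw [F.map_comp, F.map_id] at this
    exact this
  i₁_p₂ i := by
    have := congrArg F.map (c.i₁_p₂ i)
    rw [F.map_comp, F.map_zero] at this
    exact this
  i₂_p₁ i := by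
    have := congrArg F.map (c.i₂_p₁ i)
    rw [F.map_comp, F.map_zero] at this
    exact this
  i₂_p₂ i hi := by
    have := congrArg F.map (c.i₂_p₂ i hi)
    rw [F.map_comp, F.map_id] at this
    exact this
  i₁_d i := by
    have := congrArg F.map (c.i₁_d i)
    rw [F.map_add, F.map_comp, F.map_comp, F.map_comp] at this
    exact this
  i₂_d i := by
    have := congrArg F.map (c.i₂_d i)
    rw [F.map_neg, F.map_comp, F.map_comp] at this
    exact this
  left_hom := (congrArg F.map c.left_hom).trans (F.map_comp _ _)
  right_hom := congrArg F.map c.right_hom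

/-- The first terms of an exact mapping cocone. -/
lemma exists_of_isNExangle (c : CoconeData X Y f M) (hn : 1 ≤ n) {E : Bifunctor.{w} 𝒞}
    {ρ : Ext E (Y.K.X n) A} (hM : M.IsNExangle E ρ) {a : A ⟶ B} {b : C ⟶ D}
    (hf : Lifts (X := X) (Y := Y) f a b) {W : 𝒞} (z : W ⟶ B) (hz : z ≫ Y.dFirst = 0) :
    ∃ h : W ⟶ A, h ≫ X.dFirst = 0 ∧ h ≫ a = z := by
  have hz' : (z ≫ Y.left.inv) ≫ Y.K.d 0 1 = 0 := (Category.assoc _ _ _).trans hz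
  obtain ⟨h, hh⟩ := hM.exact_covariant 0 hn ((z ≫ Y.left.inv) ≫ c.i₂ 0) (by
    have := c.i₂_d 0
    rw [Category.assoc, this, Preadditive.comp_neg, ← Category.assoc, hz', zero_comp, neg_zero])
  replace hh := (c.comp_d_zero h).symm.trans hh
  have e₁ := congrArg (· ≫ c.p₁ 1) hh
  have e₂ := congrArg (· ≫ c.p₂ 0) hh
  simp only [Preadditive.add_comp, Category.assoc, c.i₁_p₁ 1 hn, c.i₂_p₁ 0, comp_zero, add_zero,
    Category.comp_id] at e₁
  have e₃ := c.i₁_p₂ 0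
  simp only [Preadditive.add_comp, Category.assoc, c.i₂_p₂ 0 (by omega),
    Category.comp_id] at e₂
  rw [e₃, comp_zero, comp_zero, comp_zero, zero_add] at e₂
  refine ⟨(h ≫ c.p₁ 0) ≫ X.left.hom, ?_, ?_⟩
  · simp [dFirst, e₁]
  · rw [Category.assoc, ← hf.1, Category.assoc, reassoc_of% e₂, Iso.inv_hom_id, Category.comp_id]

/-- A mapping cocone of a morphism of `n`-exangles is an `n`-exangle, if it is comparable with one
and if its first term `A ⟶ X₁ ⊞ B` has the property of a weak pullback (`hc`). -/
lemma isNExangle {A B C : 𝒞} {X : NComplex n A C} {Y : NComplex n B C} {f : X.K ⟶ Y.K}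
    {M : NComplex n A (Y.K.X n)} (c : CoconeData X Y f M) {E : Bifunctor.{w} 𝒞} {δ : Ext E C A}
    {a : A ⟶ B} (hX : X.IsNExangle E δ) (hY : Y.IsNExangle E (push E a δ))
    (hf : Lifts (X := X) (Y := Y) f a (𝟙 C)) {ρ : Ext E (Y.K.X n) A}
    {N : NComplex n A (Y.K.X n)} (hN : N.IsNExangle E ρ) {u : N.K ⟶ M.K} {v : M.K ⟶ N.K}
    (hu : Lifts (X := N) (Y := M) u (𝟙 A) (𝟙 _)) (hv : Lifts (X := M) (Y := N) v (𝟙 A) (𝟙 _))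
    (hc : ∀ {W : 𝒞} (z : W ⟶ B), z ≫ Y.dFirst = 0 →
      ∃ h : W ⟶ A, h ≫ X.dFirst = 0 ∧ h ≫ a = z) : M.IsNExangle E ρ := by
  obtain ⟨r, hfr⟩ : ∃ r, f.f (n + 1) ≫ r = 𝟙 _ := by
    refine ⟨Y.right.hom ≫ X.right.inv, ?_⟩
    rw [← Category.assoc, hf.2]
    simp
  refine ⟨?_, ?_, fun i hi W g hg => ?_, fun g hg => ?_, fun i hi W g hg => ?_, fun g hg => ?_⟩
  · have := hu.dFirst
    rw [Category.id_comp] at this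
    rw [← this, push_comp, hN.push_eq_zero, map_zero]
  · have := hv.dLast
    rw [Category.comp_id] at this
    rw [← this, pull_comp, hN.pull_eq_zero, map_zero]
  · have hd := (c.comp_d_succ g).symm.trans hg
    have hy : (g ≫ c.p₁ (i + 1)) ≫ f.f (i + 1) = (g ≫ c.p₂ i) ≫ Y.K.d i (i + 1) := by
      have := congrArg (· ≫ c.p₂ (i + 1)) hd
      simp only [Preadditive.add_comp, Category.assoc, c.i₂_p₂ (i + 1) hi, zero_comp] at this
      rw [show c.i₁ (i + 2) ≫ c.p₂ (i + 1) = 0 from c.i₁_p₂ (i + 1)] at this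
      simp only [comp_zero, zero_add, Category.comp_id, sub_eq_zero] at this
      simpa only [Category.assoc] using this
    have hx : (g ≫ c.p₁ (i + 1)) ≫ X.K.d (i + 1) (i + 2) = 0 := by
      by_cases hin : i + 2 ≤ n
      · have := congrArg (· ≫ c.p₁ (i + 2)) hd
        simp only [Preadditive.add_comp, Category.assoc, c.i₁_p₁ (i + 2) hin, zero_comp] at this
        rw [show c.i₂ (i + 1) ≫ c.p₁ (i + 2) = 0 from c.i₂_p₁ (i + 1)] at this
        simp only [comp_zero, add_zero, Category.comp_id] at this
        simpa only [Category.assoc] using this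
      · obtain rfl : n = i + 1 := by omega
        have e : X.K.d (i + 1) (i + 2) = f.f (i + 1) ≫ Y.K.d (i + 1) (i + 2) ≫ r := by
          rw [← Category.assoc, f.comm, Category.assoc]
          exact ((congrArg (_ ≫ ·) hfr).trans (Category.comp_id _)).symm
        rw [e, ← Category.assoc, hy, Category.assoc, ← Category.assoc (Y.K.d i _), Y.K.d_comp_d,
          zero_comp, comp_zero]
    obtain ⟨x, hx'⟩ := hX.exact_covariant i hi _ hx
    have hxy : (g ≫ c.p₂ i - x ≫ f.f i) ≫ Y.K.d i (i + 1) = 0 := by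
      rw [Preadditive.sub_comp, Category.assoc x, f.comm, ← Category.assoc x, hx', hy, sub_self]
    rcases i with _ | i
    · obtain ⟨h, h₁, h₂⟩ := hc ((g ≫ c.p₂ 0 - x ≫ f.f 0) ≫ Y.left.hom) (by
        rw [dFirst, Category.assoc, Iso.hom_inv_id_assoc]
        exact hxy)
      have h₁' : (h ≫ X.left.inv) ≫ X.K.d 0 1 = 0 := (Category.assoc _ _ _).trans h₁
      have h₂' : (h ≫ X.left.inv) ≫ f.f 0 = g ≫ c.p₂ 0 - x ≫ f.f 0 := by
        rw [← cancel_mono Y.left.hom, Category.assoc, Category.assoc, hf.1,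
          Iso.inv_hom_id_assoc, h₂]
      have k₁ : ((x + h ≫ X.left.inv) ≫ c.i₁ 0) ≫ c.p₁ 0 = x + h ≫ X.left.inv := by
        rw [Category.assoc, c.i₁_p₁ 0 (by omega), Category.comp_id]
      refine ⟨(x + h ≫ X.left.inv) ≫ c.i₁ 0, ?_⟩
      have k₂ : (x + h ≫ X.left.inv) ≫ X.K.d 0 1 = g ≫ c.p₁ 1 := by
        rw [Preadditive.add_comp, h₁', hx', add_zero]
      have k₃ : (x + h ≫ X.left.inv) ≫ f.f 0 = g ≫ c.p₂ 0 := by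
        rw [Preadditive.add_comp, h₂', add_sub_cancel]
      rw [c.comp_d_zero, k₁, k₂, k₃]
      conv_rhs => rw [← Category.comp_id g, ← c.total, Preadditive.comp_add]
      simp
    · obtain ⟨y, hy'⟩ := hY.exact_covariant i (by omega) _ hxy
      have k₁ : (x ≫ c.i₁ (i + 1) - y ≫ c.i₂ i) ≫ c.p₁ (i + 1) = x := by
        rw [Preadditive.sub_comp, Category.assoc, Category.assoc, c.i₁_p₁ (i + 1) (by omega),
          c.i₂_p₁, comp_zero, sub_zero, Category.comp_id]
      have k₂ : (x ≫ c.i₁ (i + 1) - y ≫ c.i₂ i) ≫ c.p₂ i = -y := by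
        rw [Preadditive.sub_comp, Category.assoc, Category.assoc, c.i₂_p₂ i (by omega),
          c.i₁_p₂, comp_zero, zero_sub, Category.comp_id]
      refine ⟨x ≫ c.i₁ (i + 1) - y ≫ c.i₂ i, (c.comp_d_succ _).trans ?_⟩
      rw [k₁, k₂, Preadditive.neg_comp, hy', hx', sub_neg_eq_add, add_sub_cancel]
      conv_rhs => rw [← Category.comp_id g, ← c.total, Preadditive.comp_add]
      simp
  · obtain ⟨h, hh⟩ := hN.exact_covariant_last g hg
    have := hu.dLast
    rw [Category.comp_id] at this
    exact ⟨h ≫ u.f n, by rw [Category.assoc, this, hh]⟩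
  · have hxy : X.K.d i (i + 1) ≫ c.i₁ (i + 1) ≫ g = -(f.f i ≫ c.i₂ i ≫ g) := by
      have := c.i₁_d_comp g
      rw [hg, comp_zero] at this
      exact eq_neg_of_add_eq_zero_left this.symm
    obtain ⟨y, hy⟩ : ∃ y : Y.K.X (i + 1) ⟶ W, Y.K.d i (i + 1) ≫ y = c.i₂ i ≫ g := by
      rcases i with _ | i
      · obtain ⟨y, hy⟩ := hY.exact_contravariant_last (Y.left.inv ≫ c.i₂ 0 ≫ g) (by
          have : a ≫ Y.left.inv ≫ c.i₂ 0 ≫ g = X.dFirst ≫ (-(c.i₁ 1 ≫ g)) := by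
            have e : a ≫ Y.left.inv = X.left.inv ≫ f.f 0 := by
              rw [← cancel_mono Y.left.hom, Category.assoc, Category.assoc, hf.1]
              simp
            rw [reassoc_of% e, dFirst, Category.assoc, Preadditive.comp_neg, hxy, neg_neg]
          rw [← push_comp, this, push_comp, hX.push_eq_zero, map_zero])
        refine ⟨y, ?_⟩
        rw [← cancel_epi Y.left.inv, ← hy, dFirst, Category.assoc]
      · refine hY.exact_contravariant i (by omega) _ ?_
        have := c.i₂_d_comp g
        rw [hg, comp_zero] at this
        exact neg_eq_zero.mp this.symm
    obtain ⟨x, hx⟩ := hX.exact_contravariant i hi (c.i₁ (i + 1) ≫ g + f.f (i + 1) ≫ y) (by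
      rw [Preadditive.comp_add, hxy, ← Category.assoc (X.K.d _ _), ← f.comm, Category.assoc, hy,
        neg_add_cancel])
    -- In degree `n + 1` there is no first summand, and `x` is absorbed into `y`.
    obtain ⟨x', y', h₁, h₂, h₃⟩ : ∃ (x' : X.K.X (i + 2) ⟶ W) (y' : Y.K.X (i + 1) ⟶ W),
        X.K.d (i + 1) (i + 2) ≫ x' = c.i₁ (i + 1) ≫ g + f.f (i + 1) ≫ y' ∧
        Y.K.d i (i + 1) ≫ y' = c.i₂ i ≫ g ∧ c.i₁ (i + 2) ≫ c.p₁ (i + 2) ≫ x' = x' := by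
      by_cases hin : i + 2 ≤ n
      · exact ⟨x, y, hx, hy, by rw [reassoc_of% (c.i₁_p₁ (i + 2) hin)]⟩
      · obtain rfl : n = i + 1 := by omega
        have hfr' : f.f (i + 2) ≫ r ≫ x = x :=
          (Category.assoc _ _ _).symm.trans ((congrArg (· ≫ x) hfr).trans (Category.id_comp x))
        refine ⟨0, y - Y.K.d (i + 1) (i + 2) ≫ r ≫ x, ?_, ?_, by simp⟩
        · rw [Preadditive.comp_sub, ← Category.assoc (f.f _), f.comm, Category.assoc, hfr', hx]
          simp
        · rw [Preadditive.comp_sub, ← Category.assoc, Y.K.d_comp_d, zero_comp, sub_zero, hy]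
    have k₁ : c.i₁ (i + 2) ≫ (c.p₁ (i + 2) ≫ x' - c.p₂ (i + 1) ≫ y') = x' := by
      rw [Preadditive.comp_sub, h₃, ← Category.assoc,
        show c.i₁ (i + 2) ≫ c.p₂ (i + 1) = 0 from c.i₁_p₂ (i + 1), zero_comp, sub_zero]
    have k₂ : c.i₂ (i + 1) ≫ (c.p₁ (i + 2) ≫ x' - c.p₂ (i + 1) ≫ y') = -y' := by
      rw [Preadditive.comp_sub, reassoc_of% (c.i₂_p₂ (i + 1) hi), ← Category.assoc,
        show c.i₂ (i + 1) ≫ c.p₁ (i + 2) = 0 from c.i₂_p₁ (i + 1), zero_comp, zero_sub]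
    refine ⟨c.p₁ (i + 2) ≫ x' - c.p₂ (i + 1) ≫ y', c.ext_from ?_ ?_⟩
    · rw [c.i₁_d_comp (i := i + 1)]
      refine (congrArg₂ (· + ·) (congrArg (_ ≫ ·) k₁) (congrArg (_ ≫ ·) k₂)).trans ?_
      change X.K.d (i + 1) (i + 2) ≫ x' + f.f (i + 1) ≫ (-y') = _
      rw [h₁, Preadditive.comp_neg, add_neg_cancel_right]
    · rw [c.i₂_d_comp, k₂, Preadditive.comp_neg, neg_neg, h₂]
  · obtain ⟨h, hh⟩ := hN.exact_contravariant_last g hg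
    have := hv.dFirst
    rw [Category.id_comp] at this
    exact ⟨v.f 1 ≫ h, by rw [← Category.assoc, this, hh]⟩

/-- The canonical isomorphism `Mᵢ₊₁ ≅ Xᵢ₊₁ ⊞ Yᵢ`, for `i < n`. -/
noncomputable def iso [HasBinaryBiproducts 𝒞] (c : CoconeData X Y f M) (i j : ℕ) (hij : i + 1 = j)
    (hj : j ≤ n) : M.K.X j ≅ X.K.X j ⊞ Y.K.X i := by
  subst hij
  exact
  { hom := biprod.lift (c.p₁ (i + 1)) (c.p₂ i)
    inv := biprod.desc (c.i₁ (i + 1)) (c.i₂ i)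
    hom_inv_id := by rw [biprod.lift_desc, c.total]
    inv_hom_id := by
      ext <;> simp [c.i₁_p₁ (i + 1) hj, c.i₁_p₂, c.i₂_p₁, c.i₂_p₂ i (by omega)] }

lemma isMappingCocone [HasBinaryBiproducts 𝒞] {Y : NComplex n B C} {f : X.K ⟶ Y.K}
    {M : NComplex n A (Y.K.X n)} (c : CoconeData X Y f M) : IsMappingCocone f M := by
  refine ⟨fun i j hij hj => c.iso i j hij hj, fun h => ?_, fun i j k h₁ h₂ h₃ => ?_,
    fun i h => ?_⟩
  · have e : M.left.inv = X.left.inv ≫ c.i₁ 0 := by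
      rw [← cancel_epi M.left.hom, Iso.hom_inv_id, c.left_hom, Category.assoc,
        Iso.hom_inv_id_assoc, c.total_zero]
    have e₁ := c.i₁_p₁ 1 h
    have e₂ := c.i₁_p₂ 0
    have e₃ := c.i₂_p₁ 0
    ext
    · simp [iso, dFirst, e, c.i₁_d_comp, e₁, e₃]
    · simp [iso, dFirst, e, c.i₁_d_comp, e₂, c.i₂_p₂ 0 (by omega)]
  · subst h₁ h₂
    have e₁ := c.i₁_d_comp (c.p₁ (i + 1 + 1))
    have e₂ := c.i₁_d_comp (c.p₂ (i + 1))
    have e₃ := c.i₂_d_comp (c.p₁ (i + 1 + 1))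
    have e₄ := c.i₂_d_comp (c.p₂ (i + 1))
    rw [c.i₁_p₁ _ h₃, c.i₂_p₁, comp_zero, add_zero, Category.comp_id] at e₁
    rw [c.i₂_p₂ (i + 1) (by omega), c.i₁_p₂, comp_zero, zero_add, Category.comp_id] at e₂
    rw [c.i₂_p₁, comp_zero, neg_zero] at e₃
    rw [c.i₂_p₂ (i + 1) (by omega), Category.comp_id] at e₄
    ext
    · simpa [iso] using e₁
    · simpa [iso] using e₂
    · simpa [iso] using e₃
    · simpa [iso] using e₄
  · subst h
    have e₁ := c.i₁_d_comp (c.p₂ (i + 1))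
    have e₂ := c.i₂_d_comp (c.p₂ (i + 1))
    rw [c.i₂_p₂ (i + 1) le_rfl, c.i₁_p₂, comp_zero, zero_add, Category.comp_id] at e₁
    rw [c.i₂_p₂ (i + 1) le_rfl, Category.comp_id] at e₂
    ext
    · simpa [iso, dLast, c.right_hom] using e₁
    · simpa [iso, dLast, c.right_hom] using e₂

end CoconeData

end NComplex

end Cocones

section ExistenceOfCocones

variable {n : ℕ} {𝒞 : Type u} [Category.{v} 𝒞] [Preadditive 𝒞] [HasBinaryBiproducts 𝒞]

namespace NComplex

open Classical in
/-- Conversely to `CoconeData.isMappingCocone`, the isomorphisms `Mᵢ₊₁ ≅ Xᵢ₊₁ ⊞ Yᵢ` for `i < n` that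
exhibit a mapping cocone extend to a presentation in all degrees. -/
lemma IsMappingCocone.nonempty_coconeData (hn : 1 ≤ n) {A B C : 𝒞} {X : NComplex n A C}
    {Y : NComplex n B C} {f : X.K ⟶ Y.K} {M : NComplex n A (Y.K.X n)} (h : IsMappingCocone f M) :
    Nonempty (CoconeData X Y f M) := by
  obtain ⟨φ, h₁, h₂, h₃⟩ := h
  obtain ⟨ψ, hψ⟩ : ∃ ψ : ∀ i, M.K.X (i + 1) ⟶ Y.K.X i, ψ n = M.right.hom :=
    ⟨fun i => if h : i = n then by subst h; exact M.right.hom else 0, dif_pos rfl⟩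
  obtain ⟨ψ', hψ'⟩ : ∃ ψ' : ∀ i, Y.K.X i ⟶ M.K.X (i + 1), ψ' n = M.right.inv :=
    ⟨fun i => if h : i = n then by subst h; exact M.right.inv else 0, dif_pos rfl⟩
  let p₁ : ∀ i, M.K.X i ⟶ X.K.X i := fun
    | 0 => M.left.hom ≫ X.left.inv
    | i + 1 => if h : i + 1 ≤ n then (φ i (i + 1) rfl h).hom ≫ biprod.fst else 0
  let p₂ : ∀ i, M.K.X (i + 1) ⟶ Y.K.X i := fun i =>
    if h : i + 1 ≤ n then (φ i (i + 1) rfl h).hom ≫ biprod.snd else ψ i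
  let i₁ : ∀ i, X.K.X i ⟶ M.K.X i := fun
    | 0 => X.left.hom ≫ M.left.inv
    | i + 1 => if h : i + 1 ≤ n then biprod.inl ≫ (φ i (i + 1) rfl h).inv else 0
  let i₂ : ∀ i, Y.K.X i ⟶ M.K.X (i + 1) := fun i =>
    if h : i + 1 ≤ n then biprod.inr ≫ (φ i (i + 1) rfl h).inv else ψ' i
  have p₁_le : ∀ i (h : i + 1 ≤ n), p₁ (i + 1) = (φ i (i + 1) rfl h).hom ≫ biprod.fst :=
    fun i h => dif_pos h
  have p₂_le : ∀ i (h : i + 1 ≤ n), p₂ i = (φ i (i + 1) rfl h).hom ≫ biprod.snd :=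
    fun i h => dif_pos h
  have i₁_le : ∀ i (h : i + 1 ≤ n), i₁ (i + 1) = biprod.inl ≫ (φ i (i + 1) rfl h).inv :=
    fun i h => dif_pos h
  have i₂_le : ∀ i (h : i + 1 ≤ n), i₂ i = biprod.inr ≫ (φ i (i + 1) rfl h).inv :=
    fun i h => dif_pos h
  have p₁_gt : ∀ i, ¬ i + 1 ≤ n → p₁ (i + 1) = 0 := fun i h => dif_neg h
  have i₁_gt : ∀ i, ¬ i + 1 ≤ n → i₁ (i + 1) = 0 := fun i h => dif_neg h
  have p₂_n : p₂ n = M.right.hom := (dif_neg (by omega)).trans hψ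
  have i₂_n : i₂ n = M.right.inv := (dif_neg (by omega)).trans hψ'
  have hM : ∀ i, n < i → IsZero (M.K.X (i + 1)) := fun i h => M.isZero _ (by omega)
  refine ⟨{ p₁ := p₁, p₂ := p₂, i₁ := i₁, i₂ := i₂, i₁_last := i₁_gt n (by omega),
            total_zero := by simp [p₁, i₁], total := ?_, i₁_p₁ := ?_,
            i₁_p₂ := ?_, i₂_p₁ := ?_, i₂_p₂ := ?_, i₁_d := ?_, i₂_d := ?_,
            left_hom := by simp [p₁], right_hom := p₂_n.symm }⟩
  · intro i
    rcases lt_trichotomy i n with h | rfl | h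
    · rw [p₁_le i h, p₂_le i h, i₁_le i h, i₂_le i h, Category.assoc, Category.assoc,
        ← Category.assoc biprod.fst, ← Category.assoc biprod.snd, ← Preadditive.comp_add,
        ← Preadditive.add_comp, biprod.total, Category.id_comp, Iso.hom_inv_id]
    · rw [p₁_gt i (by omega), p₂_n, i₂_n, zero_comp, zero_add, Iso.hom_inv_id]
    · exact (hM i h).eq_of_tgt _ _
  · rintro (_ | i) h
    · simp [p₁, i₁]
    · simp [p₁_le i h, i₁_le i h]
  · intro i
    by_cases h : i + 1 ≤ n
    · simp [p₂_le i h, i₁_le i h]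
    · rw [i₁_gt i h, zero_comp]
  · intro i
    by_cases h : i + 1 ≤ n
    · simp [p₁_le i h, i₂_le i h]
    · rw [p₁_gt i h, comp_zero]
  · intro i hi
    rcases hi.lt_or_eq with h | rfl
    · simp [p₂_le i h, i₂_le i h]
    · rw [p₂_n, i₂_n, Iso.inv_hom_id]
  · rintro (_ | i)
    · have e := congrArg (X.left.hom ≫ · ≫ (φ 0 1 rfl hn).inv) (h₁ hn)
      simp only [dFirst, Category.assoc, Iso.hom_inv_id, Category.comp_id] at e
      rw [i₁_le 0 hn, i₂_le 0 hn]
      refine (Category.assoc _ _ _).trans (e.trans ?_)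
      rw [← cancel_mono (φ 0 1 rfl hn).hom]
      ext <;> simp
    rcases lt_trichotomy (i + 1) n with h | rfl | h
    · have e := congrArg (biprod.inl ≫ · ≫ (φ (i + 1) (i + 2) rfl h).inv)
        (h₂ i (i + 1) (i + 2) rfl rfl h)
      simp only [Category.assoc, Iso.hom_inv_id, Category.comp_id] at e
      rw [i₁_le (i + 1) h, i₁_le i (by omega), i₂_le (i + 1) h, Category.assoc]
      refine e.trans ?_
      rw [← cancel_mono (φ (i + 1) (i + 2) rfl h).hom]
      ext <;> simp
    · have e := congrArg (biprod.inl ≫ · ≫ M.right.inv) (h₃ i rfl)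
      simp only [dLast, Category.assoc, Iso.hom_inv_id, Category.comp_id] at e
      rw [i₁_gt (i + 1) (by omega), i₁_le i le_rfl, i₂_n, Category.assoc, comp_zero, zero_add]
      refine e.trans ?_
      simp
    · exact (hM (i + 1) h).eq_of_tgt _ _
  · intro i
    rcases lt_trichotomy (i + 1) n with h | rfl | h
    · have e := congrArg (biprod.inr ≫ · ≫ (φ (i + 1) (i + 2) rfl h).inv)
        (h₂ i (i + 1) (i + 2) rfl rfl h)
      simp only [Category.assoc, Iso.hom_inv_id, Category.comp_id] at e
      rw [i₂_le (i + 1) h, i₂_le i (by omega), Category.assoc]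
      refine e.trans ?_
      rw [← cancel_mono (φ (i + 1) (i + 2) rfl h).hom]
      ext <;> simp
    · have e := congrArg (biprod.inr ≫ · ≫ M.right.inv) (h₃ i rfl)
      simp only [dLast, Category.assoc, Iso.hom_inv_id, Category.comp_id] at e
      rw [i₂_le i le_rfl, i₂_n, Category.assoc]
      refine e.trans ?_
      simp
    · exact (hM (i + 1) h).eq_of_tgt _ _

/-- Mapping cocones exist. -/
lemma exists_coconeData [HasZeroObject 𝒞] (hn : 1 ≤ n) {A B C D : 𝒞} (X : NComplex n A C)
    (Y : NComplex n B D) (f : X.K ⟶ Y.K) :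
    ∃ M : NComplex n A (Y.K.X n), Nonempty (CoconeData X Y f M) := by
  obtain ⟨Z, hZ⟩ := HasZeroObject.zero (C := 𝒞)
  -- The summands `Xᵢ` and `Yᵢ` are to be dropped for `i > n`.
  have trunc : ∀ K : CochainComplex 𝒞 ℕ, ∃ (O : ℕ → 𝒞) (q : ∀ i, K.X i ⟶ O i)
      (r : ∀ i, O i ⟶ K.X i), (∀ i, r i ≫ q i = 𝟙 _) ∧ (∀ i, i ≤ n → q i ≫ r i = 𝟙 _) ∧
      ∀ i, n < i → IsZero (O i) := fun K => by
    have : ∀ i, ∃ (O : 𝒞) (q : K.X i ⟶ O) (r : O ⟶ K.X i), r ≫ q = 𝟙 _ ∧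
        (i ≤ n → q ≫ r = 𝟙 _) ∧ (n < i → IsZero O) := fun i => by
      by_cases hi : i ≤ n
      · exact ⟨K.X i, 𝟙 _, 𝟙 _, by simp, by simp, fun h => by omega⟩
      · exact ⟨Z, 0, 0, hZ.eq_of_src _ _, fun h => (hi h).elim, fun _ => hZ⟩
    choose O q r h₁ h₂ h₃ using this
    exact ⟨O, q, r, h₁, h₂, h₃⟩
  obtain ⟨O, q, r, hrq, hqr, hO⟩ := trunc X.K
  obtain ⟨P, q', r', hrq', hqr', hP⟩ := trunc Y.K
  let T : ℕ → 𝒞 := fun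
    | 0 => X.K.X 0
    | i + 1 => O (i + 1) ⊞ P i
  let d : ∀ i, T i ⟶ T (i + 1) := fun
    | 0 => (biprod.lift (X.K.d 0 1 ≫ q 1) (f.f 0 ≫ q' 0) : X.K.X 0 ⟶ O 1 ⊞ P 0)
    | i + 1 => (biprod.desc
        (biprod.lift (r (i + 1) ≫ X.K.d (i + 1) (i + 2) ≫ q (i + 2))
          (r (i + 1) ≫ f.f (i + 1) ≫ q' (i + 1)))
        (biprod.lift 0 (-(r' i ≫ Y.K.d i (i + 1) ≫ q' (i + 1)))) :
        O (i + 1) ⊞ P i ⟶ O (i + 2) ⊞ P (i + 1))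
  have hT : ∀ i, n < i → IsZero (O (i + 1) ⊞ P i) := fun i hi => by
    rw [IsZero.iff_id_eq_zero]
    exact biprod.hom_ext _ _ ((hO _ (by omega)).eq_of_tgt _ _) ((hP _ hi).eq_of_tgt _ _)
  have sq : ∀ i, d i ≫ d (i + 1) = 0 := by
    rintro (_ | i)
    · change biprod.lift _ _ ≫ biprod.desc _ _ = (0 : X.K.X 0 ⟶ O 2 ⊞ P 1)
      ext
      · simp [reassoc_of% (hqr 1 hn)]
      · simp [reassoc_of% (hqr 1 hn), reassoc_of% (hqr' 0 (by omega))]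
    · by_cases hi : i + 2 ≤ n
      · have e₁ := hqr (i + 2) hi
        have e₂ := hqr' (i + 1) (by omega)
        change biprod.desc _ _ ≫ biprod.desc _ _ =
          (0 : O (i + 1) ⊞ P i ⟶ O (i + 3) ⊞ P (i + 2))
        ext
        · simp [reassoc_of% e₁]
        · simp [reassoc_of% e₁, reassoc_of% e₂]
        · simp
        · simp [reassoc_of% e₂]
      · exact (hT (i + 2) (by omega)).eq_of_tgt _ _
  let K : CochainComplex 𝒞 ℕ := CochainComplex.of T d sq
  have hd : ∀ i, K.d i (i + 1) = d i := fun i => CochainComplex.of_d _ _ i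
  refine ⟨{ K := K
            isZero := ?_
            left := (Iso.refl (X.K.X 0) : X.K.X 0 ≅ X.K.X 0) ≪≫ X.left
            right := (⟨biprod.snd ≫ r' n, q' n ≫ biprod.inr, ?_, ?_⟩ :
              O (n + 1) ⊞ P n ≅ Y.K.X n) }, ⟨{
            p₁ := fun
              | 0 => 𝟙 (X.K.X 0)
              | i + 1 => (biprod.fst ≫ r (i + 1) : O (i + 1) ⊞ P i ⟶ X.K.X (i + 1))
            p₂ := fun i => (biprod.snd ≫ r' i : O (i + 1) ⊞ P i ⟶ Y.K.X i)
            i₁ := fun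
              | 0 => 𝟙 (X.K.X 0)
              | i + 1 => (q (i + 1) ≫ biprod.inl : X.K.X (i + 1) ⟶ O (i + 1) ⊞ P i)
            i₂ := fun i => (q' i ≫ biprod.inr : Y.K.X i ⟶ O (i + 1) ⊞ P i)
            i₁_last := ?_
            total_zero := Category.id_comp (𝟙 (X.K.X 0))
            total := ?_
            i₁_p₁ := ?_
            i₁_p₂ := ?_
            i₂_p₁ := ?_
            i₂_p₂ := ?_
            i₁_d := ?_
            i₂_d := ?_
            left_hom := rfl
            right_hom := rfl }⟩⟩
  · rintro (_ | i) hi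
    · omega
    · exact hT i (by omega)
  · refine biprod.hom_ext _ _ ((hO _ (by omega)).eq_of_tgt _ _) ?_
    simp [reassoc_of% (hrq' n)]
  · simp [hqr' n le_rfl]
  · change q (n + 1) ≫ biprod.inl = (0 : _ ⟶ O (n + 1) ⊞ P n)
    rw [(hO (n + 1) (by omega)).eq_of_tgt (q (n + 1)) 0, zero_comp]
  · intro i
    change (biprod.fst ≫ r (i + 1)) ≫ q (i + 1) ≫ biprod.inl +
      (biprod.snd ≫ r' i) ≫ q' i ≫ biprod.inr = 𝟙 (O (i + 1) ⊞ P i)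
    simp [reassoc_of% (hrq (i + 1)), reassoc_of% (hrq' i), biprod.total]
  · rintro (_ | i) hi
    · exact Category.id_comp (𝟙 (X.K.X 0))
    · change (q (i + 1) ≫ biprod.inl) ≫ biprod.fst ≫ r (i + 1) = 𝟙 _
      simp [hqr (i + 1) hi]
  · intro i
    change (q (i + 1) ≫ biprod.inl) ≫ biprod.snd ≫ r' i = 0
    simp
  · intro i
    change (q' i ≫ biprod.inr) ≫ biprod.fst ≫ r (i + 1) = 0
    simp
  · intro i hi
    change (q' i ≫ biprod.inr) ≫ biprod.snd ≫ r' i = 𝟙 _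
    simp [hqr' i hi]
  · intro i
    refine (congrArg (_ ≫ ·) (hd i)).trans ?_
    rcases i with _ | i
    · change 𝟙 (X.K.X 0) ≫ biprod.lift _ _ = X.K.d 0 1 ≫ q 1 ≫ biprod.inl +
        f.f 0 ≫ q' 0 ≫ biprod.inr
      ext <;> simp
    · by_cases hi : i + 1 ≤ n
      · change (q (i + 1) ≫ biprod.inl) ≫ biprod.desc _ _ =
          X.K.d (i + 1) (i + 2) ≫ q (i + 2) ≫ biprod.inl + f.f (i + 1) ≫ q' (i + 1) ≫ biprod.inr
        ext <;> simp [reassoc_of% (hqr (i + 1) hi)]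
      · exact (hT (i + 1) (by omega)).eq_of_tgt _ _
  · intro i
    refine (congrArg (_ ≫ ·) (hd (i + 1))).trans ?_
    by_cases hi : i ≤ n
    · change (q' i ≫ biprod.inr) ≫ biprod.desc _ _ =
        -(Y.K.d i (i + 1) ≫ q' (i + 1) ≫ biprod.inr)
      ext <;> simp [reassoc_of% (hqr' i hi)]
    · exact (hT (i + 1) (by omega)).eq_of_tgt _ _

end NComplex

end ExistenceOfCocones

section CoconeOfRetract

attribute [local instance] hasBinaryBiproducts_of_finite_biproducts

variable {n : ℕ} {𝒞 : Type u} [Category.{v} 𝒞] [Preadditive 𝒞] [HasFiniteBiproducts 𝒞]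

/-- The existence of good lifts, whose mapping cocones are realisations, passes to retracts. -/
theorem ExtData.IsRealisation.exists_cocone_of_retract {S : ExtData.{w} n 𝒞}
    (hS : S.IsRealisation) (hE : IsBiadditive S.E) (hn : 1 ≤ n)
    {A₀ B₀ C₀ : 𝒞} {δ₀ : Ext S.E C₀ A₀} {a₀ : A₀ ⟶ B₀}
    {X₀ : NComplex n A₀ C₀} (hX₀ : X₀ ∈ S.s δ₀)
    {Y₀ : NComplex n B₀ C₀} (hY₀ : Y₀ ∈ S.s (push S.E a₀ δ₀))
    {f₀ : X₀.K ⟶ Y₀.K} (hf₀ : NComplex.Lifts (X := X₀) (Y := Y₀) f₀ a₀ (𝟙 C₀))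
    {M₀ : NComplex n A₀ (Y₀.K.X n)} (hM₀ : M₀ ∈ S.s (pull S.E Y₀.dLast δ₀))
    (m₀ : NComplex.CoconeData X₀ Y₀ f₀ M₀)
    {A B C : 𝒞} {δ : Ext S.E C A} {a : A ⟶ B}
    {X : NComplex n A C} (hX : X ∈ S.s δ) {Y : NComplex n B C} (hY : Y ∈ S.s (push S.E a δ))
    {k : A ⟶ A₀} {k' : A₀ ⟶ A} {l : B ⟶ B₀} {l' : B₀ ⟶ B} {c : C ⟶ C₀} {c' : C₀ ⟶ C}
    (hk : k ≫ k' = 𝟙 A) (hl : l ≫ l' = 𝟙 B) (hc : c ≫ c' = 𝟙 C)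
    {iX : X.K ⟶ X₀.K} (hiX : NComplex.Lifts (X := X) (Y := X₀) iX k c)
    {pX : X₀.K ⟶ X.K} (hpX : NComplex.Lifts (X := X₀) (Y := X) pX k' c')
    {sX : ∀ i, X.K.X (i + 1) ⟶ X.K.X i} (hsX : NullHtpy (𝟙 X.K - iX ≫ pX) sX)
    {iY : Y.K ⟶ Y₀.K} (hiY : NComplex.Lifts (X := Y) (Y := Y₀) iY l c)
    {pY : Y₀.K ⟶ Y.K} (hpY : NComplex.Lifts (X := Y₀) (Y := Y) pY l' c')
    {sY : ∀ i, Y.K.X (i + 1) ⟶ Y.K.X i} (hsY : NullHtpy (𝟙 Y.K - iY ≫ pY) sY)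
    (ha : a ≫ l = k ≫ a₀) (ha' : a₀ ≫ l' = k' ≫ a)
    (h₁ : push S.E k δ = pull S.E c δ₀) (h₂ : push S.E k' δ₀ = pull S.E c' δ)
    (hδ₀ : pull S.E (c' ≫ c) δ₀ = δ₀) :
    ∃ f : X.K ⟶ Y.K, NComplex.Lifts (X := X) (Y := Y) f a (𝟙 C) ∧
      ∃ M ∈ S.s (pull S.E Y.dLast δ), NComplex.IsMappingCocone (X := X) (Y := Y) f M := by
  have eX₀ := hS.isNExangle _ X₀ hX₀
  have eY₀ := hS.isNExangle _ Y₀ hY₀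
  have eX := hS.isNExangle _ X hX
  have eY := hS.isNExangle _ Y hY
  have hδ₀' : push S.E (k' ≫ k) δ₀ = δ₀ := by
    rw [push_comp, h₂, push_pull, h₁, ← pull_comp, hδ₀]
  have rX : NullRight n (𝟙 X.K - iX ≫ pX) := eX.nullRight_of_nullHtpy hn
    ((NComplex.Lifts.id.sub (hiX.comp hpX)).of_eq rfl (by rw [hc, sub_self])).f_last hsX
  have rY : NullRight n (𝟙 Y.K - iY ≫ pY) := eY.nullRight_of_nullHtpy hn
    ((NComplex.Lifts.id.sub (hiY.comp hpY)).of_eq rfl (by rw [hc, sub_self])).f_last hsY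
  have hf : NComplex.Lifts (X := X) (Y := Y) (iX ≫ f₀ ≫ pY) a (𝟙 C) :=
    (hiX.comp (hf₀.comp hpY)).of_eq (by rw [ha', reassoc_of% hk])
      (by rw [Category.id_comp, hc])
  obtain ⟨M, ⟨m⟩⟩ := NComplex.exists_coconeData hn X Y (iX ≫ f₀ ≫ pY)
  -- The morphisms of mapping cocones induced by `pX`, `pY` and by `iX`, `iY`.
  obtain ⟨Φ, hΦ⟩ := m₀.exists_hom m pX pY (a := k') (by
    obtain ⟨τ, hτ⟩ := eX₀.exact_contravariant_last (𝟙 _ - k' ≫ k) (by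
      rw [hE.push_sub, push_id, hδ₀', sub_self])
    have e : f₀ ≫ pY - pX ≫ iX ≫ f₀ ≫ pY = (𝟙 X₀.K - pX ≫ iX) ≫ f₀ ≫ pY := by
      rw [Preadditive.sub_comp, Category.id_comp, Category.assoc]
    have hL := (NComplex.Lifts.id.sub (hpX.comp hiX)).comp (hf₀.comp hpY)
    rw [e]
    refine eY.nullRight_of_split_source hn rX (τ ≫ X₀.left.inv) ?_ _ ?_ ?_
    · have hd : X₀.K.d 0 1 ≫ τ = X₀.left.hom ≫ (𝟙 _ - k' ≫ k) := by
        rw [← hτ, NComplex.dFirst, Category.assoc, Iso.hom_inv_id_assoc]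
      rw [← cancel_mono X₀.left.hom, (NComplex.Lifts.id.sub (hpX.comp hiX)).1, ← hd]
      simp
    · refine (hL.of_eq ?_ rfl).f_zero
      rw [ha', Preadditive.sub_comp, Category.id_comp, Category.assoc, reassoc_of% hk, sub_self]
    · refine (hL.of_eq rfl ?_).f_last
      rw [Preadditive.sub_comp, Category.id_comp, Category.id_comp, Category.assoc, hc,
        Category.comp_id, sub_self])
    hpX.1
  obtain ⟨Φ', hΦ'⟩ := m.exists_hom m₀ iX iY (a := k) (by
    obtain ⟨τ, hτ⟩ := eY₀.exact_contravariant_last (𝟙 _ - l' ≫ l) (by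
      have e : a₀ ≫ l' ≫ l = (k' ≫ k) ≫ a₀ := by
        rw [Category.assoc, ← ha, reassoc_of% ha']
      rw [hE.push_sub, push_id, ← push_comp, e, push_comp, hδ₀', sub_self])
    have e : (iX ≫ f₀ ≫ pY) ≫ iY - iX ≫ f₀ = -((iX ≫ f₀) ≫ (𝟙 Y₀.K - pY ≫ iY)) := by
      simp only [Preadditive.comp_sub, Category.comp_id, Category.assoc, neg_sub]
    have hL := (hiX.comp hf₀).comp (NComplex.Lifts.id.sub (hpY.comp hiY))
    rw [e]
    refine NullRight.neg (eY₀.nullRight_of_split_target hn rY (τ ≫ Y₀.left.inv) ?_ _ ?_ ?_)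
    · have hd : Y₀.K.d 0 1 ≫ τ = Y₀.left.hom ≫ (𝟙 _ - l' ≫ l) := by
        rw [← hτ, NComplex.dFirst, Category.assoc, Iso.hom_inv_id_assoc]
      rw [← cancel_mono Y₀.left.hom, (NComplex.Lifts.id.sub (hpY.comp hiY)).1, ← hd]
      simp
    · refine (hL.of_eq ?_ rfl).f_zero
      rw [← ha, Preadditive.comp_sub, Category.comp_id, Category.assoc, reassoc_of% hl, sub_self]
    · refine (hL.of_eq rfl ?_).f_last
      rw [Preadditive.comp_sub, Category.comp_id, Category.comp_id, reassoc_of% hc, sub_self])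
    hiX.1
  -- The composites with the comparison morphisms of realisations are the identity at the ends, up
  -- to an error that factors through the differential `dₙ₋₁` of `Y`.
  obtain ⟨N, hN⟩ := hS.exists_mem (pull S.E Y.dLast δ)
  have eN := hS.isNExangle _ N hN
  obtain ⟨u, hu⟩ := hS.exists_lift _ _ k (iY.f n) (by
    rw [← pull_comp, hiY.dLast, pull_comp, ← h₁, push_pull]) N hN M₀ hM₀
  obtain ⟨v, hv⟩ := hS.exists_lift _ _ k' (pY.f n) (by
    rw [← pull_comp, hpY.dLast, pull_comp, ← h₂, push_pull]) M₀ hM₀ N hN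
  obtain ⟨j, rfl⟩ : ∃ j, n = j + 1 := ⟨n - 1, by omega⟩
  obtain ⟨g, hg⟩ : ∃ g, 𝟙 (Y.K.X (j + 1)) - iY.f (j + 1) ≫ pY.f (j + 1) =
      g ≫ Y.K.d j (j + 1) := by
    obtain ⟨s, hs, hs0⟩ := rY
    refine ⟨s j, (hs.succ j).trans ?_⟩
    rw [hs0, comp_zero, add_zero]
  obtain ⟨y, hy⟩ := eN.exact_covariant_last
      (𝟙 (Y.K.X (j + 1)) - iY.f (j + 1) ≫ pY.f (j + 1)) (by
    have : (𝟙 (Y.K.X (j + 1)) - iY.f (j + 1) ≫ pY.f (j + 1)) ≫ Y.dLast = 0 := by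
      rw [hg, NComplex.dLast, Category.assoc, ← Category.assoc (Y.K.d j _), Y.K.d_comp_d,
        zero_comp, comp_zero]
    rw [← pull_comp, this, hE.pull_zero])
  have hy' : (-(g ≫ m.i₂ j)) ≫ M.dLast = 𝟙 _ - iY.f (j + 1) ≫ pY.f (j + 1) := by
    have := m.i₂_d_comp (i := j) (m.p₂ (j + 1))
    rw [m.i₂_p₂ (j + 1) le_rfl, Category.comp_id] at this
    rw [Preadditive.neg_comp, Category.assoc, NComplex.dLast, m.right_hom]
    refine (congrArg (fun t => -(g ≫ t)) this).trans ?_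
    rw [Preadditive.comp_neg, neg_neg, hg]
  obtain ⟨θ, hθ⟩ := NComplex.exists_lifts_comp_dLast hn N M (-(g ≫ m.i₂ j))
  obtain ⟨θ', hθ'⟩ := NComplex.exists_lifts_comp_dLast hn M N y
  have hu' : NComplex.Lifts (X := N) (Y := M) (u ≫ Φ + θ) (𝟙 A) (𝟙 _) :=
    ((hu.comp hΦ).add hθ).of_eq (by rw [hk, add_zero]) (by rw [hy']; abel)
  have hv' : NComplex.Lifts (X := M) (Y := N) (Φ' ≫ v + θ') (𝟙 A) (𝟙 _) :=
    ((hΦ'.comp hv).add hθ').of_eq (by rw [hk, add_zero]) (by rw [hy]; abel)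
  refine ⟨iX ≫ f₀ ≫ pY, hf, M, hS.mem_of_isNExangle hN
    (m.isNExangle eX eY hf eN hu' hv' fun {W} z hz => ?_) hu' hv', m.isMappingCocone⟩
  obtain ⟨h, e₁, e₂⟩ := m₀.exists_of_isNExangle hn (hS.isNExangle _ M₀ hM₀) hf₀ (z ≫ l) (by
    rw [Category.assoc, ← hiY.dFirst, ← Category.assoc, hz, zero_comp])
  refine ⟨h ≫ k', ?_, ?_⟩
  · rw [Category.assoc, ← hpX.dFirst, ← Category.assoc, e₁, zero_comp]
  · rw [Category.assoc, ← ha', ← Category.assoc, e₂, Category.assoc, hl, Category.comp_id]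

theorem ExtData.IsNExangulated.karoubi_exists_cocone {S : ExtData.{w} n 𝒞}
    (hS : S.IsNExangulated) (hn : 1 ≤ n) {A B C : Karoubi 𝒞} (δ : Ext S.karoubi.E C A)
    (a : A ⟶ B) (Y : NComplex n B C) (hY : Y ∈ S.karoubi.s (push S.karoubi.E a δ))
    (X : NComplex n A C) (hX : X ∈ S.karoubi.s δ) :
    ∃ f : X.K ⟶ Y.K, NComplex.Lifts (X := X) (Y := Y) f a (𝟙 C) ∧
      ∃ M ∈ S.karoubi.s (pull S.karoubi.E Y.dLast δ),
        NComplex.IsMappingCocone (X := X) (Y := Y) f M := by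
  have hR := hS.isExactRealisation.isRealisation
  have hI : IsNExangulatedFunctor S S.karoubi (toKaroubi 𝒞) (karoubiGamma S.E) :=
    isNExangulatedFunctor_toKaroubi hn hR
  obtain ⟨X₁, hX₁, iX, pX, hiX, hpX, sX, hsX⟩ := exists_retract_of_mem_karoubi hX
  obtain ⟨Y₁, hY₁, iY, pY, hiY, hpY, sY, hsY⟩ := exists_retract_of_mem_karoubi hY
  obtain ⟨f, hf, M, hM, hc⟩ := hS.exists_cocone (underlying S.E δ) a.f Y₁ hY₁ X₁ hX₁
  obtain ⟨m⟩ := hc.nonempty_coconeData hn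
  refine (hR.karoubi hn).exists_cocone_of_retract (karoubiBifunctor_isBiadditive hS.isBiadditive)
    hn (δ₀ := extMap (karoubiGamma S.E) (underlying S.E δ)) (a₀ := (toKaroubi 𝒞).map a.f)
    (X₀ := X₁.map (toKaroubi 𝒞)) (Y₀ := Y₁.map (toKaroubi 𝒞)) (hI _ X₁ hX₁) (hI _ Y₁ hY₁)
    ((hf.map (toKaroubi 𝒞)).of_eq rfl ((toKaroubi 𝒞).map_id _)) (hI _ M hM)
    (m.map (toKaroubi 𝒞)) hX hY (karoubiInc_proj A) (karoubiInc_proj B) (karoubiInc_proj C)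
    hiX hpX hsX hiY hpY hsY ?_ ?_ (push_inc_eq δ) (push_proj_eq δ) ?_
  · ext
    change a.f ≫ B.p = A.p ≫ a.f
    rw [Karoubi.comp_p, Karoubi.p_comp]
  · ext
    change a.f ≫ B.p = A.p ≫ a.f
    rw [Karoubi.comp_p, Karoubi.p_comp]
  · refine underlying_injective ?_
    change pull S.E (C.p ≫ C.p) (underlying S.E δ) = underlying S.E δ
    rw [C.idem]
    exact pull_p_underlying δ

end CoconeOfRetract

/-! ### The universal property -/

section NaturalTransformations

variable {𝒞 : Type u} [Category.{v} 𝒞] {𝒞' : Type u'} [Category.{v'} 𝒞']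
  {E : Bifunctor.{w} 𝒞} {E' : Bifunctor.{w} 𝒞'} {F G : 𝒞 ⥤ 𝒞'}

lemma extMap_push (Γ : E ⟶ restrict F E') {C A B : 𝒞} (a : A ⟶ B) (δ : Ext E C A) :
    extMap Γ (push E a δ) = push E' (F.map a) (extMap Γ δ) :=
  ConcreteCategory.congr_hom ((Γ.app (op C)).naturality a) δ

lemma extMap_pull (Γ : E ⟶ restrict F E') {C D A : 𝒞} (c : D ⟶ C) (δ : Ext E C A) :
    extMap Γ (pull E c δ) = pull E' (F.map c) (extMap Γ δ) :=
  ConcreteCategory.congr_hom (NatTrans.congr_app (Γ.naturality c.op) A) δ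

/-- A natural transformation `E(-, -) ⟶ E'(F -, F -)`, given by its components. -/
def extTrans (φ : ∀ C A : 𝒞, Ext E C A →+ Ext E' (F.obj C) (F.obj A))
    (hpush : ∀ {C A B : 𝒞} (a : A ⟶ B) (δ : Ext E C A),
      φ C B (push E a δ) = push E' (F.map a) (φ C A δ))
    (hpull : ∀ {C D A : 𝒞} (c : D ⟶ C) (δ : Ext E C A),
      φ D A (pull E c δ) = pull E' (F.map c) (φ C A δ)) : E ⟶ restrict F E' where
  app C :=
    { app := fun A => AddCommGrpCat.ofHom (φ C.unop A)
      naturality := fun A B a => by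
        ext δ
        exact hpush a δ }
  naturality C D c := by
    ext A δ
    exact hpull c.unop δ

/-- The inverse of an invertible `n`-exangulated natural transformation is `n`-exangulated. -/
lemma IsNExangulatedNatTrans.natIso {Γ : E ⟶ restrict F E'} {Λ : E ⟶ restrict G E'} {β : F ≅ G}
    (h : IsNExangulatedNatTrans Γ Λ β.hom) : IsNExangulatedNatIso Γ Λ β := by
  refine ⟨h, fun {A C} δ => ?_⟩
  have e : pull E' (β.inv.app C) (pull E' (β.hom.app C) (extMap Λ δ)) = extMap Λ δ := by
    rw [← pull_comp, Iso.inv_hom_id_app, pull_id]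
  rw [← e, ← h, push_pull, ← push_comp, Iso.hom_inv_id_app, push_id]

end NaturalTransformations

section Extension

variable {n : ℕ} {𝒞 : Type u} [Category.{v} 𝒞] {𝒞' : Type u'} [Category.{v'} 𝒞']

lemma karoubiProj_comp {P Q : Karoubi 𝒞} (f : P ⟶ Q) :
    karoubiProj P ≫ f = (toKaroubi 𝒞).map f.f ≫ karoubiProj Q := by
  ext
  change P.p ≫ f.f = f.f ≫ Q.p
  rw [Karoubi.p_comp, Karoubi.comp_p]

lemma comp_karoubiInc {P Q : Karoubi 𝒞} (f : P ⟶ Q) :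
    f ≫ karoubiInc Q = karoubiInc P ≫ (toKaroubi 𝒞).map f.f := by
  ext
  change f.f ≫ Q.p = P.p ≫ f.f
  rw [Karoubi.p_comp, Karoubi.comp_p]

lemma karoubiProj_inc (P : Karoubi 𝒞) :
    karoubiProj P ≫ karoubiInc P = (toKaroubi 𝒞).map P.p := by
  ext
  exact P.idem

/-- A functor on the idempotent completion is determined by its restriction. -/
lemma map_eq_of_toKaroubi (G : Karoubi 𝒞 ⥤ 𝒞') {P Q : Karoubi 𝒞} (f : P ⟶ Q) :
    G.map f = G.map (karoubiInc P) ≫ G.map ((toKaroubi 𝒞).map f.f) ≫ G.map (karoubiProj Q) := by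
  rw [← G.map_comp, ← G.map_comp, ← karoubiProj_comp, ← Category.assoc, karoubiInc_proj,
    Category.id_comp]

lemma additive_of_toKaroubi_comp [Preadditive 𝒞] [Preadditive 𝒞'] (G : Karoubi 𝒞 ⥤ 𝒞')
    [(toKaroubi 𝒞 ⋙ G).Additive] : G.Additive where
  map_add {P Q f g} := by
    have h : G.map ((toKaroubi 𝒞).map (f.f + g.f)) =
        G.map ((toKaroubi 𝒞).map f.f) + G.map ((toKaroubi 𝒞).map g.f) :=
      (toKaroubi 𝒞 ⋙ G).map_add
    rw [map_eq_of_toKaroubi G (f + g), map_eq_of_toKaroubi G f, map_eq_of_toKaroubi G g,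
      ← Preadditive.comp_add, ← Preadditive.add_comp, ← h]
    rfl

variable {E : Bifunctor.{w} 𝒞} {E' : Bifunctor.{w} 𝒞'} {F : 𝒞 ⥤ 𝒞'} {G : Karoubi 𝒞 ⥤ 𝒞'}

/-- The inclusion of `G P` into `F P.X`, if `F` is the restriction of `G`. -/
def extensionInc (τ : F ≅ toKaroubi 𝒞 ⋙ G) (P : Karoubi 𝒞) : G.obj P ⟶ F.obj P.X :=
  G.map (karoubiInc P) ≫ τ.inv.app P.X

/-- The projection of `F P.X` onto `G P`, if `F` is the restriction of `G`. -/
def extensionProj (τ : F ≅ toKaroubi 𝒞 ⋙ G) (P : Karoubi 𝒞) : F.obj P.X ⟶ G.obj P :=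
  τ.hom.app P.X ≫ G.map (karoubiProj P)

lemma extensionInc_proj (τ : F ≅ toKaroubi 𝒞 ⋙ G) (P : Karoubi 𝒞) :
    extensionInc τ P ≫ extensionProj τ P = 𝟙 _ := by
  have h : τ.inv.app P.X ≫ τ.hom.app P.X ≫ G.map (karoubiProj P) = G.map (karoubiProj P) :=
    Iso.inv_hom_id_app_assoc τ P.X _
  rw [extensionInc, extensionProj, Category.assoc, h, ← G.map_comp, karoubiInc_proj, G.map_id]

lemma extensionProj_inc (τ : F ≅ toKaroubi 𝒞 ⋙ G) (P : Karoubi 𝒞) :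
    extensionProj τ P ≫ extensionInc τ P = F.map P.p := by
  have h : G.map ((toKaroubi 𝒞).map P.p) ≫ τ.inv.app P.X = τ.inv.app P.X ≫ F.map P.p :=
    τ.inv.naturality P.p
  rw [extensionInc, extensionProj, Category.assoc, ← Category.assoc (G.map _), ← G.map_comp,
    karoubiProj_inc, h, Iso.hom_inv_id_app_assoc]

lemma extensionProj_map (τ : F ≅ toKaroubi 𝒞 ⋙ G) {P Q : Karoubi 𝒞} (f : P ⟶ Q) :
    extensionProj τ P ≫ G.map f = F.map f.f ≫ extensionProj τ Q := by
  have h : F.map f.f ≫ τ.hom.app Q.X = τ.hom.app P.X ≫ G.map ((toKaroubi 𝒞).map f.f) :=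
    τ.hom.naturality f.f
  rw [extensionProj, extensionProj, Category.assoc, ← G.map_comp, karoubiProj_comp, G.map_comp,
    ← Category.assoc (F.map _), h, Category.assoc]

lemma map_extensionInc (τ : F ≅ toKaroubi 𝒞 ⋙ G) {P Q : Karoubi 𝒞} (f : P ⟶ Q) :
    G.map f ≫ extensionInc τ Q = extensionInc τ P ≫ F.map f.f := by
  have h : G.map ((toKaroubi 𝒞).map f.f) ≫ τ.inv.app Q.X = τ.inv.app P.X ≫ F.map f.f :=
    τ.inv.naturality f.f
  rw [extensionInc, extensionInc, Category.assoc, ← h, ← Category.assoc, ← G.map_comp,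
    comp_karoubiInc, G.map_comp, Category.assoc]

lemma extensionInc_toKaroubi (τ : F ≅ toKaroubi 𝒞 ⋙ G) (A : 𝒞) :
    extensionInc τ ((toKaroubi 𝒞).obj A) = τ.inv.app A :=
  (congrArg (· ≫ τ.inv.app A) (G.map_id _)).trans (Category.id_comp _)

lemma extensionProj_toKaroubi (τ : F ≅ toKaroubi 𝒞 ⋙ G) (A : 𝒞) :
    extensionProj τ ((toKaroubi 𝒞).obj A) = τ.hom.app A :=
  (congrArg (τ.hom.app A ≫ ·) (G.map_id _)).trans (Category.comp_id _)

/-- The extension of a transformation `Λ : E(-, -) ⟶ E'(F -, F -)` to the idempotent completion: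
it sends `δ` to the image of `Λ(δ)` under the projection of `F A.X` onto `G A` and under the
inclusion of `G C` into `F C.X`. -/
def extensionTrans (Λ : E ⟶ restrict F E') (τ : F ≅ toKaroubi 𝒞 ⋙ G) :
    karoubiBifunctor E ⟶ restrict G E' :=
  extTrans (fun C A => (push E' (extensionProj τ A)).comp ((pull E' (extensionInc τ C)).comp
      ((extMap Λ).comp (karoubiExt E C A).subtype)))
    (fun {C A B} a δ => by
      change push E' (extensionProj τ B) (pull E' (extensionInc τ C)
        (extMap Λ (push E a.f (underlying E δ)))) = push E' (G.map a) (push E' (extensionProj τ A)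
        (pull E' (extensionInc τ C) (extMap Λ (underlying E δ))))
      rw [extMap_push, ← push_pull, ← push_comp, ← push_comp, extensionProj_map])
    (fun {C D A} c δ => by
      change push E' (extensionProj τ A) (pull E' (extensionInc τ D)
        (extMap Λ (pull E c.f (underlying E δ)))) = pull E' (G.map c) (push E' (extensionProj τ A)
        (pull E' (extensionInc τ C) (extMap Λ (underlying E δ))))
      rw [extMap_pull, ← pull_comp, ← push_pull, ← pull_comp, map_extensionInc])

lemma extMap_extensionTrans (Λ : E ⟶ restrict F E') (τ : F ≅ toKaroubi 𝒞 ⋙ G) {C A : Karoubi 𝒞}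
    (δ : Ext (karoubiBifunctor E) C A) :
    extMap (extensionTrans Λ τ) δ = push E' (extensionProj τ A)
      (pull E' (extensionInc τ C) (extMap Λ (underlying E δ))) :=
  rfl

lemma isNExangulatedNatIso_extensionTrans (Λ : E ⟶ restrict F E') (τ : F ≅ toKaroubi 𝒞 ⋙ G) :
    IsNExangulatedNatIso Λ (compExt (karoubiGamma E) (extensionTrans Λ τ)) τ := by
  refine IsNExangulatedNatTrans.natIso fun {A C} δ => ?_
  rw [extMap_compExt, extMap_extensionTrans, extensionInc_toKaroubi, extensionProj_toKaroubi,
    underlying_karoubiGamma, ← push_pull]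
  have e : τ.hom.app C ≫ τ.inv.app C = 𝟙 _ := τ.hom_inv_id_app C
  exact (congrArg (push E' (τ.hom.app A))
    ((pull_comp E' (τ.inv.app C) (τ.hom.app C) (extMap Λ δ)).symm.trans
      ((congrArg (fun c => pull E' c (extMap Λ δ)) e).trans (pull_id E' _)))).symm

lemma push_extensionInc (Λ : E ⟶ restrict F E') (τ : F ≅ toKaroubi 𝒞 ⋙ G) {C A : Karoubi 𝒞}
    (δ : Ext (karoubiBifunctor E) C A) :
    push E' (extensionInc τ A) (extMap (extensionTrans Λ τ) δ) =
      pull E' (extensionInc τ C) (extMap Λ (underlying E δ)) := by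
  rw [extMap_extensionTrans, ← push_comp, extensionProj_inc, push_pull, ← extMap_push,
    push_p_underlying]

lemma push_extensionProj (Λ : E ⟶ restrict F E') (τ : F ≅ toKaroubi 𝒞 ⋙ G) {C A : Karoubi 𝒞}
    (δ : Ext (karoubiBifunctor E) C A) :
    push E' (extensionProj τ A) (extMap Λ (underlying E δ)) =
      pull E' (extensionProj τ C) (extMap (extensionTrans Λ τ) δ) := by
  rw [extMap_extensionTrans, ← push_pull, ← pull_comp, extensionProj_inc, ← extMap_pull,
    pull_p_underlying]

lemma map_comp_inv_app_comp (τ : F ≅ toKaroubi 𝒞 ⋙ G) {U U' : Karoubi 𝒞} {V V' : 𝒞}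
    {x : U ⟶ (toKaroubi 𝒞).obj V} {y : U' ⟶ (toKaroubi 𝒞).obj V'} {d : U ⟶ U'} {d' : V ⟶ V'}
    (h : x ≫ (toKaroubi 𝒞).map d' = d ≫ y) :
    (G.map x ≫ τ.inv.app V) ≫ F.map d' = G.map d ≫ G.map y ≫ τ.inv.app V' := by
  have e : G.map ((toKaroubi 𝒞).map d') ≫ τ.inv.app V' = τ.inv.app V ≫ F.map d' :=
    τ.inv.naturality d'
  rw [Category.assoc, ← e, ← Category.assoc, ← Category.assoc, ← G.map_comp, ← G.map_comp, h]

lemma hom_app_comp_map_comp (τ : F ≅ toKaroubi 𝒞 ⋙ G) {U U' : Karoubi 𝒞} {V V' : 𝒞}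
    {x : (toKaroubi 𝒞).obj V ⟶ U} {y : (toKaroubi 𝒞).obj V' ⟶ U'} {d : U ⟶ U'} {d' : V ⟶ V'}
    (h : (toKaroubi 𝒞).map d' ≫ y = x ≫ d) :
    (τ.hom.app V ≫ G.map x) ≫ G.map d = F.map d' ≫ τ.hom.app V' ≫ G.map y := by
  have e : F.map d' ≫ τ.hom.app V' = τ.hom.app V ≫ G.map ((toKaroubi 𝒞).map d') :=
    τ.hom.naturality d'
  rw [← Category.assoc (F.map d'), e, Category.assoc, Category.assoc, ← G.map_comp, ← G.map_comp, h]

lemma map_comp_inv_app_comp_hom_app (τ : F ≅ toKaroubi 𝒞 ⋙ G) {U U' : Karoubi 𝒞} {V : 𝒞}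
    (x : U ⟶ (toKaroubi 𝒞).obj V) (y : (toKaroubi 𝒞).obj V ⟶ U') :
    (G.map x ≫ τ.inv.app V) ≫ τ.hom.app V ≫ G.map y = G.map (x ≫ y) := by
  have e : τ.inv.app V ≫ τ.hom.app V ≫ G.map y = G.map y := Iso.inv_hom_id_app_assoc τ V _
  rw [Category.assoc, e, G.map_comp]

variable [Preadditive 𝒞] [Preadditive 𝒞'] [F.Additive] [G.Additive]

/-- An extension of an `n`-exangulated functor to the idempotent completion is `n`-exangulated,
since the image of a realisation `Z` is a homotopy retract of the image of a realisation in `𝒞`. -/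
theorem isNExangulatedFunctor_extensionTrans {S : ExtData.{w} n 𝒞} {S' : ExtData.{w} n 𝒞'}
    (hS' : S'.IsRealisation) {Λ : S.E ⟶ restrict F S'.E} (hΛ : IsNExangulatedFunctor S S' F Λ)
    (τ : F ≅ toKaroubi 𝒞 ⋙ G) :
    IsNExangulatedFunctor S.karoubi S' G (extensionTrans Λ τ) := by
  intro A C δ Z hZ
  obtain ⟨X, hX, i, p, hi, hp, h, hh⟩ := ExtData.exists_retract_of_mem_karoubi hZ
  let i' : (Z.map G).K ⟶ (X.map F).K :=
    { f := fun j => G.map (i.f j) ≫ τ.inv.app (X.K.X j)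
      comm' := fun j k _ => map_comp_inv_app_comp τ (i.comm j k) }
  let p' : (X.map F).K ⟶ (Z.map G).K :=
    { f := fun j => τ.hom.app (X.K.X j) ≫ G.map (p.f j)
      comm' := fun j k _ => hom_app_comp_map_comp τ (p.comm j k).symm }
  refine hS'.mem_of_retract (hΛ _ X hX) (i := i') (p := p')
    ⟨map_comp_inv_app_comp τ hi.1, map_comp_inv_app_comp τ hi.2⟩
    ⟨hom_app_comp_map_comp τ hp.1.symm, hom_app_comp_map_comp τ hp.2.symm⟩
    (extensionInc_proj τ A) (extensionInc_proj τ C) (push_extensionInc Λ τ δ)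
    (push_extensionProj Λ τ δ) fun j _ => ?_
  obtain ⟨s, t, hst⟩ := exists_of_nullHtpy_id_sub hh j
  have e := congrArg G.map hst
  rw [G.map_add, G.map_add, G.map_id, G.map_comp s, G.map_comp (Z.K.d _ _)] at e
  exact ⟨G.map s, G.map t, (map_comp_inv_app_comp_hom_app τ (i.f (j + 1)) (p.f (j + 1))).trans e⟩

end Extension

section Uniqueness

variable {𝒞 : Type u} [Category.{v} 𝒞] {𝒞' : Type u'} [Category.{v'} 𝒞']
  {E : Bifunctor.{w} 𝒞} {E' : Bifunctor.{w} 𝒞'} {G H : Karoubi 𝒞 ⥤ 𝒞'}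

lemma eq_push_pull_karoubiGamma {C A : Karoubi 𝒞} (δ : Ext (karoubiBifunctor E) C A) :
    δ = push (karoubiBifunctor E) (karoubiProj A) (pull (karoubiBifunctor E) (karoubiInc C)
      (extMap (karoubiGamma E) (underlying E δ))) := by
  rw [← push_inc_eq, ← push_comp, karoubiInc_proj, push_id]

/-- A natural transformation of functors on the idempotent completion is `n`-exangulated as soon as
its restriction is. -/
lemma isNExangulatedNatTrans_of_restriction {Θ : karoubiBifunctor E ⟶ restrict G E'}
    {Φ : karoubiBifunctor E ⟶ restrict H E'} {μ : G ⟶ H}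
    (h : ∀ {A C : 𝒞} (δ : Ext E C A),
      push E' (μ.app ((toKaroubi 𝒞).obj A)) (extMap Θ (extMap (karoubiGamma E) δ)) =
        pull E' (μ.app ((toKaroubi 𝒞).obj C)) (extMap Φ (extMap (karoubiGamma E) δ))) :
    IsNExangulatedNatTrans Θ Φ μ := by
  intro A C δ
  rw [eq_push_pull_karoubiGamma δ, extMap_push, extMap_push, extMap_pull, extMap_pull,
    ← push_comp, μ.naturality, push_comp, ← push_pull, push_pull _ (μ.app _), h, ← pull_comp,
    ← pull_comp, μ.naturality]

end Uniqueness

end NExang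

open NExang in
theorem theorem4p22 {n : ℕ} (hn : 1 ≤ n)
    {𝒞 : Type u} [Category.{v} 𝒞] [Preadditive 𝒞] [HasFiniteBiproducts 𝒞]
    (S : ExtData.{w} n 𝒞) (hS : S.IsNExangulated) :
    S.karoubi.IsNExangulated ∧ IsIdempotentComplete (Karoubi 𝒞) ∧
    IsNExangulatedFunctor S S.karoubi (toKaroubi 𝒞) (karoubiGamma S.E) ∧
    ∀ {𝒞' : Type u'} [Category.{v'} 𝒞'] [Preadditive 𝒞'] [HasFiniteBiproducts 𝒞']
      [IsIdempotentComplete 𝒞'] (S' : ExtData.{w} n 𝒞') (_ : S'.IsNExangulated)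
      (F : 𝒞 ⥤ 𝒞') [F.Additive] (Λ : S.E ⟶ restrict F S'.E)
      (_ : IsNExangulatedFunctor S S' F Λ),
      (∃ (G : Karoubi 𝒞 ⥤ 𝒞') (_ : G.Additive) (Ψ : S.karoubi.E ⟶ restrict G S'.E)
        (τ : F ≅ toKaroubi 𝒞 ⋙ G),
        IsNExangulatedFunctor S.karoubi S' G Ψ ∧
        IsNExangulatedNatIso Λ (compExt (karoubiGamma S.E) Ψ) τ) ∧
      (∀ (G H : Karoubi 𝒞 ⥤ 𝒞') [G.Additive] [H.Additive]
        (Θ : S.karoubi.E ⟶ restrict G S'.E) (Φ : S.karoubi.E ⟶ restrict H S'.E)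
        (_ : IsNExangulatedFunctor S.karoubi S' G Θ) (_ : IsNExangulatedFunctor S.karoubi S' H Φ)
        (β : F ≅ toKaroubi 𝒞 ⋙ G) (γ : F ≅ toKaroubi 𝒞 ⋙ H)
        (_ : IsNExangulatedNatIso Λ (compExt (karoubiGamma S.E) Θ) β)
        (_ : IsNExangulatedNatIso Λ (compExt (karoubiGamma S.E) Φ) γ),
        ∃ μ : G ≅ H, IsNExangulatedNatIso Θ Φ μ ∧
          γ = β ≪≫ Functor.isoWhiskerLeft (toKaroubi 𝒞) μ ∧
          ∀ μ' : G ≅ H, γ = β ≪≫ Functor.isoWhiskerLeft (toKaroubi 𝒞) μ' → μ' = μ) := by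
  have : HasBinaryBiproducts 𝒞 := hasBinaryBiproducts_of_finite_biproducts 𝒞
  refine ⟨⟨karoubiBifunctor_isBiadditive hS.isBiadditive,
    hS.isExactRealisation.karoubi hn hS.isBiadditive,
    fun g h hg hh => hS.karoubi_inflation_comp hn hg hh,
    fun g h hg hh => hS.karoubi_deflation_comp hn hg hh,
    hS.karoubi_exists_cone hn, hS.karoubi_exists_cocone hn⟩, inferInstance,
    isNExangulatedFunctor_toKaroubi hn hS.isExactRealisation.isRealisation, ?_⟩
  intro 𝒞' _ _ _ _ S' hS' F _ Λ hΛ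
  refine ⟨?_, ?_⟩
  · let W := (Functor.whiskeringLeft 𝒞 (Karoubi 𝒞) 𝒞').obj (toKaroubi 𝒞)
    let G : Karoubi 𝒞 ⥤ 𝒞' := W.objPreimage F
    let τ : F ≅ toKaroubi 𝒞 ⋙ G := (W.objObjPreimageIso F).symm
    have : (toKaroubi 𝒞 ⋙ G).Additive := Functor.additive_of_iso τ
    have hG : G.Additive := additive_of_toKaroubi_comp G
    exact ⟨G, hG, extensionTrans Λ τ, τ,
      isNExangulatedFunctor_extensionTrans hS'.isExactRealisation.isRealisation hΛ τ,
      isNExangulatedNatIso_extensionTrans Λ τ⟩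
  · intro G H _ _ Θ Φ _ _ β γ hβ hγ
    let W := whiskeringLeftObjToKaroubiFullyFaithful (C := 𝒞) (D := 𝒞')
    let μ : G ≅ H := W.preimageIso (β.symm ≪≫ γ)
    have hμ : Functor.isoWhiskerLeft (toKaroubi 𝒞) μ = β.symm ≪≫ γ := by
      ext1
      exact W.map_preimage (β.symm ≪≫ γ).hom
    have hμ' : ∀ A, μ.hom.app ((toKaroubi 𝒞).obj A) = β.inv.app A ≫ γ.hom.app A := fun A =>
      congrArg (fun ν : toKaroubi 𝒞 ⋙ G ≅ toKaroubi 𝒞 ⋙ H => ν.hom.app A) hμ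
    have hΘ : IsNExangulatedNatTrans Θ Φ μ.hom := by
      refine isNExangulatedNatTrans_of_restriction fun {A C} δ => ?_
      rw [hμ', hμ', push_comp, pull_comp]
      refine (congrArg (push S'.E (γ.hom.app A)) (hβ.2 δ)).trans ?_
      rw [push_pull]
      exact congrArg (pull S'.E (β.inv.app C)) (hγ.1 δ)
    refine ⟨μ, IsNExangulatedNatTrans.natIso hΘ, ?_, fun μ' h => ?_⟩
    · rw [hμ, Iso.self_symm_id_assoc]
    · ext1
      refine W.map_injective ?_
      have : Functor.isoWhiskerLeft (toKaroubi 𝒞) μ' = Functor.isoWhiskerLeft (toKaroubi 𝒞) μ := by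
        rw [hμ, h, Iso.symm_self_id_assoc]
      exact congrArg Iso.hom this
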